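/- **Conventions.** Let $\mathbb R$ be a regular category (finite limits, coequalizers of kernel pairs, regular epimorphisms stable under pullback). Fibrations $\mathcal C=(p:|\mathcal C|\to\mathbb R)$ are Grothendieck fibrations; fibered functors commute strictly with the projections and preserve cartesian maps; fibered natural transformations have vertical components. A *finite-limit pre-stack* is a fibration whose fibers have finite limits, preserved by reindexing, and such that for every regular epimorphism $e:J\to I$ in $\mathbb R$ the comparison functor from $\mathcal C_I$ to descent data along $e$ is full and faithful. $\mathbf{Lex}(\mathbb R)$ is the 2-category of finite-limit pre-stacks, fibered functors preserving fiberwise finite limits, and fibered natural transformations. A *fibered pretopos* is a pre-stack whose fibers are (Barr-)exact categories, whose reindexing functors are regular (preserve finite limits and regular epimorphisms), and which has extensive internal sums: it is also an opfibration satisfying the Beck–Chevalley condition, cocartesian maps are stable under pullback in the total category, and the diagonal $A\to A\times_BA$ of each cocartesian map $A\to B$ is cocartesian. $\mathbf{Pretop}(\mathbb R)$ is the 2-category of fibered pretoposes, fibered functors that are fiberwise regular and preserve cocartesian maps, and fibered natural transformations. **Presheaves.** Let $\mathcal C$ be a finite-limit pre-stack. A map of $|\mathcal C|$ is *cover-cartesian*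 if it is cartesian over a regular epimorphism. A predicate on $X\in|\mathcal C|$ is a morphism into $X$, and for $f,g$ with codomain $X$ put $f\le g$ iff $f\circ e=g\circ k$ for some cover-cartesian $e$ and some $k$. This gives an indexed preorder on $|\mathcal C|$ which models regular logic (conjunction is pullback, existential quantification is postcomposition). Let $\mathbb R\{\mathcal C\}$ be the category whose objects are pairs $(C,\rho)$ of an object of $|\mathcal C|$ and a total equivalence relation on it, and whose morphisms are functional relations up to logical equivalence, both in this logic. Let $\Delta:\mathbb R\to\mathbb R\{\mathcal C\}$ send $I$ to $(1_I,=)$, where $1_I$ is terminal in $\mathcal C_I$, and send $u:J\to I$ to the graph of the unique $1_u:1_J\to1_I$ over $u$. The *fibration of presheaves* $\widehat{\mathcal C}$ is the projection to $\mathbb R$ of the comma category $\mathbb R\{\mathcal C\}\downarrow\Delta$. The *fibered Yoneda embedding* $Y:\mathcal C\to\widehat{\mathcal C}$ sends $C\in\mathcal C_I$ to $(C,=)$ with the graph of $C\to1_I$ as map to $\Delta I$, and sends morphisms to their graphs. **Lemma.** For every finite-limit pre-stack $\mathcal C$ on $\mathbb R$: 1. $Y:\mathcal C\to\widehat{\mathcal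 C}$ is full and faithful; 2. $\widehat{\mathcal C}$ is a fibered pretopos, $Y$ is a finite-limit preserving fibered functor, and for every fibered pretopos $\mathcal X$ on $\mathbb R$ precomposition with $Y$ is an equivalence of categories $\mathbf{Pretop}(\mathbb R)(\widehat{\mathcal C},\mathcal X)\simeq\mathbf{Lex}(\mathbb R)(\mathcal C,\mathcal X)$. Consequently, when $\mathbb R$ and all fibrations are small relative to a universe, $\mathcal C\mapsto\widehat{\mathcal C}$ is the object part of a pseudofunctor $\mathbf{Lex}(\mathbb R)\to\mathbf{Pretop}(\mathbb R)$ that is left biadjoint to the forgetful functor $U:\mathbf{Pretop}(\mathbb R)\to\mathbf{Lex}(\mathbb R)$, with unit $Y$: the embeddings $Y_{\mathcal C}$ are the components of a pseudonatural transformation from the identity to $U\circ\widehat{(-)}$, and the functors $\mathbf{Pretop}(\mathbb R)(\widehat{\mathcal C},\mathcal X)\to\mathbf{Lex}(\mathbb R)(\mathcal C,U\mathcal X)$, $G\mapsto UG\circ Y_{\mathcal C}$, are equivalences. -/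

import Mathlib

open CategoryTheory CategoryTheory.Limits CategoryTheory.Functor

universe w v₁ u₁ v₂ u₂ v₃ u₃ v₄ u₄

namespace FibPsh

section Fibrations

variable {R : Type u₁} [Category.{v₁} R] {E : Type u₂} [Category.{v₂} E] (p : E ⥤ R)

/-- `f` is cartesian over its image in the base. -/
def IsCart {A B : E} (f : A ⟶ B) : Prop := p.IsStronglyCartesian (p.map f) f

/-- `f` is cocartesian over its image in the base. -/
def IsCocart {A B : E} (f : A ⟶ B) : Prop := p.IsStronglyCocartesian (p.map f) f

/-- Cover-cartesian maps: cartesian maps over regular epimorphisms. -/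
def IsCover {A B : E} (e : A ⟶ B) : Prop := IsCart p e ∧ IsRegularEpi (p.map e)

open Functor.IsPreFibered in
/-- The reindexing functor `u^* : E_I ⥤ E_J` of a fibration along `u : J ⟶ I`. -/
noncomputable def reindex [p.IsFibered] {J I : R} (u : J ⟶ I) : p.Fiber I ⥤ p.Fiber J where
  obj A := ⟨pullbackObj A.2 u, pullbackObj_proj A.2 u⟩
  map {A B} f :=
    haveI := f.2
    ⟨IsCartesian.map p u (pullbackMap B.2 u) (pullbackMap A.2 u ≫ f.1), inferInstance⟩
  map_id A := by
    apply Subtype.ext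
    have := (𝟙 A : A ⟶ A).2
    have : p.IsHomLift (𝟙 J) (𝟙 (pullbackObj A.2 u)) := IsHomLift.id (pullbackObj_proj A.2 u)
    exact (IsCartesian.map_uniq p u (pullbackMap A.2 u) _ (𝟙 _)
      (by change 𝟙 _ ≫ _ = _ ≫ 𝟙 _; simp)).symm
  map_comp {A B C} f g := by
    apply Subtype.ext
    have := f.2
    have := g.2
    have := (f ≫ g).2
    refine (IsCartesian.map_uniq p u (pullbackMap C.2 u) (pullbackMap A.2 u ≫ (f ≫ g).1)
      (IsCartesian.map p u (pullbackMap B.2 u) (pullbackMap A.2 u ≫ f.1) ≫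
        IsCartesian.map p u (pullbackMap C.2 u) (pullbackMap B.2 u ≫ g.1)) ?_).symm
    rw [Category.assoc, IsCartesian.fac, ← Category.assoc, IsCartesian.fac, Category.assoc]
    rfl

/-- The chosen cartesian lifting `u^* A ⟶ A`. -/
noncomputable def lift [p.IsFibered] {J I : R} (u : J ⟶ I) (A : p.Fiber I) :
    ((reindex p u).obj A).1 ⟶ A.1 :=
  IsPreFibered.pullbackMap A.2 u

instance [p.IsFibered] {J I : R} (u : J ⟶ I) (A : p.Fiber I) :
    p.IsStronglyCartesian u (lift p u A) :=
  inferInstanceAs (p.IsStronglyCartesian u (IsPreFibered.pullbackMap A.2 u))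

lemma reindex_map_lift [p.IsFibered] {J I : R} (u : J ⟶ I) {A B : p.Fiber I} (f : A ⟶ B) :
    ((reindex p u).map f).1 ≫ lift p u B = lift p u A ≫ f.1 :=
  have := f.2
  IsCartesian.fac p u (IsPreFibered.pullbackMap B.2 u) (IsPreFibered.pullbackMap A.2 u ≫ f.1)

/-- The canonical descent datum of an object `e^* A`: the vertical comparison
`d₁^* e^* A ⟶ d₀^* e^* A` compatible with the cartesian projections to `A`, for `d₀ e = d₁ e`. -/
noncomputable def canonicalDescent [p.IsFibered] {K J I : R} (e : J ⟶ I) {d₀ d₁ : K ⟶ J}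
    (h : d₀ ≫ e = d₁ ≫ e) (A : p.Fiber I) :
    (reindex p d₁).obj ((reindex p e).obj A) ⟶ (reindex p d₀).obj ((reindex p e).obj A) :=
  ⟨IsStronglyCartesian.map p (d₀ ≫ e) (lift p d₀ ((reindex p e).obj A) ≫ lift p e A)
      (g := 𝟙 K) (f' := d₁ ≫ e) (by rw [Category.id_comp, h])
      (lift p d₁ ((reindex p e).obj A) ≫ lift p e A), inferInstance⟩

/-- A fibration is a pre-stack (for the regular topology) if for each regular epimorphism
`e : J ⟶ I` with kernel pair `d₀, d₁`, the functor sending `A` over `I` to `e^* A` with its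
canonical descent datum is full and faithful: each morphism of descent data `f` between
`e^* A` and `e^* B` is `e^* h` for a unique vertical `h`. -/
def IsPreStack [p.IsFibered] : Prop :=
  ∀ ⦃K J I : R⦄ (e : J ⟶ I) (d₀ d₁ : K ⟶ J), IsRegularEpi e → ∀ hk : IsKernelPair e d₀ d₁,
    ∀ (A B : p.Fiber I) (f : (reindex p e).obj A ⟶ (reindex p e).obj B),
      canonicalDescent p e hk.w A ≫ (reindex p d₀).map f =
          (reindex p d₁).map f ≫ canonicalDescent p e hk.w B →
        ∃! h : A ⟶ B, (reindex p e).map h = f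

/-- Finite limit fibrations: the fibers have finite limits, preserved by reindexing. -/
class IsLexFibration : Prop extends p.IsFibered where
  hasFiniteLimits : ∀ I : R, HasFiniteLimits (p.Fiber I)
  preservesFiniteLimits : ∀ ⦃J I : R⦄ (u : J ⟶ I), PreservesFiniteLimits (reindex p u)

attribute [instance] IsLexFibration.hasFiniteLimits IsLexFibration.preservesFiniteLimits

/-- Finite-limit pre-stacks. -/
class IsLexPreStack : Prop extends IsLexFibration p where
  isPreStack : IsPreStack p

/-- Extensive (stable and disjoint) internal sums. -/
structure HasExtensiveSums : Prop where
  /-- `p` is an opfibration. -/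
  exists_cocart : ∀ (A : E) ⦃I : R⦄ (u : p.obj A ⟶ I),
    ∃ (B : E) (s : A ⟶ B), p.IsStronglyCocartesian u s
  /-- The Beck-Chevalley condition. -/
  beckChevalley : ∀ ⦃P A B C : E⦄ ⦃g' : P ⟶ A⦄ ⦃s' : P ⟶ C⦄ ⦃s : A ⟶ B⦄ ⦃g : C ⟶ B⦄,
    IsPullback g' s' s g → IsCocart p s → IsCart p g → IsCocart p s'
  /-- Sums are stable: cocartesian maps are stable under arbitrary pullbacks. -/
  stable : ∀ ⦃P A B C : E⦄ ⦃g' : P ⟶ A⦄ ⦃s' : P ⟶ C⦄ ⦃s : A ⟶ B⦄ ⦃g : C ⟶ B⦄,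
    IsPullback g' s' s g → IsCocart p s → IsCocart p s'
  /-- Sums are disjoint: the diagonal `A ⟶ A ×_B A` of a cocartesian map is cocartesian. -/
  disjoint : ∀ ⦃P A B : E⦄ ⦃q₀ q₁ : P ⟶ A⦄ ⦃s : A ⟶ B⦄ (d : A ⟶ P),
    IsPullback q₀ q₁ s s → IsCocart p s → d ≫ q₀ = 𝟙 A → d ≫ q₁ = 𝟙 A → IsCocart p d

/-- Regular functors preserve finite limits and regular epimorphisms. -/
structure IsRegularFunctor {A : Type u₃} [Category.{v₃} A] {B : Type u₄} [Category.{v₄} B]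
    (F : A ⥤ B) : Prop where
  preservesFiniteLimits : PreservesFiniteLimits F
  map_regularEpi : ∀ ⦃X Y : A⦄ (f : X ⟶ Y), IsRegularEpi f → IsRegularEpi (F.map f)

/-- (Barr-)exact categories: regular categories in which equivalence relations are kernel pairs. -/
structure IsExact (A : Type u₃) [Category.{v₃} A] : Prop where
  regular : Regular A
  effective : ∀ ⦃S X : A⦄ (r₁ r₂ : S ⟶ X), IsEquivalenceRelation r₁ r₂ →
    ∃ (Q : A) (q : X ⟶ Q), IsKernelPair q r₁ r₂

/-- Fibered pretoposes: pre-stacks of exact categories with extensive internal sums. -/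
class IsFiberedPretopos : Prop extends p.IsFibered where
  isPreStack : IsPreStack p
  isExact : ∀ I : R, IsExact (p.Fiber I)
  isRegularFunctor : ∀ ⦃J I : R⦄ (u : J ⟶ I), IsRegularFunctor (reindex p u)
  hasExtensiveSums : HasExtensiveSums p

instance IsFiberedPretopos.isLexPreStack [IsFiberedPretopos p] : IsLexPreStack p where
  hasFiniteLimits I := (IsFiberedPretopos.isExact (p := p) I).regular.toHasFiniteLimits
  preservesFiniteLimits _ _ u :=
    (IsFiberedPretopos.isRegularFunctor (p := p) u).preservesFiniteLimits
  isPreStack := IsFiberedPretopos.isPreStack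

end Fibrations

section TotalCategory

variable {R : Type u₁} [Category.{v₁} R] {E : Type u₂} [Category.{v₂} E] (p : E ⥤ R)

lemma hom_ext_lift [p.IsFibered] {J I : R} (u : J ⟶ I) (A : p.Fiber I) {T : E} {K : R}
    (t : K ⟶ J) {x y : T ⟶ ((reindex p u).obj A).1} (hx : p.IsHomLift t x) (hy : p.IsHomLift t y)
    (h : x ≫ lift p u A = y ≫ lift p u A) : x = y :=
  IsStronglyCartesian.ext p u (lift p u A) t h

lemma exists_factor_lift [p.IsFibered] {J I : R} (u : J ⟶ I) (A : p.Fiber I) {T : E} {K : R}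
    (t : K ⟶ J) (x : T ⟶ A.1) (hx : p.IsHomLift (t ≫ u) x) :
    ∃ x' : T ⟶ ((reindex p u).obj A).1, p.IsHomLift t x' ∧ x' ≫ lift p u A = x :=
  ⟨IsStronglyCartesian.map p u (lift p u A) (g := t) rfl x, inferInstance,
    IsStronglyCartesian.fac ..⟩

/-- Pullbacks in a fiber of a finite limit fibration are pullbacks in the total category. -/
lemma isPullback_total [IsLexFibration p] {I : R} {D A B C : p.Fiber I} {a : D ⟶ A} {b : D ⟶ B}
    {f : A ⟶ C} {g : B ⟶ C} (h : IsPullback a b f g) {T : E} {K : R} (t : K ⟶ I)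
    (x : T ⟶ A.1) (y : T ⟶ B.1) (hx : p.IsHomLift t x) (hy : p.IsHomLift t y)
    (hxy : x ≫ f.1 = y ≫ g.1) :
    ∃! d : T ⟶ D.1, p.IsHomLift t d ∧ d ≫ a.1 = x ∧ d ≫ b.1 = y := by
  obtain ⟨x', hx', rfl⟩ := exists_factor_lift p t A (𝟙 K) x (by simpa using hx)
  obtain ⟨y', hy', rfl⟩ := exists_factor_lift p t B (𝟙 K) y (by simpa using hy)
  have hT : p.obj T = K := IsHomLift.domain_eq p (𝟙 K) x'
  let T' : p.Fiber K := ⟨T, hT⟩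
  let x₁ : T' ⟶ (reindex p t).obj A := ⟨x', hx'⟩
  let y₁ : T' ⟶ (reindex p t).obj B := ⟨y', hy'⟩
  have h' := h.map (reindex p t)
  have e : x₁ ≫ (reindex p t).map f = y₁ ≫ (reindex p t).map g := by
    apply Subtype.ext
    refine hom_ext_lift p t C (𝟙 K) (Subtype.property _) (Subtype.property _) ?_
    change (x' ≫ ((reindex p t).map f).1) ≫ _ = (y' ≫ ((reindex p t).map g).1) ≫ _
    rw [Category.assoc, Category.assoc, reindex_map_lift, reindex_map_lift, ← Category.assoc,
      ← Category.assoc, hxy]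
  have hd := (h'.lift x₁ y₁ e).2
  refine ⟨(h'.lift x₁ y₁ e).1 ≫ lift p t D, ⟨?_, ?_, ?_⟩, ?_⟩
  · infer_instance
  · rw [Category.assoc, ← reindex_map_lift, ← Category.assoc]
    exact congrArg (· ≫ lift p t A) (congrArg Subtype.val (h'.lift_fst x₁ y₁ e))
  · rw [Category.assoc, ← reindex_map_lift, ← Category.assoc]
    exact congrArg (· ≫ lift p t B) (congrArg Subtype.val (h'.lift_snd x₁ y₁ e))
  · rintro d ⟨hd, hda, hdb⟩
    obtain ⟨d', hd', rfl⟩ := exists_factor_lift p t D (𝟙 K) d (by simpa using hd)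
    congr 1
    let d₁ : T' ⟶ (reindex p t).obj D := ⟨d', hd'⟩
    suffices d₁ = h'.lift x₁ y₁ e from congrArg Subtype.val this
    apply h'.hom_ext
    · rw [h'.lift_fst]
      apply Subtype.ext
      refine hom_ext_lift p t A (𝟙 K) (Subtype.property _) (Subtype.property _) ?_
      change (d' ≫ ((reindex p t).map a).1) ≫ _ = _
      rw [Category.assoc, reindex_map_lift, ← Category.assoc]
      exact hda
    · rw [h'.lift_snd]
      apply Subtype.ext
      refine hom_ext_lift p t B (𝟙 K) (Subtype.property _) (Subtype.property _) ?_
      change (d' ≫ ((reindex p t).map b).1) ≫ _ = _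
      rw [Category.assoc, reindex_map_lift, ← Category.assoc]
      exact hdb

/-- The total category of a finite limit fibration on a base with pullbacks has pullbacks. -/
lemma hasPullbacks_total [HasPullbacks R] [IsLexFibration p] : HasPullbacks E := by
  suffices ∀ {A B C : E} (f : A ⟶ C) (g : B ⟶ C), HasPullback f g from
    hasPullbacks_of_hasLimit_cospan E
  intro A B C f g
  let π₀ := pullback.fst (p.map f) (p.map g)
  let π₁ := pullback.snd (p.map f) (p.map g)
  have hw : π₀ ≫ p.map f = π₁ ≫ p.map g := pullback.condition
  let A₀ : p.Fiber (p.obj A) := ⟨A, rfl⟩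
  let B₀ : p.Fiber (p.obj B) := ⟨B, rfl⟩
  let C₀ : p.Fiber (p.obj C) := ⟨C, rfl⟩
  obtain ⟨α, hα, hα'⟩ := exists_factor_lift p (π₀ ≫ p.map f) C₀ (𝟙 _) (lift p π₀ A₀ ≫ f)
    (by rw [Category.id_comp]; infer_instance)
  obtain ⟨β, hβ, hβ'⟩ := exists_factor_lift p (π₀ ≫ p.map f) C₀ (𝟙 _) (lift p π₁ B₀ ≫ g)
    (by rw [Category.id_comp, hw]; infer_instance)
  let α₁ : (reindex p π₀).obj A₀ ⟶ (reindex p (π₀ ≫ p.map f)).obj C₀ := ⟨α, hα⟩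
  let β₁ : (reindex p π₁).obj B₀ ⟶ (reindex p (π₀ ≫ p.map f)).obj C₀ := ⟨β, hβ⟩
  obtain ⟨D, a, b, h⟩ : ∃ (D : p.Fiber (pullback (p.map f) (p.map g))) (a : D ⟶ _) (b : D ⟶ _),
    IsPullback a b α₁ β₁ := ⟨_, _, _, IsPullback.of_hasPullback α₁ β₁⟩
  have ha := a.2
  have hb := b.2
  have sq : a.1 ≫ α = b.1 ≫ β := congrArg Subtype.val h.w
  have comm : (a.1 ≫ lift p π₀ A₀) ≫ f = (b.1 ≫ lift p π₁ B₀) ≫ g := by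
    rw [Category.assoc, Category.assoc, ← hα', ← hβ', ← Category.assoc, ← Category.assoc, sq]
  have univ : ∀ {T : E} (x : T ⟶ A) (y : T ⟶ B), x ≫ f = y ≫ g →
      ∃! d : T ⟶ D.1, d ≫ a.1 ≫ lift p π₀ A₀ = x ∧ d ≫ b.1 ≫ lift p π₁ B₀ = y := by
    intro T x y hxy
    have hpxy : p.map x ≫ p.map f = p.map y ≫ p.map g := by
      rw [← p.map_comp, ← p.map_comp, hxy]
    let t := pullback.lift (p.map x) (p.map y) hpxy
    have ht₀ : t ≫ π₀ = p.map x := pullback.lift_fst ..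
    have ht₁ : t ≫ π₁ = p.map y := pullback.lift_snd ..
    obtain ⟨x', hx', hxx'⟩ := exists_factor_lift p π₀ A₀ t x (by rw [ht₀]; infer_instance)
    obtain ⟨y', hy', hyy'⟩ := exists_factor_lift p π₁ B₀ t y (by rw [ht₁]; infer_instance)
    have e : x' ≫ α = y' ≫ β := by
      refine hom_ext_lift p (π₀ ≫ p.map f) C₀ t (x := x' ≫ α) (y := y' ≫ β) inferInstance
        inferInstance ?_
      rw [Category.assoc, Category.assoc, hα', hβ', ← Category.assoc, ← Category.assoc,
        hxx', hyy', hxy]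
    obtain ⟨d, ⟨hd, hda, hdb⟩, hu⟩ := isPullback_total p h t x' y' hx' hy' e
    refine ⟨d, ⟨?_, ?_⟩, ?_⟩
    · rw [← Category.assoc, hda, hxx']
    · rw [← Category.assoc, hdb, hyy']
    · rintro d' ⟨h₀, h₁⟩
      have hd' : p.IsHomLift t d' := by
        have hD := D.2
        apply IsHomLift.of_fac p t d' rfl hD
        simp only [eqToHom_refl, Category.id_comp]
        apply pullback.hom_ext
        · change t ≫ π₀ = _ ≫ π₀
          rw [ht₀, ← h₀, p.map_comp, IsHomLift.fac' p π₀ (a.1 ≫ lift p π₀ A₀)]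
          simp
        · change t ≫ π₁ = _ ≫ π₁
          rw [ht₁, ← h₁, p.map_comp, IsHomLift.fac' p π₁ (b.1 ≫ lift p π₁ B₀)]
          simp
      refine hu d' ⟨hd', ?_, ?_⟩
      · refine hom_ext_lift p π₀ A₀ t inferInstance hx' ?_
        rw [Category.assoc, h₀, hxx']
      · refine hom_ext_lift p π₁ B₀ t inferInstance hy' ?_
        rw [Category.assoc, h₁, hyy']
  have key : IsPullback (a.1 ≫ lift p π₀ A₀) (b.1 ≫ lift p π₁ B₀) f g :=
    ⟨⟨comm⟩, ⟨PullbackCone.IsLimit.mk comm (fun s => (univ s.fst s.snd s.condition).choose)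
      (fun s => (univ s.fst s.snd s.condition).choose_spec.1.1)
      (fun s => (univ s.fst s.snd s.condition).choose_spec.1.2)
      (fun s m h₀ h₁ => (univ s.fst s.snd s.condition).choose_spec.2 m ⟨h₀, h₁⟩)⟩⟩
  exact key.hasPullback

lemma IsCover.of_lift {J I : R} {A B : E} (u : J ⟶ I) (e : A ⟶ B)
    [h : p.IsStronglyCartesian u e] (hu : IsRegularEpi u) : IsCover p e := by
  have hl : p.IsHomLift u e := h.toIsHomLift
  obtain ⟨⟩ := hl
  exact ⟨h, hu⟩

/-- Cover-cartesian maps can be pulled back along arbitrary maps. -/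
lemma IsCover.exists_pullback [Regular R] [p.IsFibered] {B' B A : E} {e : B' ⟶ B}
    (he : IsCover p e) (f : A ⟶ B) :
    ∃ (A' : E) (e' : A' ⟶ A) (f' : A' ⟶ B'), IsCover p e' ∧ f' ≫ e = e' ≫ f := by
  obtain ⟨hc, hr⟩ := he
  have hc' : p.IsStronglyCartesian (p.map e) e := hc
  let A₀ : p.Fiber (p.obj A) := ⟨A, rfl⟩
  let π := pullback.fst (p.map f) (p.map e)
  have hπ : π ≫ p.map f = pullback.snd (p.map f) (p.map e) ≫ p.map e := pullback.condition
  have : p.IsHomLift (π ≫ p.map f) (lift p π A₀ ≫ f) := inferInstance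
  exact ⟨_, lift p π A₀, IsStronglyCartesian.map p (p.map e) e hπ (lift p π A₀ ≫ f),
    IsCover.of_lift p π _ inferInstance, IsStronglyCartesian.fac ..⟩

lemma IsCover.comp [Regular R] {A B C : E} {e : A ⟶ B} {f : B ⟶ C} (he : IsCover p e)
    (hf : IsCover p f) : IsCover p (e ≫ f) := by
  obtain ⟨h₁, h₂⟩ := he
  obtain ⟨h₃, h₄⟩ := hf
  have h₁ : p.IsStronglyCartesian (p.map e) e := h₁
  have h₃ : p.IsStronglyCartesian (p.map f) f := h₃
  refine ⟨?_, ?_⟩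
  · change p.IsStronglyCartesian _ _
    rw [p.map_comp]
    infer_instance
  · rw [p.map_comp]
    infer_instance

lemma IsCover.id (A : E) : IsCover p (𝟙 A) :=
  ⟨inferInstanceAs (p.IsStronglyCartesian _ _), by rw [p.map_id]; infer_instance⟩

end TotalCategory

section Sieves

variable {R : Type u₁} [Category.{v₁} R] {E : Type u₂} [Category.{v₂} E] (p : E ⥤ R)

/-- Binary predicates of the fibration of sieves: a predicate on `X × Y` is a morphism into
`X × Y`, i.e. a pair of morphisms with common domain. -/
structure SieveRel (X Y : E) where
  pt : E
  fst : pt ⟶ X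
  snd : pt ⟶ Y

/-- `ρ.Holds p x y`: the predicate `(x, y) : T ⟶ X × Y` entails `ρ` in the fibration of sieves,
i.e. `(x, y)` precomposed with some cover-cartesian map factors through `ρ`; in other words the
judgment `⊢ ρ(x, y)` holds for the generalized elements `x : T ⟶ X` and `y : T ⟶ Y`. A judgment
`φ(..), ψ(..) ⊢ χ(..)` holds iff for all generalized elements `φ(..)` and `ψ(..)` imply `χ(..)`. -/
def SieveRel.Holds {X Y : E} (ρ : SieveRel X Y) {T : E} (x : T ⟶ X) (y : T ⟶ Y) : Prop :=
  ∃ (T' : E) (e : T' ⟶ T) (k : T' ⟶ ρ.pt), IsCover p e ∧ k ≫ ρ.fst = e ≫ x ∧ k ≫ ρ.snd = e ≫ y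

/-- The entailment order of the fibration of sieves. -/
def SieveRel.Le {X Y : E} (ρ σ : SieveRel X Y) : Prop := σ.Holds p ρ.fst ρ.snd

/-- The predicate `(x : X, y : Y | f x = y)`. -/
abbrev SieveRel.graph {X Y : E} (f : X ⟶ Y) : SieveRel X Y := ⟨X, 𝟙 X, f⟩

/-- Relational composition `(x, z | ∃ y. ρ(x, y) ∧ σ(y, z))`: existential quantification is
postcomposition, conjunction is pullback. -/
noncomputable abbrev SieveRel.comp [HasPullbacks E] {X Y Z : E} (ρ : SieveRel X Y)
    (σ : SieveRel Y Z) : SieveRel X Z :=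
  ⟨pullback ρ.snd σ.fst, pullback.fst _ _ ≫ ρ.fst, pullback.snd _ _ ≫ σ.snd⟩

namespace SieveRel

variable {p} {X Y Z : E}

lemma Holds.self [Regular R] (ρ : SieveRel X Y) : ρ.Holds p ρ.fst ρ.snd :=
  ⟨_, 𝟙 _, 𝟙 _, IsCover.id p _, by simp, by simp⟩

lemma Holds.of_cover [Regular R] {ρ : SieveRel X Y} {T' T : E} {x : T ⟶ X} {y : T ⟶ Y}
    {e : T' ⟶ T} (he : IsCover p e) (h : ρ.Holds p (e ≫ x) (e ≫ y)) : ρ.Holds p x y := by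
  obtain ⟨T₁, e₁, k, h₁, h₂, h₃⟩ := h
  exact ⟨T₁, e₁ ≫ e, k, IsCover.comp p h₁ he, by simpa using h₂, by simpa using h₃⟩

lemma Holds.precomp [Regular R] [p.IsFibered] {ρ : SieveRel X Y} {T' T : E} {x : T ⟶ X}
    {y : T ⟶ Y} (h : ρ.Holds p x y) (t : T' ⟶ T) : ρ.Holds p (t ≫ x) (t ≫ y) := by
  obtain ⟨T₁, e, k, h₁, h₂, h₃⟩ := h
  obtain ⟨T₂, e', t', h₄, h₅⟩ := IsCover.exists_pullback p h₁ t
  exact ⟨T₂, e', t' ≫ k, h₄, by rw [Category.assoc, h₂, reassoc_of% h₅],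
    by rw [Category.assoc, h₃, reassoc_of% h₅]⟩

lemma Holds.mono [Regular R] [p.IsFibered] {ρ σ : SieveRel X Y} (hle : ρ.Le p σ) {T : E}
    {x : T ⟶ X} {y : T ⟶ Y} (h : ρ.Holds p x y) : σ.Holds p x y := by
  obtain ⟨T₁, e, k, h₁, h₂, h₃⟩ := h
  refine .of_cover h₁ ?_
  rw [← h₂, ← h₃]
  exact Holds.precomp hle k

lemma le_of_holds [Regular R] {ρ σ : SieveRel X Y}
    (h : ∀ {T : E} (x : T ⟶ X) (y : T ⟶ Y), ρ.Holds p x y → σ.Holds p x y) : ρ.Le p σ :=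
  h _ _ (Holds.self ρ)

lemma holds_graph [Regular R] {f : X ⟶ Y} {T : E} (x : T ⟶ X) :
    (graph f).Holds p x (x ≫ f) :=
  ⟨T, 𝟙 T, x, IsCover.id p T, by simp [graph], by simp [graph]⟩

lemma holds_graph_iff [Regular R] {f : X ⟶ Y} {T : E} (x : T ⟶ X) (y : T ⟶ Y) :
    (graph f).Holds p x y ↔ ∃ (T' : E) (e : T' ⟶ T), IsCover p e ∧ e ≫ x ≫ f = e ≫ y := by
  constructor
  · rintro ⟨T', e, k, h₁, h₂, h₃⟩
    have h₄ : k = e ≫ x := by simpa using h₂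
    exact ⟨T', e, h₁, by rw [← h₃, h₄, Category.assoc]⟩
  · rintro ⟨T', e, h₁, h₂⟩
    exact ⟨T', e, e ≫ x, h₁, by simp [graph], by simp [graph, h₂]⟩

lemma holds_comp_iff [Regular R] [p.IsFibered] [HasPullbacks E] {ρ : SieveRel X Y}
    {σ : SieveRel Y Z} {T : E} (x : T ⟶ X) (z : T ⟶ Z) :
    (ρ.comp σ).Holds p x z ↔ ∃ (T' : E) (e : T' ⟶ T) (y : T' ⟶ Y), IsCover p e ∧
      ρ.Holds p (e ≫ x) y ∧ σ.Holds p y (e ≫ z) := by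
  constructor
  · rintro ⟨T', e, k, h₁, h₂, h₃⟩
    refine ⟨T', e, k ≫ pullback.fst _ _ ≫ ρ.snd, h₁, ?_, ?_⟩
    · rw [← h₂]
      simpa only [Category.assoc] using (Holds.self (p := p) ρ).precomp (k ≫ pullback.fst _ _)
    · rw [← h₃, pullback.condition]
      simpa only [Category.assoc] using (Holds.self (p := p) σ).precomp (k ≫ pullback.snd _ _)
  · rintro ⟨T₀, e, y, he, hρ, hσ⟩
    refine .of_cover he ?_
    obtain ⟨T₁, e₁, k, h₁, h₂, h₃⟩ := hρ
    refine .of_cover h₁ ?_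
    obtain ⟨T₂, e₂, l, h₄, h₅, h₆⟩ := hσ.precomp e₁
    refine ⟨T₂, e₂, pullback.lift (e₂ ≫ k) l (by simp [h₃, h₅]), h₄, ?_, ?_⟩
    · rw [pullback.lift_fst_assoc, Category.assoc, h₂]
    · rw [pullback.lift_snd_assoc, h₆]

end SieveRel

end Sieves

section Presheaves

variable {R : Type u₁} [Category.{v₁} R] {E : Type u₂} [Category.{v₂} E]

/-- The objects of `R{E}`: objects of the total category with a total equivalence relation in the
fibration of sieves. -/
structure EqvObj (p : E ⥤ R) where
  carrier : E
  rel : SieveRel carrier carrier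
  refl : ∀ {T : E} (x : T ⟶ carrier), rel.Holds p x x
  symm : ∀ {T : E} (x y : T ⟶ carrier), rel.Holds p x y → rel.Holds p y x
  trans : ∀ {T : E} (x y z : T ⟶ carrier), rel.Holds p x y → rel.Holds p y z → rel.Holds p x z

variable {p : E ⥤ R}

/-- Functional relations `φ` from `(C, ρ)` to `(D, σ)`. The condition of strictness
`φ(c, d) ⊢ ρ(c, c) ∧ σ(d, d)` is void since `ρ` and `σ` are total. -/
structure FunRel (A B : EqvObj p) where
  toRel : SieveRel A.carrier B.carrier
  cong : ∀ {T : E} (c c' : T ⟶ A.carrier) (d d' : T ⟶ B.carrier), toRel.Holds p c d →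
    A.rel.Holds p c c' → B.rel.Holds p d d' → toRel.Holds p c' d'
  singval : ∀ {T : E} (c : T ⟶ A.carrier) (d d' : T ⟶ B.carrier), toRel.Holds p c d →
    toRel.Holds p c d' → B.rel.Holds p d d'
  /-- `⊢ ∃ d. φ(c, d)` -/
  tot : ∃ (C' : E) (e : C' ⟶ A.carrier) (k : C' ⟶ toRel.pt), IsCover p e ∧ k ≫ toRel.fst = e

lemma FunRel.exists_holds [Regular R] [p.IsFibered] {A B : EqvObj p} (φ : FunRel A B) {T : E}
    (c : T ⟶ A.carrier) :
    ∃ (T' : E) (e : T' ⟶ T) (d : T' ⟶ B.carrier), IsCover p e ∧ φ.toRel.Holds p (e ≫ c) d := by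
  obtain ⟨C', e, k, he, hk⟩ := φ.tot
  obtain ⟨T', e', c', he', h⟩ := IsCover.exists_pullback p he c
  refine ⟨T', e', c' ≫ k ≫ φ.toRel.snd, he', ?_⟩
  rw [← h, ← hk]
  simpa using (SieveRel.Holds.self φ.toRel).precomp (c' ≫ k)

lemma FunRel.tot_of_exists_holds [Regular R] {A B : EqvObj p}
    (φ : SieveRel A.carrier B.carrier)
    (h : ∃ (T' : E) (e : T' ⟶ A.carrier) (d : T' ⟶ B.carrier), IsCover p e ∧ φ.Holds p e d) :
    ∃ (C' : E) (e : C' ⟶ A.carrier) (k : C' ⟶ φ.pt), IsCover p e ∧ k ≫ φ.fst = e := by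
  obtain ⟨T', e, d, he, T₁, e₁, k, he₁, hk, -⟩ := h
  exact ⟨T₁, e₁ ≫ e, k, he₁.comp p he, hk⟩

variable [Regular R] [IsLexFibration p]

/-- Two functional relations are identified if they entail each other. -/
instance FunRel.setoid (A B : EqvObj p) : Setoid (FunRel A B) where
  r φ ψ := φ.toRel.Le p ψ.toRel ∧ ψ.toRel.Le p φ.toRel
  iseqv :=
    { refl := fun _ => ⟨SieveRel.Holds.self _, SieveRel.Holds.self _⟩
      symm := fun h => ⟨h.2, h.1⟩
      trans := fun h h' => ⟨SieveRel.Holds.mono h'.1 h.1, SieveRel.Holds.mono h.2 h'.2⟩ }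

lemma FunRel.equiv_of_holds_iff {A B : EqvObj p} {φ ψ : FunRel A B}
    (h : ∀ {T : E} (x : T ⟶ A.carrier) (y : T ⟶ B.carrier),
      φ.toRel.Holds p x y ↔ ψ.toRel.Holds p x y) : φ ≈ ψ :=
  ⟨SieveRel.le_of_holds fun x y => (h x y).1, SieveRel.le_of_holds fun x y => (h x y).2⟩

lemma FunRel.holds_iff_of_equiv {A B : EqvObj p} {φ ψ : FunRel A B} (h : φ ≈ ψ) {T : E}
    (x : T ⟶ A.carrier) (y : T ⟶ B.carrier) :
    φ.toRel.Holds p x y ↔ ψ.toRel.Holds p x y :=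
  ⟨SieveRel.Holds.mono h.1, SieveRel.Holds.mono h.2⟩

/-- The identity functional relation is the equivalence relation itself. -/
def FunRel.id (A : EqvObj p) : FunRel A A where
  toRel := A.rel
  cong _ _ _ _ h h₁ h₂ := A.trans _ _ _ (A.symm _ _ h₁) (A.trans _ _ _ h h₂)
  singval _ _ _ h h' := A.trans _ _ _ (A.symm _ _ h) h'
  tot := FunRel.tot_of_exists_holds _ ⟨_, 𝟙 _, 𝟙 _, IsCover.id p _, A.refl _⟩

/-- Composition of functional relations is relational composition. -/
noncomputable def FunRel.comp {A B C : EqvObj p} (φ : FunRel A B) (ψ : FunRel B C) :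
    FunRel A C :=
  haveI := hasPullbacks_total p
  { toRel := φ.toRel.comp ψ.toRel
    cong := by
      intro T c c' d d' h h₁ h₂
      rw [SieveRel.holds_comp_iff] at h ⊢
      obtain ⟨T', e, y, he, hφ, hψ⟩ := h
      exact ⟨T', e, y, he, φ.cong _ _ _ _ hφ (h₁.precomp e) (B.refl y),
        ψ.cong _ _ _ _ hψ (B.refl y) (h₂.precomp e)⟩
    singval := by
      intro T c d d' h h'
      rw [SieveRel.holds_comp_iff] at h h'
      obtain ⟨T₁, e₁, y₁, he₁, hφ₁, hψ₁⟩ := h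
      refine .of_cover he₁ ?_
      obtain ⟨T₂, e₂, y₂, he₂, hφ₂, hψ₂⟩ := h'
      obtain ⟨T₃, e₃, t, he₃, ht⟩ := IsCover.exists_pullback p he₂ e₁
      refine .of_cover he₃ ?_
      have h₁ := hφ₁.precomp e₃
      have h₂ := hφ₂.precomp t
      rw [reassoc_of% ht] at h₂
      have h₃ := hψ₂.precomp t
      rw [reassoc_of% ht] at h₃
      have hy := φ.singval _ _ _ h₂ h₁
      exact ψ.singval _ _ _ (hψ₁.precomp e₃) (ψ.cong _ _ _ _ h₃ hy (C.refl _))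
    tot := by
      apply FunRel.tot_of_exists_holds
      obtain ⟨T₁, e₁, d₁, he₁, h₁⟩ := φ.exists_holds (𝟙 _)
      obtain ⟨T₂, e₂, d₂, he₂, h₂⟩ := ψ.exists_holds d₁
      refine ⟨T₂, e₂ ≫ e₁, d₂, he₂.comp p he₁, ?_⟩
      rw [SieveRel.holds_comp_iff]
      refine ⟨T₂, 𝟙 _, e₂ ≫ d₁, IsCover.id p _, ?_, by simpa using h₂⟩
      simpa using h₁.precomp e₂ }

lemma FunRel.holds_comp_iff {A B C : EqvObj p} (φ : FunRel A B) (ψ : FunRel B C) {T : E}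
    (x : T ⟶ A.carrier) (z : T ⟶ C.carrier) :
    (φ.comp ψ).toRel.Holds p x z ↔ ∃ (T' : E) (e : T' ⟶ T) (y : T' ⟶ B.carrier), IsCover p e ∧
      φ.toRel.Holds p (e ≫ x) y ∧ ψ.toRel.Holds p y (e ≫ z) :=
  haveI := hasPullbacks_total p
  SieveRel.holds_comp_iff x z

/-- The category `R{E}` of total equivalence relations in the fibration of sieves and functional
relations up to logical equivalence. -/
noncomputable instance : Category.{max u₂ v₂} (EqvObj p) where
  Hom A B := Quotient (FunRel.setoid A B)
  id A := ⟦FunRel.id A⟧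
  comp := Quotient.map₂ FunRel.comp (by
    intro φ φ' h ψ ψ' h'
    apply FunRel.equiv_of_holds_iff
    intro T x z
    simp only [FunRel.holds_comp_iff, FunRel.holds_iff_of_equiv h, FunRel.holds_iff_of_equiv h'])
  id_comp := by
    rintro A B ⟨φ⟩
    apply Quotient.sound
    apply FunRel.equiv_of_holds_iff
    intro T x z
    rw [FunRel.holds_comp_iff]
    constructor
    · rintro ⟨T', e, y, he, h₁, h₂⟩
      exact .of_cover he (φ.cong _ _ _ _ h₂ (A.symm _ _ h₁) (B.refl _))
    · intro h
      exact ⟨T, 𝟙 T, x, IsCover.id p T, by simpa using! A.refl x, by simpa using h⟩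
  comp_id := by
    rintro A B ⟨φ⟩
    apply Quotient.sound
    apply FunRel.equiv_of_holds_iff
    intro T x z
    rw [FunRel.holds_comp_iff]
    constructor
    · rintro ⟨T', e, y, he, h₁, h₂⟩
      exact .of_cover he (φ.cong _ _ _ _ h₁ (A.refl _) h₂)
    · intro h
      exact ⟨T, 𝟙 T, z, IsCover.id p T, by simpa using h, by simpa using! B.refl z⟩
  assoc := by
    rintro A B C D ⟨φ⟩ ⟨ψ⟩ ⟨χ⟩
    apply Quotient.sound
    apply FunRel.equiv_of_holds_iff
    intro T x z
    simp only [FunRel.holds_comp_iff]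
    constructor
    · rintro ⟨T₁, e₁, y₁, he₁, ⟨T₂, e₂, y₂, he₂, h₁, h₂⟩, h₃⟩
      refine ⟨T₂, e₂ ≫ e₁, y₂, he₂.comp p he₁, by simpa using h₁, T₂, 𝟙 _, e₂ ≫ y₁,
        IsCover.id p _, by simpa using h₂, by simpa using h₃.precomp e₂⟩
    · rintro ⟨T₁, e₁, y₁, he₁, h₁, T₂, e₂, y₂, he₂, h₂, h₃⟩
      refine ⟨T₂, e₂ ≫ e₁, y₂, he₂.comp p he₁, ⟨T₂, 𝟙 _, e₂ ≫ y₁, IsCover.id p _,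
        by simpa using h₁.precomp e₂, by simpa using h₂⟩, by simpa using h₃⟩

end Presheaves

section TerminalObjects

variable {R : Type u₁} [Category.{v₁} R] {E : Type u₂} [Category.{v₂} E] (p : E ⥤ R)
variable [IsLexFibration p]

/-- The terminal object `1_I` of the fiber over `I`. -/
noncomputable def one (I : R) : p.Fiber I := ⊤_ (p.Fiber I)

lemma existsUnique_one {A : E} {J I : R} (hA : p.obj A = J) (u : J ⟶ I) :
    ∃! f : A ⟶ (one p I).1, p.IsHomLift u f := by
  let t : IsTerminal ((reindex p u).obj (one p I)) :=
    terminalIsTerminal.isTerminalObj (reindex p u) _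
  let A' : p.Fiber J := ⟨A, hA⟩
  have h := (t.from A').2
  refine ⟨(t.from A').1 ≫ lift p u (one p I), ?_, ?_⟩
  · change p.IsHomLift u _
    infer_instance
  · intro f hf
    obtain ⟨f', hf', rfl⟩ := exists_factor_lift p u (one p I) (𝟙 J) f (by simpa using hf)
    congr 1
    exact congrArg Subtype.val (t.hom_ext (Y := A') ⟨f', hf'⟩ (t.from A'))

/-- The unique map `1_u : A ⟶ 1_I` over `u`. -/
noncomputable def toOne {A : E} {J I : R} (hA : p.obj A = J) (u : J ⟶ I) : A ⟶ (one p I).1 :=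
  (existsUnique_one p hA u).choose

instance {A : E} {J I : R} (hA : p.obj A = J) (u : J ⟶ I) : p.IsHomLift u (toOne p hA u) :=
  (existsUnique_one p hA u).choose_spec.1

lemma toOne_uniq {A : E} {J I : R} (hA : p.obj A = J) (u : J ⟶ I) (f : A ⟶ (one p I).1)
    [p.IsHomLift u f] : f = toOne p hA u :=
  (existsUnique_one p hA u).choose_spec.2 f inferInstance

/-- The functor `I ↦ 1_I` from the base to the total category. -/
noncomputable def oneFunctor : R ⥤ E where
  obj I := (one p I).1
  map {J I} u := toOne p (one p J).2 u
  map_id I := by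
    have : p.IsHomLift (𝟙 I) (𝟙 (one p I).1) := IsHomLift.id (one p I).2
    exact (toOne_uniq p _ _ _).symm
  map_comp u v := (toOne_uniq p _ _ _).symm

end TerminalObjects

section Presheaves

variable {R : Type u₁} [Category.{v₁} R] {E : Type u₂} [Category.{v₂} E] (p : E ⥤ R)
variable [Regular R] [IsLexFibration p]

variable {p} in
lemma SieveRel.Holds.congr {X Y : E} {ρ : SieveRel X Y} {T : E} {c c' : T ⟶ X} {d d' : T ⟶ Y}
    (h : ρ.Holds p c d) (hc : (SieveRel.graph (𝟙 X)).Holds p c c')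
    (hd : (SieveRel.graph (𝟙 Y)).Holds p d d') : ρ.Holds p c' d' := by
  rw [SieveRel.holds_graph_iff] at hc
  obtain ⟨T₁, e₁, he₁, hc⟩ := hc
  refine .of_cover he₁ ?_
  have hd := hd.precomp e₁
  rw [SieveRel.holds_graph_iff] at hd
  obtain ⟨T₂, e₂, he₂, hd⟩ := hd
  refine .of_cover he₂ ?_
  rw [Category.comp_id] at hc hd
  rw [← hd, ← hc]
  exact (h.precomp e₁).precomp e₂

/-- The object `(C, =)` of `R{E}`. -/
def discreteObj (C : E) : EqvObj p where
  carrier := C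
  rel := SieveRel.graph (𝟙 C)
  refl x := by simpa using SieveRel.holds_graph (p := p) (f := 𝟙 C) x
  symm x y h := by
    rw [SieveRel.holds_graph_iff] at h ⊢
    obtain ⟨T, e, he, h⟩ := h
    exact ⟨T, e, he, by simpa using h.symm⟩
  trans x y z h h' := h.congr (by simpa using SieveRel.holds_graph (p := p) (f := 𝟙 C) x) h'

variable {p} in
lemma SieveRel.graph_singval {X Y : E} {f : X ⟶ Y} {T : E} (c : T ⟶ X) (d d' : T ⟶ Y)
    (h : (SieveRel.graph f).Holds p c d) (h' : (SieveRel.graph f).Holds p c d') :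
    (SieveRel.graph (𝟙 Y)).Holds p d d' := by
  rw [SieveRel.holds_graph_iff] at h
  obtain ⟨T₁, e₁, he₁, h⟩ := h
  refine .of_cover he₁ ?_
  have h' := h'.precomp e₁
  rw [SieveRel.holds_graph_iff] at h'
  obtain ⟨T₂, e₂, he₂, h'⟩ := h'
  refine (SieveRel.holds_graph_iff _ _).2 ⟨T₂, e₂, he₂, ?_⟩
  rw [Category.comp_id, ← h, ← h', Category.assoc]

variable {p} in
lemma SieveRel.holds_graph_comp_iff {X Y Z : E} {f : X ⟶ Y} {g : Y ⟶ Z} {T : E} (x : T ⟶ X)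
    (z : T ⟶ Z) : (SieveRel.graph (f ≫ g)).Holds p x z ↔
      ∃ (T' : E) (e : T' ⟶ T) (y : T' ⟶ Y), IsCover p e ∧
        (SieveRel.graph f).Holds p (e ≫ x) y ∧ (SieveRel.graph g).Holds p y (e ≫ z) := by
  constructor
  · intro h
    rw [SieveRel.holds_graph_iff] at h
    obtain ⟨T₁, e₁, he₁, h⟩ := h
    refine ⟨T₁, e₁, (e₁ ≫ x) ≫ f, he₁, SieveRel.holds_graph _, ?_⟩
    rw [← h]
    simpa using SieveRel.holds_graph (p := p) (f := g) ((e₁ ≫ x) ≫ f)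
  · rintro ⟨T₁, e₁, y, he₁, h₁, h₂⟩
    refine .of_cover he₁ ?_
    rw [SieveRel.holds_graph_iff] at h₁
    obtain ⟨T₂, e₂, he₂, h₁⟩ := h₁
    refine .of_cover he₂ ?_
    have h₂ := h₂.precomp e₂
    rw [← h₁, SieveRel.holds_graph_iff] at h₂
    obtain ⟨T₃, e₃, he₃, h₂⟩ := h₂
    exact (SieveRel.holds_graph_iff _ _).2 ⟨T₃, e₃, he₃, by simpa using h₂⟩

/-- The graph of a morphism as a functional relation between discrete equivalence relations. -/
def discreteMap {C D : E} (f : C ⟶ D) : FunRel (discreteObj p C) (discreteObj p D) where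
  toRel := SieveRel.graph f
  cong _ _ _ _ h h₁ h₂ := h.congr h₁ h₂
  singval c d d' h h' := SieveRel.graph_singval c d d' h h'
  tot := ⟨C, 𝟙 C, 𝟙 C, IsCover.id p C, Category.comp_id _⟩

/-- The embedding of the total category into `R{E}`: an object `C` is sent to `C` with the discrete
equivalence relation, a morphism to its graph. -/
noncomputable def discrete : E ⥤ EqvObj p where
  obj C := discreteObj p C
  map f := ⟦discreteMap p f⟧
  map_id C := rfl
  map_comp {C D F} f g := by
    apply Quotient.sound
    apply FunRel.equiv_of_holds_iff
    intro T x z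
    rw [FunRel.holds_comp_iff]
    exact SieveRel.holds_graph_comp_iff x z

/-- The constant objects functor `Δ : R ⥤ R{E}`, `I ↦ (1_I, =)`. -/
noncomputable def constObj : R ⥤ EqvObj p := oneFunctor p ⋙ discrete p

/-- The fibration of presheaves on `p`: the gluing of `R{E}` along `Δ`, i.e. the projection to `R`
of the comma category `R{E} ↓ Δ`. -/
noncomputable def presheaves : BasedCategory.{max v₁ u₂ v₂, max u₁ u₂ v₂} R :=
  BasedCategory.ofFunctor (Comma.snd (𝟭 (EqvObj p)) (constObj p))

/-- The functor underlying the fibered Yoneda embedding. -/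
noncomputable def yonedaFunctor : E ⥤ Comma (𝟭 (EqvObj p)) (constObj p) where
  obj C := ⟨(discrete p).obj C, p.obj C, (discrete p).map (toOne p rfl (𝟙 (p.obj C)))⟩
  map {C D} f :=
    { left := (discrete p).map f
      right := p.map f
      w := by
        have h₁ : p.IsHomLift (p.map f) (f ≫ toOne p rfl (𝟙 (p.obj D))) := inferInstance
        have h₂ : p.IsHomLift (p.map f) (toOne p (A := C) rfl (𝟙 (p.obj C)) ≫
            toOne p (one p (p.obj C)).2 (p.map f)) := inferInstance
        have key : f ≫ toOne p (A := D) rfl (𝟙 (p.obj D)) =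
            toOne p (A := C) rfl (𝟙 (p.obj C)) ≫ toOne p (one p (p.obj C)).2 (p.map f) :=
          (toOne_uniq p rfl (p.map f) _).trans (toOne_uniq p rfl (p.map f) _).symm
        exact ((discrete p).map_comp _ _).symm.trans
          ((congrArg (discrete p).map key).trans ((discrete p).map_comp _ _)) }
  map_id C := CommaMorphism.ext ((discrete p).map_id C) (p.map_id C)
  map_comp f g := CommaMorphism.ext ((discrete p).map_comp f g) (p.map_comp f g)

/-- The fibered Yoneda embedding, sending `C` over `I` to `(C, =)`, displayed over `Δ I` by means of
the unique vertical map `C ⟶ 1_I`. -/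
noncomputable def yoneda : BasedFunctor (BasedCategory.ofFunctor p) (presheaves p) where
  toFunctor := yonedaFunctor p
  w := rfl

end Presheaves

section FiberedFunctors

open BasedFunctor BasedNatTrans
open scoped BasedFunctor

variable {R : Type u₁} [Category.{v₁} R]

/-- The functor between the fibers over `I` induced by a functor over `R`. -/
def fiberFunctor {C : BasedCategory.{v₂, u₂} R} {D : BasedCategory.{v₃, u₃} R}
    (F : BasedFunctor C D) (I : R) : C.p.Fiber I ⥤ D.p.Fiber I where
  obj A := ⟨F.obj A.1, (F.w_obj A.1).trans A.2⟩
  map f := ⟨F.map f.1, haveI := f.2; inferInstance⟩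
  map_id A := Subtype.ext (F.map_id A.1)
  map_comp f g := Subtype.ext (F.map_comp f.1 g.1)

/-- Finite limit preserving fibered functors. -/
structure IsLexFunctor {C : BasedCategory.{v₂, u₂} R} {D : BasedCategory.{v₃, u₃} R}
    (F : BasedFunctor C D) : Prop where
  map_cart : ∀ ⦃A B : C.obj⦄ (f : A ⟶ B), IsCart C.p f → IsCart D.p (F.map f)
  preservesFiniteLimits : ∀ I : R, PreservesFiniteLimits (fiberFunctor F I)

/-- Positive fibered functors: fibered functors which are fiberwise regular and preserve internal
sums, i.e. preserve cocartesian maps. -/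
structure IsPositiveFunctor {C : BasedCategory.{v₂, u₂} R} {D : BasedCategory.{v₃, u₃} R}
    (F : BasedFunctor C D) : Prop where
  map_cart : ∀ ⦃A B : C.obj⦄ (f : A ⟶ B), IsCart C.p f → IsCart D.p (F.map f)
  isRegularFunctor : ∀ I : R, IsRegularFunctor (fiberFunctor F I)
  map_cocart : ∀ ⦃A B : C.obj⦄ (f : A ⟶ B), IsCocart C.p f → IsCocart D.p (F.map f)

lemma IsPositiveFunctor.isLexFunctor {C : BasedCategory.{v₂, u₂} R}
    {D : BasedCategory.{v₃, u₃} R} {F : BasedFunctor C D} (h : IsPositiveFunctor F) :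
    IsLexFunctor F :=
  ⟨h.map_cart, fun I => (h.isRegularFunctor I).preservesFiniteLimits⟩

lemma IsLexFunctor.id (C : BasedCategory.{v₂, u₂} R) : IsLexFunctor (BasedFunctor.id C) where
  map_cart _ _ _ h := h
  preservesFiniteLimits I := inferInstanceAs (PreservesFiniteLimits (𝟭 (C.p.Fiber I)))

lemma IsLexFunctor.comp {C : BasedCategory.{v₂, u₂} R} {D : BasedCategory.{v₃, u₃} R}
    {X : BasedCategory.{v₄, u₄} R} {F : BasedFunctor C D} {G : BasedFunctor D X}
    (hF : IsLexFunctor F) (hG : IsLexFunctor G) : IsLexFunctor (F.comp G) where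
  map_cart _ _ _ h := hG.map_cart _ (hF.map_cart _ h)
  preservesFiniteLimits I :=
    haveI := hF.preservesFiniteLimits I
    haveI := hG.preservesFiniteLimits I
    inferInstanceAs (PreservesFiniteLimits (fiberFunctor F I ⋙ fiberFunctor G I))

lemma IsPositiveFunctor.id (C : BasedCategory.{v₂, u₂} R) :
    IsPositiveFunctor (BasedFunctor.id C) where
  map_cart _ _ _ h := h
  isRegularFunctor I := ⟨(IsLexFunctor.id C).preservesFiniteLimits I, fun _ _ _ h => h⟩
  map_cocart _ _ _ h := h

lemma IsPositiveFunctor.comp {C : BasedCategory.{v₂, u₂} R} {D : BasedCategory.{v₃, u₃} R}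
    {X : BasedCategory.{v₄, u₄} R} {F : BasedFunctor C D} {G : BasedFunctor D X}
    (hF : IsPositiveFunctor F) (hG : IsPositiveFunctor G) : IsPositiveFunctor (F.comp G) where
  map_cart _ _ _ h := hG.map_cart _ (hF.map_cart _ h)
  isRegularFunctor I := ⟨(hF.isLexFunctor.comp hG.isLexFunctor).preservesFiniteLimits I,
    fun _ _ _ h => (hG.isRegularFunctor I).map_regularEpi _
      ((hF.isRegularFunctor I).map_regularEpi _ h)⟩
  map_cocart _ _ _ h := hG.map_cocart _ (hF.map_cocart _ h)

/-- The category of finite limit preserving fibered functors and fibered natural transformations,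
i.e. natural transformations with vertical components. -/
abbrev LexFun (C : BasedCategory.{v₂, u₂} R) (D : BasedCategory.{v₃, u₃} R) :=
  ObjectProperty.FullSubcategory fun F : BasedFunctor C D => IsLexFunctor F

/-- The category of positive fibered functors and fibered natural transformations. -/
abbrev PosFun (C : BasedCategory.{v₂, u₂} R) (D : BasedCategory.{v₃, u₃} R) :=
  ObjectProperty.FullSubcategory fun F : BasedFunctor C D => IsPositiveFunctor F

/-- Precomposition with a finite limit preserving fibered functor `Y : C ⟶ D`, as a functor from
positive fibered functors `D ⟶ X` to finite limit preserving fibered functors `C ⟶ X`. -/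
def precomp {C : BasedCategory.{v₂, u₂} R} {D : BasedCategory.{v₃, u₃} R} (Y : BasedFunctor C D)
    (hY : IsLexFunctor Y) (X : BasedCategory.{v₄, u₄} R) : PosFun D X ⥤ LexFun C X where
  obj G := ⟨Y.comp G.obj, hY.comp G.property.isLexFunctor⟩
  map α := ObjectProperty.homMk (BasedCategory.whiskerLeft Y α.hom)

end FiberedFunctors

section Bicategories

open BasedFunctor BasedNatTrans Bicategory

variable {R : Type u₁} [Category.{v₁} R]

lemma fun_hom_ext {C : BasedCategory.{v₂, u₂} R} {D : BasedCategory.{v₃, u₃} R}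
    {P : ObjectProperty (BasedFunctor C D)} {F G : P.FullSubcategory} {α β : F ⟶ G}
    (h : ∀ a, α.hom.toNatTrans.app a = β.hom.toNatTrans.app a) : α = β :=
  ObjectProperty.hom_ext _ (BasedNatTrans.ext _ _ (NatTrans.ext (funext h)))

variable (R)

/-- The objects of `Lex(R)`: finite-limit pre-stacks. -/
structure Lex where
  toBased : BasedCategory.{w, w} R
  isLexPreStack : IsLexPreStack toBased.p

/-- The objects of `Pretop(R)`: fibered pretoposes. -/
structure Pretop where
  toBased : BasedCategory.{w, w} R
  isFiberedPretopos : IsFiberedPretopos toBased.p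

/-- The 2-category `Lex(R)` of finite-limit pre-stacks, finite limit preserving fibered functors and
fibered natural transformations. -/
instance : Bicategory (Lex.{w} R) where
  Hom C D := LexFun C.toBased D.toBased
  id C := ⟨BasedFunctor.id _, IsLexFunctor.id _⟩
  comp F G := ⟨F.obj.comp G.obj, F.property.comp G.property⟩
  homCategory C D := inferInstanceAs (Category (LexFun C.toBased D.toBased))
  whiskerLeft F _ _ α := ObjectProperty.homMk (BasedCategory.whiskerLeft F.obj α.hom)
  whiskerRight α H := ObjectProperty.homMk (BasedCategory.whiskerRight α.hom H.obj)
  associator _ _ _ := ObjectProperty.isoMk _ (BasedNatIso.id _)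
  leftUnitor F := ObjectProperty.isoMk _ (BasedNatIso.id F.obj)
  rightUnitor F := ObjectProperty.isoMk _ (BasedNatIso.id F.obj)
  whiskerLeft_id _ _ := rfl
  whiskerLeft_comp _ _ _ _ _ _ := rfl
  id_whiskerLeft α := fun_hom_ext fun a =>
    ((Category.id_comp _).trans (Category.comp_id _)).symm
  comp_whiskerLeft _ _ _ _ _ := fun_hom_ext fun a =>
    ((Category.id_comp _).trans (Category.comp_id _)).symm
  id_whiskerRight F G := fun_hom_ext fun a => G.obj.toFunctor.map_id _
  comp_whiskerRight _ _ H := fun_hom_ext fun a => H.obj.toFunctor.map_comp _ _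
  whiskerRight_id _ := fun_hom_ext fun a =>
    ((Category.id_comp _).trans (Category.comp_id _)).symm
  whiskerRight_comp _ _ _ := fun_hom_ext fun a =>
    ((Category.id_comp _).trans (Category.comp_id _)).symm
  whisker_assoc _ _ _ _ _ := fun_hom_ext fun a =>
    ((Category.id_comp _).trans (Category.comp_id _)).symm
  whisker_exchange α β := fun_hom_ext fun a => (β.hom.toNatTrans.naturality _).symm
  pentagon _ _ _ K := fun_hom_ext fun a =>
    congrArg (· ≫ 𝟙 _ ≫ 𝟙 _) (K.obj.toFunctor.map_id _) |>.trans (by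
      change 𝟙 _ ≫ 𝟙 _ ≫ 𝟙 _ = 𝟙 _ ≫ 𝟙 _
      simp only [Category.comp_id])
  triangle _ G := fun_hom_ext fun a =>
    (Category.comp_id _).trans (G.obj.toFunctor.map_id _).symm

/-- The 2-category `Pretop(R)` of fibered pretoposes, positive fibered functors and fibered natural
transformations. -/
instance : Bicategory (Pretop.{w} R) where
  Hom C D := PosFun C.toBased D.toBased
  id C := ⟨BasedFunctor.id _, IsPositiveFunctor.id _⟩
  comp F G := ⟨F.obj.comp G.obj, F.property.comp G.property⟩
  homCategory C D := inferInstanceAs (Category (PosFun C.toBased D.toBased))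
  whiskerLeft F _ _ α := ObjectProperty.homMk (BasedCategory.whiskerLeft F.obj α.hom)
  whiskerRight α H := ObjectProperty.homMk (BasedCategory.whiskerRight α.hom H.obj)
  associator _ _ _ := ObjectProperty.isoMk _ (BasedNatIso.id _)
  leftUnitor F := ObjectProperty.isoMk _ (BasedNatIso.id F.obj)
  rightUnitor F := ObjectProperty.isoMk _ (BasedNatIso.id F.obj)
  whiskerLeft_id _ _ := rfl
  whiskerLeft_comp _ _ _ _ _ _ := rfl
  id_whiskerLeft α := fun_hom_ext fun a =>
    ((Category.id_comp _).trans (Category.comp_id _)).symm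
  comp_whiskerLeft _ _ _ _ _ := fun_hom_ext fun a =>
    ((Category.id_comp _).trans (Category.comp_id _)).symm
  id_whiskerRight F G := fun_hom_ext fun a => G.obj.toFunctor.map_id _
  comp_whiskerRight _ _ H := fun_hom_ext fun a => H.obj.toFunctor.map_comp _ _
  whiskerRight_id _ := fun_hom_ext fun a =>
    ((Category.id_comp _).trans (Category.comp_id _)).symm
  whiskerRight_comp _ _ _ := fun_hom_ext fun a =>
    ((Category.id_comp _).trans (Category.comp_id _)).symm
  whisker_assoc _ _ _ _ _ := fun_hom_ext fun a =>
    ((Category.id_comp _).trans (Category.comp_id _)).symm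
  whisker_exchange α β := fun_hom_ext fun a => (β.hom.toNatTrans.naturality _).symm
  pentagon _ _ _ K := fun_hom_ext fun a =>
    congrArg (· ≫ 𝟙 _ ≫ 𝟙 _) (K.obj.toFunctor.map_id _) |>.trans (by
      change 𝟙 _ ≫ 𝟙 _ ≫ 𝟙 _ = 𝟙 _ ≫ 𝟙 _
      simp only [Category.comp_id])
  triangle _ G := fun_hom_ext fun a =>
    (Category.comp_id _).trans (G.obj.toFunctor.map_id _).symm

/-- The forgetful functor `Pretop(R) ⟶ Lex(R)`. -/
def forget : Pseudofunctor (Pretop.{w} R) (Lex.{w} R) where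
  obj X := ⟨X.toBased, haveI := X.isFiberedPretopos; inferInstance⟩
  map F := ⟨F.obj, F.property.isLexFunctor⟩
  map₂ α := ObjectProperty.homMk α.hom
  mapId X := Iso.refl _
  mapComp F G := Iso.refl _
  map₂_whisker_left _ _ _ _ := fun_hom_ext fun a =>
    ((Category.id_comp _).trans (Category.comp_id _)).symm
  map₂_whisker_right _ _ := fun_hom_ext fun a =>
    ((Category.id_comp _).trans (Category.comp_id _)).symm
  map₂_associator _ _ H := fun_hom_ext fun a => by
    refine Eq.symm ((Category.id_comp _).trans ?_)
    refine (congrArg (· ≫ 𝟙 _ ≫ 𝟙 _ ≫ 𝟙 _) (H.obj.toFunctor.map_id _)).trans ?_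
    change 𝟙 _ ≫ 𝟙 _ ≫ 𝟙 _ ≫ 𝟙 _ = 𝟙 _
    simp only [Category.comp_id]
  map₂_left_unitor F := fun_hom_ext fun a => by
    refine Eq.symm ((Category.id_comp _).trans ((Category.comp_id _).trans ?_))
    exact F.obj.toFunctor.map_id _
  map₂_right_unitor F := fun_hom_ext fun a => by
    exact ((Category.id_comp _).trans (Category.comp_id _)).symm

variable {R}

/-- For `L : A ⟶ B`, `U : B ⟶ A` and `η : 1 ⟶ U L`, the functor `B(L a, b) ⥤ A(a, U b)`,
`g ↦ U g ∘ η a`. -/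
def transposeFunctor {A : Type u₂} [Bicategory.{v₂, w} A] {B : Type u₃} [Bicategory.{v₃, v₄} B]
    (L : Pseudofunctor A B) (U : Pseudofunctor B A)
    (η : Pseudofunctor.StrongTrans (Pseudofunctor.id A) (L.comp U)) (a : A) (b : B) :
    (L.obj a ⟶ b) ⥤ (a ⟶ U.obj b) where
  obj g := η.app a ≫ U.map g
  map α := η.app a ◁ U.map₂ α
  map_id g := by
    rw [U.map₂_id]
    exact Bicategory.whiskerLeft_id _ _
  map_comp α β := by
    rw [U.map₂_comp]
    exact Bicategory.whiskerLeft_comp _ _ _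

/-- `L` is left biadjoint to `U` with unit `η`: the functors `B(L a, b) ⥤ A(a, U b)`,
`g ↦ U g ∘ η a`, which are pseudonatural in `a` and `b`, are equivalences of categories. -/
def IsLeftBiadjoint {A : Type u₂} [Bicategory.{v₂, w} A] {B : Type u₃} [Bicategory.{v₃, v₄} B]
    (L : Pseudofunctor A B) (U : Pseudofunctor B A)
    (η : Pseudofunctor.StrongTrans (Pseudofunctor.id A) (L.comp U)) : Prop :=
  ∀ a b, (transposeFunctor L U η a b).IsEquivalence

end Bicategories

section Unit

variable {R : Type u₁} [Category.{v₁} R] [Regular R]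

attribute [instance] Lex.isLexPreStack Pretop.isFiberedPretopos

/-- The fibration of presheaves as an object of `Pretop(R)`, once it is known to be a fibered
pretopos. -/
noncomputable def Lex.presheaves (C : Lex.{max w u₁ v₁} R)
    (h : IsFiberedPretopos (FibPsh.presheaves C.toBased.p).p) : Pretop.{max w u₁ v₁} R :=
  ⟨FibPsh.presheaves C.toBased.p, h⟩

/-- The fibered Yoneda embedding as a 1-cell of `Lex(R)`, once it is known to preserve finite
limits. -/
noncomputable def Lex.yoneda (C : Lex.{max w u₁ v₁} R)
    (h : IsFiberedPretopos (FibPsh.presheaves C.toBased.p).p)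
    (hY : IsLexFunctor (FibPsh.yoneda C.toBased.p)) : C ⟶ (forget R).obj (C.presheaves h) :=
  ⟨FibPsh.yoneda C.toBased.p, hY⟩

end Unit

end FibPsh

/-!
The proof rests on one notion that replaces regular epimorphisms across the fibers: a map of the
total category of a fibration is a *surjection* (`IsSurj`) if all its pullbacks are effective
relative to the base. Covers in a pre-stack, regular epimorphisms of the fibers and cocartesian maps
of a fibered pretopos are surjections, and in a fibered pretopos every surjection is a cocartesian
map followed by a regular epimorphism of a fiber. So the positive functors between fibered
pretoposes are the finite limit preserving ones which preserve surjections
(`IsPositiveFunctor.map_isSurj`, `IsPositiveFunctor.of_isSurj`). One can argue with generalized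
elements and "locally", that is after precomposition with a surjection. Moreover, a span which is
locally an equivalence relation has a quotient over any object of the base under its carrier
(`exists_quotient`), obtained from a sum and an exact quotient in one fiber.

A full and faithful finite limit preserving `Y : C ⟶ D` is *dense* (`IsDense`) if every object of
`D` is the target of a surjection from some `Y A`, and if each surjection onto an object `Y A` has a
section on a cover of `A`. For such a `Y`, precomposition is an equivalence for every fibered
pretopos `X` (`IsDense.precomp_isEquivalence`). Indeed an object `Z` of `D` is the quotient of some
`Y A` by a kernel pair which is covered by a span in `C`. The value at `Z` of the extension of
`F : C ⟶ X` is the quotient of `F A` by the image of this span (`IsDense.exists_realization`). It is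
described without choices: locally its generalized elements are those of the objects `F A` for maps
`Y A ⟶ Z`, and two of them agree iff, locally, they come from the same map into `Z`. This
description yields functoriality and the preservation of finite limits and surjections.
Transformations extend because they descend along the surjections `Y A ⟶ Z`.

That the Yoneda embedding is of this kind is seen in the regular logic of the pre-stack.
A morphism of total equivalence relations is determined by its values on generalized elements of
the carrier, these being morphisms out of discrete objects (`elt`). In these terms the finite limits
and images are computed as for sets, and equivalence relations are effective by changing the
relation on the carrier, so that the category of total equivalence relations is exact with the
locally surjective morphisms as regular epimorphisms (`isExact_eqvObj`). The constant objects
functor preserves finite limits and regular epimorphisms, and gluing an exact category along such a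
functor gives a fibered pretopos (`isFiberedPretopos_glue`): a fiber of the gluing is a slice, sums
are compositions with the displayed map, and surjections are the maps whose component in the exact
category is a regular epimorphism. The pre-stack condition says that a morphism between discrete
objects which is given locally, with prescribed image in the base, is given by a map; hence `Y` is
full and faithful. The carrier of a presheaf covers it, and a surjection onto a representable is
locally surjective on generalized elements, so `Y` is dense (`isDense_yoneda`).

Finally, a choice of universal arrows (`UniversalArrows`) gives a left biadjoint with these as unit.
Every functor and transformation is defined by its restriction along the universal arrows, and the
axioms of a pseudofunctor and a pseudonatural transformation are checked there.
-/

namespace FibPsh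

/-! ### Relatively effective epimorphisms -/

section Effective

variable {R : Type u₁} [Category.{v₁} R] {E : Type u₂} [Category.{v₂} E] (p : E ⥤ R)

lemma map_eq_of_isHomLift {A B : E} {f g : A ⟶ B} {J I : R} (u : J ⟶ I) (hf : p.IsHomLift u f)
    (hg : p.IsHomLift u g) : p.map f = p.map g := by
  rw [IsHomLift.fac' p u f, IsHomLift.fac' p u g]

lemma isCart_iff {A B : E} {f : A ⟶ B} : IsCart p f ↔ ∀ ⦃T : E⦄ (g : T ⟶ B)
    (v : p.obj T ⟶ p.obj A), p.map g = v ≫ p.map f → ∃! h : T ⟶ A, p.map h = v ∧ h ≫ f = g := by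
  constructor
  · intro hf T g v hg
    have hf : p.IsStronglyCartesian (p.map f) f := hf
    have : p.IsHomLift (v ≫ p.map f) g := by rw [← hg]; infer_instance
    obtain ⟨h, ⟨h₁, h₂⟩, h₃⟩ := hf.universal_property' v g
    refine ⟨h, ⟨(IsHomLift.eq_of_isHomLift p v h).symm, h₂⟩, fun h' ⟨h₄, h₅⟩ => h₃ h' ⟨?_, h₅⟩⟩
    rw [← h₄]
    infer_instance
  · intro H
    refine { universal_property' := ?_ }
    intro T v g hg
    obtain ⟨h, ⟨h₁, h₂⟩, h₃⟩ := H g v (IsHomLift.eq_of_isHomLift p _ g).symm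
    refine ⟨h, ⟨by rw [← h₁]; infer_instance, h₂⟩, fun h' ⟨h₄, h₅⟩ => h₃ h' ⟨?_, h₅⟩⟩
    exact (IsHomLift.eq_of_isHomLift p v h').symm

lemma isCocart_iff {A B : E} {f : A ⟶ B} : IsCocart p f ↔ ∀ ⦃Z : E⦄ (g : A ⟶ Z)
    (v : p.obj B ⟶ p.obj Z), p.map g = p.map f ≫ v →
      ∃! h : B ⟶ Z, p.map h = v ∧ f ≫ h = g := by
  constructor
  · intro hf T g v hg
    have hf : p.IsStronglyCocartesian (p.map f) f := hf
    have : p.IsHomLift (p.map f ≫ v) g := by rw [← hg]; infer_instance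
    obtain ⟨h, ⟨h₁, h₂⟩, h₃⟩ := hf.universal_property' v g
    refine ⟨h, ⟨(IsHomLift.eq_of_isHomLift p v h).symm, h₂⟩, fun h' ⟨h₄, h₅⟩ => h₃ h' ⟨?_, h₅⟩⟩
    rw [← h₄]
    infer_instance
  · intro H
    refine { universal_property' := ?_ }
    intro T v g hg
    obtain ⟨h, ⟨h₁, h₂⟩, h₃⟩ := H g v (IsHomLift.eq_of_isHomLift p _ g).symm
    refine ⟨h, ⟨by rw [← h₁]; infer_instance, h₂⟩, fun h' ⟨h₄, h₅⟩ => h₃ h' ⟨?_, h₅⟩⟩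
    exact (IsHomLift.eq_of_isHomLift p v h').symm

/-- A morphism `f : A ⟶ B` of the total category is relatively effective if every `g : A ⟶ Z` whose
image in the base factors through `p f`, and which identifies all pairs identified by `f`, factors
uniquely through `f` over any given factorization in the base. Cocartesian maps, regular
epimorphisms of the fibers and (for pre-stacks) cover-cartesian maps are all of this kind. -/
def IsEff {A B : E} (f : A ⟶ B) : Prop :=
  ∀ ⦃Z : E⦄ (g : A ⟶ Z) (v : p.obj B ⟶ p.obj Z), p.map g = p.map f ≫ v →
    (∀ ⦃T : E⦄ (a b : T ⟶ A), a ≫ f = b ≫ f → a ≫ g = b ≫ g) →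
      ∃! h : B ⟶ Z, p.map h = v ∧ f ≫ h = g

/-- Surjections: the universally relatively effective morphisms. They play the role that regular
epimorphisms have in a regular category. -/
def IsSurj {A B : E} (f : A ⟶ B) : Prop :=
  ∀ ⦃P T : E⦄ (a : P ⟶ A) (f' : P ⟶ T) (b : T ⟶ B), IsPullback a f' f b → IsEff p f'

variable {p} {A B C : E}

lemma IsEff.ext {f : A ⟶ B} (hf : IsEff p f) {Z : E} {h h' : B ⟶ Z} (hp : p.map h = p.map h')
    (hh : f ≫ h = f ≫ h') : h = h' :=
  (hf (f ≫ h) (p.map h) (p.map_comp _ _) fun _ a b e => by rw [reassoc_of% e]).unique ⟨rfl, rfl⟩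
    ⟨hp.symm, hh.symm⟩

/-- The universal property of relatively effective maps with the compatibility in the base stated by
lifts, which avoids transporting along equalities of objects of the base. -/
lemma IsEff.desc {f : A ⟶ B} (hf : IsEff p f) {Z : E} (g : A ⟶ Z) {K J I : R} (u : K ⟶ J)
    (v : J ⟶ I) (hu : p.IsHomLift u f) (hg : p.IsHomLift (u ≫ v) g)
    (H : ∀ ⦃T : E⦄ (a b : T ⟶ A), a ≫ f = b ≫ f → a ≫ g = b ≫ g) :
    ∃ h : B ⟶ Z, p.IsHomLift v h ∧ f ≫ h = g := by
  obtain rfl : p.obj Z = I := IsHomLift.codomain_eq p (u ≫ v) g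
  obtain ⟨⟩ := hu
  obtain ⟨h, ⟨rfl, h₂⟩, -⟩ := hf g v (IsHomLift.eq_of_isHomLift p _ g).symm H
  exact ⟨h, inferInstance, h₂⟩

lemma IsEff.of_iso {A' : E} {f : A ⟶ B} (hf : IsEff p f) (e : A' ≅ A) : IsEff p (e.hom ≫ f) := by
  intro Z g v hv H
  have hg : p.map (e.inv ≫ g) = p.map f ≫ v := by
    rw [p.map_comp, hv, ← Category.assoc, ← p.map_comp, e.inv_hom_id_assoc]
  obtain ⟨h, ⟨h₁, h₂⟩, h₃⟩ := hf (e.inv ≫ g) v hg fun T a b hab => by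
    simpa using H (a ≫ e.inv) (b ≫ e.inv) (by simpa using hab)
  refine ⟨h, ⟨h₁, by simp [h₂]⟩, fun h' ⟨h₄, h₅⟩ => h₃ h' ⟨h₄, ?_⟩⟩
  simp [← h₅]

/-- Effectivity need only be checked on one pullback along each map into the codomain. -/
lemma IsSurj.of_exists {f : A ⟶ B} (H : ∀ ⦃T : E⦄ (b : T ⟶ B), ∃ (P : E) (a : P ⟶ A) (f' : P ⟶ T),
    IsPullback a f' f b ∧ IsEff p f') : IsSurj p f := by
  intro P T a f' b h
  obtain ⟨P', a', f'', h', hf⟩ := H b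
  have := hf.of_iso (h.isoIsPullback _ _ h')
  rwa [h.isoIsPullback_hom_snd] at this

lemma IsSurj.isEff {f : A ⟶ B} (hf : IsSurj p f) : IsEff p f :=
  hf _ _ _ (IsPullback.of_id_fst : IsPullback (𝟙 A) f f (𝟙 B))

lemma IsSurj.ext {f : A ⟶ B} (hf : IsSurj p f) {Z : E} {h h' : B ⟶ Z} (hp : p.map h = p.map h')
    (hh : f ≫ h = f ≫ h') : h = h' :=
  hf.isEff.ext hp hh

lemma IsSurj.of_isPullback {P T : E} {a : P ⟶ A} {f' : P ⟶ T} {f : A ⟶ B} {b : T ⟶ B}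
    (hf : IsSurj p f) (h : IsPullback a f' f b) : IsSurj p f' :=
  fun _ _ _ _ _ h' => hf _ _ _ (h'.paste_horiz h)

lemma IsSurj.of_isIso (f : A ⟶ B) [IsIso f] : IsSurj p f := by
  intro P T a f' b h Z g v hv _
  have : IsIso f' := h.isIso_snd_of_isIso
  refine ⟨inv f' ≫ g, ⟨?_, by simp⟩, fun h' ⟨_, h₅⟩ => by simp [← h₅]⟩
  rw [p.map_comp, hv, ← Category.assoc, ← p.map_comp]
  simp

/-- A relatively effective monomorphism over an isomorphism is an isomorphism. -/
lemma IsEff.isIso {f : A ⟶ B} (hf : IsEff p f) [IsIso (p.map f)]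
    (H : ∀ ⦃T : E⦄ (a b : T ⟶ A), a ≫ f = b ≫ f → a = b) : IsIso f := by
  obtain ⟨h, ⟨h₁, h₂⟩, -⟩ := hf (𝟙 A) (inv (p.map f)) (by simp)
    fun T a b e => by rw [H a b e]
  refine ⟨h, h₂, hf.ext (by simp [h₁]) (by simp [reassoc_of% h₂])⟩

/-- If elements identified by `f` are locally equal, the compatibility condition in the universal
property of `f` is void. -/
lemma IsEff.isCocart {f : A ⟶ B} (hf : IsEff p f)
    (H : ∀ ⦃T : E⦄ (a b : T ⟶ A), a ≫ f = b ≫ f →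
      ∃ (T' : E) (t : T' ⟶ T), IsSurj p t ∧ t ≫ a = t ≫ b) : IsCocart p f := by
  rw [isCocart_iff]
  intro Z g v hv
  refine hf g v hv fun T a b e => ?_
  obtain ⟨T', t, ht, h⟩ := H a b e
  refine ht.ext ?_ (by rw [reassoc_of% h])
  rw [p.map_comp, p.map_comp, hv, ← p.map_comp_assoc, e, p.map_comp_assoc]

lemma IsCocart.isEff {f : A ⟶ B} (hf : IsCocart p f) : IsEff p f :=
  fun _ g v hv _ => (isCocart_iff p).1 hf g v hv

variable [HasPullbacks E]

/-- Generalized elements of the codomain of a surjection lift locally. -/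
lemma IsSurj.exists_lift {f : A ⟶ B} (hf : IsSurj p f) {T : E} (b : T ⟶ B) :
    ∃ (T' : E) (t : T' ⟶ T) (a : T' ⟶ A), IsSurj p t ∧ a ≫ f = t ≫ b :=
  ⟨_, pullback.snd f b, pullback.fst f b, hf.of_isPullback (.of_hasPullback _ _),
    pullback.condition⟩

lemma IsEff.comp {f : A ⟶ B} {g : B ⟶ C} (hf : IsSurj p f) (hg : IsEff p g) :
    IsEff p (f ≫ g) := by
  intro Z k v hv H
  obtain ⟨h, ⟨h₁, h₂⟩, -⟩ := hf.isEff k (p.map g ≫ v) (by rw [hv, p.map_comp, Category.assoc])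
    fun T a b e => H a b (by rw [reassoc_of% e])
  -- elements `a, b` of `B` identified by `g` lift, locally, to elements of `A` identified by `f ≫
  -- g`
  obtain ⟨l, ⟨h₃, h₄⟩, -⟩ := hg h v h₁ (by
    intro T a b e
    obtain ⟨T₁, t₁, a', ht₁, ha'⟩ := hf.exists_lift a
    obtain ⟨T₂, t₂, b', ht₂, hb'⟩ := hf.exists_lift (t₁ ≫ b)
    apply ht₁.ext (by rw [p.map_comp, p.map_comp, h₁, ← Category.assoc, ← p.map_comp, e, p.map_comp,
      Category.assoc])
    apply ht₂.ext (by
      rw [p.map_comp, p.map_comp, p.map_comp, p.map_comp, h₁, ← p.map_comp_assoc a, e, p.map_comp,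
        Category.assoc])
    rw [← reassoc_of% ha', ← reassoc_of% hb', h₂, ← Category.assoc]
    refine H _ _ ?_
    rw [Category.assoc, reassoc_of% ha', e, reassoc_of% hb'])
  refine ⟨l, ⟨h₃, by rw [Category.assoc, h₄, h₂]⟩, fun l' ⟨h₅, h₆⟩ => hg.ext (h₅.trans h₃.symm) ?_⟩
  refine hf.ext ?_ ?_
  · rw [p.map_comp, p.map_comp, h₅, h₃]
  · rw [h₄, h₂, ← h₆, Category.assoc]

lemma IsSurj.comp {f : A ⟶ B} {g : B ⟶ C} (hf : IsSurj p f) (hg : IsSurj p g) :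
    IsSurj p (f ≫ g) := by
  apply IsSurj.of_exists
  intro T b
  refine ⟨_, pullback.fst f (pullback.fst g b), pullback.snd f (pullback.fst g b) ≫
    pullback.snd g b, ((IsPullback.of_hasPullback f _).flip.paste_horiz
      (IsPullback.of_hasPullback g b).flip).flip, ?_⟩
  exact IsEff.comp (hf.of_isPullback (.of_hasPullback _ _))
    (hg.of_isPullback (.of_hasPullback _ _)).isEff

lemma IsEff.of_comp {e : A ⟶ B} {f : B ⟶ C} (h : IsSurj p (e ≫ f)) : IsEff p f := by
  intro Z g v hv H
  obtain ⟨l, ⟨h₁, h₂⟩, -⟩ := h.isEff (e ≫ g) v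
    (by rw [p.map_comp, hv, p.map_comp, Category.assoc]) fun T a b hab => by
      simpa using H (a ≫ e) (b ≫ e) (by simpa using hab)
  refine ⟨l, ⟨h₁, ?_⟩, fun l' ⟨h₃, h₄⟩ => h.ext (h₃.trans h₁.symm) ?_⟩
  · obtain ⟨T, t, t', ht, ht'⟩ := h.exists_lift f
    apply ht.ext
    · rw [hv, p.map_comp, h₁]
    · rw [Category.assoc] at h₂
      rw [← reassoc_of% ht', h₂, ← Category.assoc]
      exact H _ _ (by rw [Category.assoc, ht'])
  · rw [h₂, ← h₄, Category.assoc]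

lemma IsSurj.of_comp {e : A ⟶ B} {f : B ⟶ C} (h : IsSurj p (e ≫ f)) : IsSurj p f := by
  apply IsSurj.of_exists
  intro T b
  refine ⟨_, pullback.fst f b, pullback.snd f b, .of_hasPullback _ _, ?_⟩
  refine IsEff.of_comp (e := pullback.snd e (pullback.fst f b)) ?_
  exact h.of_isPullback ((IsPullback.of_hasPullback e (pullback.fst f b)).flip.paste_horiz
      (IsPullback.of_hasPullback f b).flip).flip

lemma IsSurj.of_comp_eq {D : E} {e : A ⟶ B} {f : B ⟶ C} {a : A ⟶ D} {b : D ⟶ C} (ha : IsSurj p a)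
    (hb : IsSurj p b) (h : e ≫ f = a ≫ b) : IsSurj p f :=
  IsSurj.of_comp (e := e) (h ▸ ha.comp hb)

end Effective

/-! ### Pullbacks and terminal objects in the total category -/

section TotalLimits

variable {R : Type u₁} [Category.{v₁} R] {E : Type u₂} [Category.{v₂} E] (p : E ⥤ R)

lemma isHomLift_of_comp_vertical {A B C : E} {J I : R} (u : J ⟶ I) (f : A ⟶ B) (g : B ⟶ C)
    (hg : p.IsHomLift (𝟙 I) g) (hfg : p.IsHomLift u (f ≫ g)) : p.IsHomLift u f := by
  obtain rfl : p.obj B = I := IsHomLift.domain_eq p (𝟙 I) g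
  obtain rfl : p.obj A = J := IsHomLift.domain_eq p u (f ≫ g)
  have h₁ := IsHomLift.fac' p (𝟙 (p.obj B)) g
  have h₂ := IsHomLift.fac' p u (f ≫ g)
  rw [p.map_comp, h₁] at h₂
  simp only [eqToHom_refl, Category.id_comp, cancel_mono] at h₂
  rw [← h₂]
  infer_instance

/-- The existence part of the universal property of cartesian maps, in terms of lifts. -/
lemma exists_cart_factor {A B T : E} {K J I : R} {u : J ⟶ I} {f : A ⟶ B}
    (hf : p.IsStronglyCartesian u f) (t : K ⟶ J) (x : T ⟶ B) (hx : p.IsHomLift (t ≫ u) x) :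
    ∃ x' : T ⟶ A, p.IsHomLift t x' ∧ x' ≫ f = x :=
  ⟨IsStronglyCartesian.map p u f (g := t) rfl x, inferInstance, IsStronglyCartesian.fac ..⟩

lemma cart_ext {A B T : E} {K J I : R} {u : J ⟶ I} {f : A ⟶ B}
    (hf : p.IsStronglyCartesian u f) (t : K ⟶ J) {x y : T ⟶ A} (hx : p.IsHomLift t x)
    (hy : p.IsHomLift t y) (h : x ≫ f = y ≫ f) : x = y :=
  IsStronglyCartesian.ext p u f t h

lemma IsCart.of_isStronglyCartesian {A B : E} {J I : R} (u : J ⟶ I) (f : A ⟶ B)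
    (h : p.IsStronglyCartesian u f) : IsCart p f := by
  obtain ⟨⟩ := h.toIsHomLift
  exact h

lemma IsCart.isStronglyCartesian {A B : E} {J I : R} (u : J ⟶ I) {f : A ⟶ B}
    (h : IsCart p f) (hu : p.IsHomLift u f) : p.IsStronglyCartesian u f := by
  obtain ⟨⟩ := hu
  exact h

lemma IsCocart.of_isStronglyCocartesian {A B : E} {J I : R} (u : J ⟶ I) (f : A ⟶ B)
    (h : p.IsStronglyCocartesian u f) : IsCocart p f := by
  obtain ⟨⟩ := h.toIsHomLift
  exact h

/-- A pullback square in a fiber is a pullback square in the total category. -/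
lemma isPullback_of_fiber [IsLexFibration p] {I : R} {D A B C : p.Fiber I} {a : D ⟶ A}
    {b : D ⟶ B} {f : A ⟶ C} {g : B ⟶ C} (h : IsPullback a b f g) :
    IsPullback a.1 b.1 f.1 g.1 := by
  have univ : ∀ {T : E} (x : T ⟶ A.1) (y : T ⟶ B.1), x ≫ f.1 = y ≫ g.1 →
      ∃! d : T ⟶ D.1, d ≫ a.1 = x ∧ d ≫ b.1 = y := by
    intro T x y hxy
    obtain ⟨K, t, hx⟩ : ∃ (K : R) (t : K ⟶ I), p.IsHomLift t x :=
      ⟨_, p.map x ≫ eqToHom A.2, inferInstance⟩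
    have hf := f.2
    have hg := g.2
    have hy : p.IsHomLift t y := by
      refine isHomLift_of_comp_vertical p t y g.1 hg ?_
      rw [← hxy]
      infer_instance
    obtain ⟨d, ⟨-, h₁, h₂⟩, hu⟩ := isPullback_total p h t x y hx hy hxy
    refine ⟨d, ⟨h₁, h₂⟩, fun d' ⟨h₃, h₄⟩ => hu d' ⟨?_, h₃, h₄⟩⟩
    exact isHomLift_of_comp_vertical p t d' a.1 a.2 (by rw [h₃]; exact hx)
  have comm : a.1 ≫ f.1 = b.1 ≫ g.1 := congrArg Subtype.val h.w
  exact ⟨⟨comm⟩, ⟨PullbackCone.IsLimit.mk comm (fun s => (univ s.fst s.snd s.condition).choose)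
      (fun s => (univ s.fst s.snd s.condition).choose_spec.1.1)
      (fun s => (univ s.fst s.snd s.condition).choose_spec.1.2)
      (fun s m h₀ h₁ => (univ s.fst s.snd s.condition).choose_spec.2 m ⟨h₀, h₁⟩)⟩⟩

/-- A square of vertical maps which is a pullback in the total category is one in the fiber. -/
lemma isPullback_fiber_of_total {I : R} {D A B C : p.Fiber I} {a : D ⟶ A}
    {b : D ⟶ B} {f : A ⟶ C} {g : B ⟶ C} (h : IsPullback a.1 b.1 f.1 g.1) :
    IsPullback a b f g := by
  have comm : a ≫ f = b ≫ g := Subtype.ext h.w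
  refine ⟨⟨comm⟩, ⟨PullbackCone.IsLimit.mk comm (fun s => ⟨h.lift s.fst.1 s.snd.1
    (congrArg Subtype.val s.condition), ?_⟩) ?_ ?_ ?_⟩⟩
  · refine isHomLift_of_comp_vertical p _ _ a.1 a.2 ?_
    rw [h.lift_fst]
    exact s.fst.2
  · exact fun s => Subtype.ext (h.lift_fst ..)
  · exact fun s => Subtype.ext (h.lift_snd ..)
  · intro s m h₁ h₂
    apply Subtype.ext
    apply h.hom_ext
    · exact (congrArg Subtype.val h₁).trans (h.lift_fst ..).symm
    · exact (congrArg Subtype.val h₂).trans (h.lift_snd ..).symm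

/-- Pullbacks in the total category are glued from a pullback in the base, cartesian liftings of the
corners to the apex, and a pullback in the fiber over the apex. -/
lemma isPullback_of_cart [IsLexFibration p] {L J K I : R} {π₀ : L ⟶ J} {π₁ : L ⟶ K}
    {u : J ⟶ I} {v : K ⟶ I} (hR : IsPullback π₀ π₁ u v) {A B C : E} {f : A ⟶ C} {g : B ⟶ C}
    (hf : p.IsHomLift u f) (hg : p.IsHomLift v g) {D A' B' C' : p.Fiber L} {a' : A'.1 ⟶ A}
    {b' : B'.1 ⟶ B} {c' : C'.1 ⟶ C} (ha' : p.IsStronglyCartesian π₀ a')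
    (hb' : p.IsStronglyCartesian π₁ b') (hc' : p.IsStronglyCartesian (π₀ ≫ u) c')
    {α : A' ⟶ C'} {β : B' ⟶ C'} (hα : α.1 ≫ c' = a' ≫ f) (hβ : β.1 ≫ c' = b' ≫ g)
    {a : D ⟶ A'} {b : D ⟶ B'} (h : IsPullback a b α β) :
    IsPullback (a.1 ≫ a') (b.1 ≫ b') f g := by
  have h₀ := isPullback_of_fiber p h
  have hlα := α.2
  have hlβ := β.2
  have hla := a.2
  have hlb := b.2
  have comm : (a.1 ≫ a') ≫ f = (b.1 ≫ b') ≫ g := by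
    rw [Category.assoc, Category.assoc, ← hα, ← hβ, ← Category.assoc, ← Category.assoc, h₀.w]
  have univ : ∀ {T : E} (x : T ⟶ A) (y : T ⟶ B), x ≫ f = y ≫ g →
      ∃! d : T ⟶ D.1, d ≫ a.1 ≫ a' = x ∧ d ≫ b.1 ≫ b' = y := by
    intro T x y hxy
    -- `x` and `y` lie over a pair with a common composite, which factors through `L` by `t`; `x`
    -- and `y` then factor through the cartesian liftings `A'` and `B'` over `t`, and the
    -- factorizations define a map into the pullback in the fiber over `L`
    obtain ⟨x₀, hx⟩ : ∃ x₀ : p.obj T ⟶ J, p.IsHomLift x₀ x :=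
      ⟨p.map x ≫ eqToHom (IsHomLift.domain_eq p u f), inferInstance⟩
    obtain ⟨y₀, hy⟩ : ∃ y₀ : p.obj T ⟶ K, p.IsHomLift y₀ y :=
      ⟨p.map y ≫ eqToHom (IsHomLift.domain_eq p v g), inferInstance⟩
    have hw : x₀ ≫ u = y₀ ≫ v := by
      have h₁ : p.IsHomLift (y₀ ≫ v) (x ≫ f) := by rw [hxy]; infer_instance
      rw [IsHomLift.fac p (x₀ ≫ u) (x ≫ f), IsHomLift.fac p (y₀ ≫ v) (x ≫ f)]
    let t := hR.lift x₀ y₀ hw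
    have ht₀ : t ≫ π₀ = x₀ := hR.lift_fst ..
    have ht₁ : t ≫ π₁ = y₀ := hR.lift_snd ..
    obtain ⟨x', hx', hxx'⟩ := exists_cart_factor p ha' t x (by rwa [ht₀])
    obtain ⟨y', hy', hyy'⟩ := exists_cart_factor p hb' t y (by rwa [ht₁])
    have e : x' ≫ α.1 = y' ≫ β.1 := by
      refine cart_ext p hc' t (x := x' ≫ α.1) (y := y' ≫ β.1) inferInstance inferInstance ?_
      rw [Category.assoc, Category.assoc, hα, hβ, ← Category.assoc, ← Category.assoc, hxx', hyy',
        hxy]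
    refine ⟨h₀.lift x' y' e, ⟨?_, ?_⟩, ?_⟩
    · rw [← Category.assoc, h₀.lift_fst, hxx']
    · rw [← Category.assoc, h₀.lift_snd, hyy']
    · rintro d ⟨h₁, h₂⟩
      obtain ⟨t', hd⟩ : ∃ t' : p.obj T ⟶ L, p.IsHomLift t' d :=
        ⟨p.map d ≫ eqToHom D.2, inferInstance⟩
      have htt : t' = t := by
        apply hR.hom_ext
        · have h₃ : p.IsHomLift (t' ≫ π₀) x := by rw [← h₁]; infer_instance
          rw [ht₀, IsHomLift.fac p x₀ x, IsHomLift.fac p (t' ≫ π₀) x]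
        · have h₃ : p.IsHomLift (t' ≫ π₁) y := by rw [← h₂]; infer_instance
          rw [ht₁, IsHomLift.fac p y₀ y, IsHomLift.fac p (t' ≫ π₁) y]
      subst htt
      apply h₀.hom_ext
      · rw [h₀.lift_fst]
        exact cart_ext p ha' t (x := d ≫ a.1) inferInstance hx' (by rw [Category.assoc, h₁, hxx'])
      · rw [h₀.lift_snd]
        exact cart_ext p hb' t (x := d ≫ b.1) inferInstance hy' (by rw [Category.assoc, h₂, hyy'])
  exact ⟨⟨comm⟩, ⟨PullbackCone.IsLimit.mk comm (fun s => (univ s.fst s.snd s.condition).choose)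
      (fun s => (univ s.fst s.snd s.condition).choose_spec.1.1)
      (fun s => (univ s.fst s.snd s.condition).choose_spec.1.2)
      (fun s m h₀ h₁ => (univ s.fst s.snd s.condition).choose_spec.2 m ⟨h₀, h₁⟩)⟩⟩

lemma exists_isPullback_of_cart [IsLexFibration p] [HasPullbacks R] {A B C : E} (f : A ⟶ C)
    (g : B ⟶ C) : ∃ (D A' B' C' : p.Fiber (pullback (p.map f) (p.map g))) (a' : A'.1 ⟶ A)
      (b' : B'.1 ⟶ B) (c' : C'.1 ⟶ C) (α : A' ⟶ C') (β : B' ⟶ C') (a : D ⟶ A') (b : D ⟶ B'),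
      p.IsStronglyCartesian (pullback.fst (p.map f) (p.map g)) a' ∧
      p.IsStronglyCartesian (pullback.snd (p.map f) (p.map g)) b' ∧
      p.IsStronglyCartesian (pullback.fst (p.map f) (p.map g) ≫ p.map f) c' ∧
      α.1 ≫ c' = a' ≫ f ∧ β.1 ≫ c' = b' ≫ g ∧ IsPullback a b α β := by
  let π₀ := pullback.fst (p.map f) (p.map g)
  let π₁ := pullback.snd (p.map f) (p.map g)
  have hw : π₀ ≫ p.map f = π₁ ≫ p.map g := pullback.condition
  let A₀ : p.Fiber (p.obj A) := ⟨A, rfl⟩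
  let B₀ : p.Fiber (p.obj B) := ⟨B, rfl⟩
  let C₀ : p.Fiber (p.obj C) := ⟨C, rfl⟩
  obtain ⟨α, hα, hα'⟩ := exists_factor_lift p (π₀ ≫ p.map f) C₀ (𝟙 _) (lift p π₀ A₀ ≫ f)
    (by rw [Category.id_comp]; infer_instance)
  obtain ⟨β, hβ, hβ'⟩ := exists_factor_lift p (π₀ ≫ p.map f) C₀ (𝟙 _) (lift p π₁ B₀ ≫ g)
    (by rw [Category.id_comp, hw]; infer_instance)
  let α₁ : (reindex p π₀).obj A₀ ⟶ (reindex p (π₀ ≫ p.map f)).obj C₀ := ⟨α, hα⟩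
  let β₁ : (reindex p π₁).obj B₀ ⟶ (reindex p (π₀ ≫ p.map f)).obj C₀ := ⟨β, hβ⟩
  exact ⟨pullback α₁ β₁, _, _, _, lift p π₀ A₀, lift p π₁ B₀, lift p _ C₀, α₁, β₁, _, _,
    inferInstance, inferInstance, inferInstance, hα', hβ', .of_hasPullback _ _⟩

/-- The projection of a finite limit fibration preserves pullbacks. -/
lemma map_isPullback [IsLexFibration p] [HasPullbacks R] {P A B C : E} {a : P ⟶ A} {b : P ⟶ B}
    {f : A ⟶ C} {g : B ⟶ C} (h : IsPullback a b f g) :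
    IsPullback (p.map a) (p.map b) (p.map f) (p.map g) := by
  obtain ⟨D, A', B', C', a', b', c', α, β, a₀, b₀, ha', hb', hc', hα, hβ, hD⟩ :=
    exists_isPullback_of_cart p f g
  have hR := IsPullback.of_hasPullback (p.map f) (p.map g)
  have h' := isPullback_of_cart p hR inferInstance inferInstance ha' hb' hc' hα hβ hD
  have hla := a₀.2
  have hlb := b₀.2
  have key : IsPullback (p.map (a₀.1 ≫ a')) (p.map (b₀.1 ≫ b')) (p.map f) (p.map g) := by
    refine hR.of_iso (eqToIso D.2.symm) (.refl _) (.refl _) (.refl _) ?_ ?_ (by simp) (by simp)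
    · rw [IsHomLift.fac' p (pullback.fst (p.map f) (p.map g)) (a₀.1 ≫ a')]
      simp
    · rw [IsHomLift.fac' p (pullback.snd (p.map f) (p.map g)) (b₀.1 ≫ b')]
      simp
  refine key.of_iso (p.mapIso (h'.isoIsPullback _ _ h)) (.refl _) (.refl _) (.refl _)
    ?_ ?_ (by simp) (by simp)
  · rw [Functor.mapIso_hom, ← p.map_comp, h'.isoIsPullback_hom_fst, Iso.refl_hom, Category.comp_id]
  · rw [Functor.mapIso_hom, ← p.map_comp, h'.isoIsPullback_hom_snd, Iso.refl_hom, Category.comp_id]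

/-- Objects which are terminal in their fiber, for maps over an arbitrary map of the base. -/
def IsFibTerminal (O : E) : Prop :=
  ∀ ⦃T : E⦄ (v : p.obj T ⟶ p.obj O), ∃! f : T ⟶ O, p.map f = v

variable {p}

lemma IsFibTerminal.ext {O T : E} (hO : IsFibTerminal p O) {f g : T ⟶ O} (h : p.map f = p.map g) :
    f = g :=
  (hO (p.map g)).unique h rfl

lemma IsFibTerminal.exists_lift {O T : E} (hO : IsFibTerminal p O) {J I : R} (hT : p.obj T = J)
    (hI : p.obj O = I) (u : J ⟶ I) : ∃ f : T ⟶ O, p.IsHomLift u f := by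
  subst hT hI
  obtain ⟨f, rfl, -⟩ := hO u
  exact ⟨f, inferInstance⟩

lemma isFibTerminal_one [IsLexFibration p] (I : R) : IsFibTerminal p (one p I).1 := by
  intro T v
  obtain ⟨f, hf, hu⟩ := existsUnique_one p (A := T) rfl (v ≫ eqToHom (one p I).2)
  refine ⟨f, ?_, ?_⟩
  · change p.map f = v
    rw [IsHomLift.fac' p (v ≫ eqToHom (one p I).2) f]
    simp
  · rintro g rfl
    exact hu g inferInstance

lemma isFibTerminal_of_isTerminal [IsLexFibration p] {I : R} {O : p.Fiber I} (hO : IsTerminal O) :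
    IsFibTerminal p O.1 := by
  let e : O ≅ one p I := hO.uniqueUpToIso terminalIsTerminal
  have h₁ : p.IsHomLift (𝟙 I) e.hom.1 := e.hom.2
  have h₂ : p.IsHomLift (𝟙 I) e.inv.1 := e.inv.2
  have h₃ : e.hom.1 ≫ e.inv.1 = 𝟙 _ := congrArg Subtype.val e.hom_inv_id
  have h₄ : e.inv.1 ≫ e.hom.1 = 𝟙 _ := congrArg Subtype.val e.inv_hom_id
  intro T v
  obtain ⟨f, hf, hu⟩ := isFibTerminal_one (p := p) I (v ≫ p.map e.hom.1)
  refine ⟨f ≫ e.inv.1, ?_, ?_⟩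
  · change p.map (f ≫ e.inv.1) = v
    rw [p.map_comp, hf, Category.assoc, ← p.map_comp, h₃]
    simp
  · rintro g rfl
    rw [← hu (g ≫ e.hom.1) (p.map_comp _ _), Category.assoc, h₃, Category.comp_id]

lemma IsFibTerminal.isTerminal {I : R} {O : p.Fiber I} (hO : IsFibTerminal p O.1) :
    Nonempty (IsTerminal O) := by
  have : ∀ A : p.Fiber I, Nonempty (Unique (A ⟶ O)) := by
    intro A
    obtain ⟨f, hf⟩ := hO.exists_lift A.2 O.2 (𝟙 I)
    exact ⟨⟨⟨f, hf⟩⟩, fun g => Subtype.ext (hO.ext (map_eq_of_isHomLift p (𝟙 I) g.2 hf))⟩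
  exact ⟨@IsTerminal.ofUnique _ _ O fun A => (this A).some⟩

lemma IsFibTerminal.isTerminal_total {O : E} (hO : IsFibTerminal p O)
    (hO' : IsTerminal (p.obj O)) : Nonempty (IsTerminal O) := by
  have : ∀ T : E, Nonempty (Unique (T ⟶ O)) := by
    intro T
    obtain ⟨f, -⟩ := (hO (hO'.from (p.obj T))).exists
    exact ⟨⟨⟨f⟩, fun g => hO.ext (hO'.hom_ext _ _)⟩⟩
  exact ⟨@IsTerminal.ofUnique _ _ O fun T => (this T).some⟩

/-- A map is cartesian iff the square with the maps to the fiberwise terminal objects is a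
pullback. -/
lemma isCart_iff_isPullback {A B O O' : E} (hO : IsFibTerminal p O) (hO' : IsFibTerminal p O')
    {f : A ⟶ B} {a : A ⟶ O} {b : B ⟶ O'} {o : O ⟶ O'} [IsIso (p.map a)] [IsIso (p.map b)]
    (w : f ≫ b = a ≫ o) : IsCart p f ↔ IsPullback f a b o := by
  have wp : p.map f ≫ p.map b = p.map a ≫ p.map o := by rw [← p.map_comp, w, p.map_comp]
  rw [isCart_iff]
  constructor
  · intro H
    have univ : ∀ {T : E} (x : T ⟶ B) (y : T ⟶ O), x ≫ b = y ≫ o →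
        ∃! d : T ⟶ A, d ≫ f = x ∧ d ≫ a = y := by
      intro T x y hxy
      obtain ⟨d, ⟨h₁, h₂⟩, hu⟩ := H x (p.map y ≫ inv (p.map a)) (by
        rw [← cancel_mono (p.map b), ← p.map_comp, hxy, Category.assoc, Category.assoc, wp]
        simp)
      refine ⟨d, ⟨h₂, hO.ext ?_⟩, fun d' ⟨h₃, h₄⟩ => hu d' ⟨?_, h₃⟩⟩
      · rw [p.map_comp, h₁]
        simp
      · rw [← h₄]
        simp
    exact ⟨⟨w⟩, ⟨PullbackCone.IsLimit.mk w (fun s => (univ s.fst s.snd s.condition).choose)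
      (fun s => (univ s.fst s.snd s.condition).choose_spec.1.1)
      (fun s => (univ s.fst s.snd s.condition).choose_spec.1.2)
      (fun s m h₀ h₁ => (univ s.fst s.snd s.condition).choose_spec.2 m ⟨h₀, h₁⟩)⟩⟩
  · intro H T g v hg
    obtain ⟨y, hy, -⟩ := hO (v ≫ p.map a)
    have e : g ≫ b = y ≫ o := hO'.ext (by
      rw [p.map_comp, p.map_comp, hg, hy, Category.assoc, wp, Category.assoc])
    refine ⟨H.lift g y e, ⟨?_, H.lift_fst ..⟩, ?_⟩
    · rw [← cancel_mono (p.map a), ← p.map_comp, H.lift_snd, hy]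
    · rintro d ⟨h₁, h₂⟩
      apply H.hom_ext
      · rw [h₂, H.lift_fst]
      · rw [H.lift_snd]
        exact hO.ext (by rw [p.map_comp, h₁, hy])

lemma IsCart.of_isPullback [IsLexFibration p] [HasPullbacks R] {P A B C : E} {a : P ⟶ A}
    {b : P ⟶ B} {f : A ⟶ C} {g : B ⟶ C} (h : IsPullback a b f g) (hf : IsCart p f) :
    IsCart p b := by
  rw [isCart_iff] at hf ⊢
  have hp := map_isPullback p h
  intro T x v hx
  obtain ⟨y, ⟨h₁, h₂⟩, -⟩ := hf (x ≫ g) (v ≫ p.map a) (by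
    rw [p.map_comp, hx, Category.assoc, Category.assoc, hp.w])
  refine ⟨h.lift y x h₂, ⟨?_, h.lift_snd ..⟩, ?_⟩
  · apply hp.hom_ext
    · rw [← p.map_comp, h.lift_fst, h₁]
    · rw [← p.map_comp, h.lift_snd, hx]
  · rintro d ⟨h₃, h₄⟩
    apply h.hom_ext
    · rw [h.lift_fst]
      refine (hf (d ≫ a ≫ f) (v ≫ p.map a) ?_).unique ⟨?_, ?_⟩ ⟨h₁, ?_⟩
      · rw [p.map_comp, p.map_comp, h₃, Category.assoc]
      · rw [p.map_comp, h₃]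
      · rw [Category.assoc]
      · rw [h₂, h.w, reassoc_of% h₄]
    · rw [h₄, h.lift_snd]

lemma IsCover.of_isPullback [IsLexFibration p] [Regular R] {P A B C : E} {a : P ⟶ A}
    {b : P ⟶ B} {f : A ⟶ C} {g : B ⟶ C} (h : IsPullback a b f g) (hf : IsCover p f) :
    IsCover p b :=
  ⟨IsCart.of_isPullback h hf.1, Regular.regularEpiIsStableUnderBaseChange.of_isPullback
    (map_isPullback p h) hf.2⟩

variable (p) in
lemma hasFiniteLimits_total [IsLexFibration p] [HasFiniteLimits R] : HasFiniteLimits E := by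
  have := hasPullbacks_total p
  obtain ⟨h⟩ := (isFibTerminal_one (p := p) (⊤_ R)).isTerminal_total
    (terminalIsTerminal.ofIso (eqToIso (one p (⊤_ R)).2.symm))
  have := h.hasTerminal
  exact hasFiniteLimits_of_hasTerminal_and_pullbacks

end TotalLimits

/-! ### Pre-stacks -/

section PreStack

variable {R : Type u₁} [Category.{v₁} R] {E : Type u₂} [Category.{v₂} E] {p : E ⥤ R}

lemma canonicalDescent_lift [p.IsFibered] {K J I : R} (e : J ⟶ I) {d₀ d₁ : K ⟶ J}
    (h : d₀ ≫ e = d₁ ≫ e) (A : p.Fiber I) :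
    (canonicalDescent p e h A).1 ≫ lift p d₀ ((reindex p e).obj A) ≫ lift p e A =
      lift p d₁ ((reindex p e).obj A) ≫ lift p e A :=
  IsStronglyCartesian.fac p (d₀ ≫ e) (lift p d₀ ((reindex p e).obj A) ≫ lift p e A)
    (f' := d₁ ≫ e) (by rw [Category.id_comp, h]) _

lemma fiber_comp_val {I : R} {A B C : p.Fiber I} (f : A ⟶ B) (g : B ⟶ C) :
    (f ≫ g).1 = f.1 ≫ g.1 := rfl

/-- In a pre-stack, cover-cartesian maps are relatively effective. -/
lemma IsPreStack.isEff [p.IsFibered] [HasPullbacks R] (hp : IsPreStack p) {A B : E} {e : A ⟶ B}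
    (he : IsCover p e) : IsEff p e := by
  obtain ⟨hc, hr⟩ := he
  have hc' : p.IsStronglyCartesian (p.map e) e := hc
  intro Z g v hg H
  let u := p.map e
  let B₀ : p.Fiber (p.obj B) := ⟨B, rfl⟩
  let Z₀ : p.Fiber (p.obj Z) := ⟨Z, rfl⟩
  let W := (reindex p v).obj Z₀
  -- `θ` and `θ'` compare `A` with the chosen reindexing of `B` along `u`
  obtain ⟨θ, hθ, hθe⟩ := exists_cart_factor p hc' (𝟙 _) (lift p u B₀)
    (by rw [Category.id_comp]; infer_instance)
  obtain ⟨θ', hθ', hθe'⟩ := exists_factor_lift p u B₀ (𝟙 _) e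
    (by rw [Category.id_comp]; infer_instance)
  have hθθ : θ' ≫ θ = 𝟙 A := cart_ext p hc' (𝟙 _) (x := θ' ≫ θ) (y := 𝟙 A) inferInstance
    inferInstance (by rw [Category.assoc, hθe, hθe', Category.id_comp])
  have hgl : p.IsHomLift (u ≫ v) g := by rw [← hg]; infer_instance
  -- maps `B ⟶ Z` over `v` are vertical maps `B ⟶ W`, and `g` becomes a vertical map `f₁` from
  -- `u* B` to `u* W`, to be descended along `u`
  obtain ⟨x, hx, hxg⟩ := exists_factor_lift p v Z₀ u (θ ≫ g) inferInstance
  obtain ⟨f, hf, hfx⟩ := exists_factor_lift p u W (𝟙 _) x (by rw [Category.id_comp]; exact hx)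
  let f₁ : (reindex p u).obj B₀ ⟶ (reindex p u).obj W := ⟨f, hf⟩
  let d₀ := pullback.fst u u
  let d₁ := pullback.snd u u
  have hk : IsKernelPair u d₀ d₁ := .of_hasPullback u
  have hd₀ := fun {X Y : p.Fiber (p.obj A)} (f : X ⟶ Y) => reindex_map_lift p d₀ f
  have hd₁ := fun {X Y : p.Fiber (p.obj A)} (f : X ⟶ Y) => reindex_map_lift p d₁ f
  -- `f₁` commutes with the descent data, as `g` identifies the two maps `d₀* u* B ⟶ A`, which `e`
  -- identifies
  have cond : canonicalDescent p u hk.w B₀ ≫ (reindex p d₀).map f₁ =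
      (reindex p d₁).map f₁ ≫ canonicalDescent p u hk.w W := by
    have hL := (canonicalDescent p u hk.w B₀ ≫ (reindex p d₀).map f₁).2
    have hR := ((reindex p d₁).map f₁ ≫ canonicalDescent p u hk.w W).2
    apply Subtype.ext
    refine hom_ext_lift p d₀ _ (𝟙 _) hL hR ?_
    refine hom_ext_lift p u W (𝟙 _ ≫ d₀) inferInstance inferInstance ?_
    refine hom_ext_lift p v Z₀ ((𝟙 _ ≫ d₀) ≫ u) inferInstance inferInstance ?_
    rw [fiber_comp_val, fiber_comp_val]
    simp only [Category.assoc]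
    have h₁ := reassoc_of% (hd₀ f₁)
    have h₂ := reassoc_of% (hd₁ f₁)
    have h₃ := reassoc_of% (canonicalDescent_lift u hk.w W)
    rw [h₁, h₃, h₂]
    have h₄ : f ≫ lift p u W ≫ lift p v Z₀ = θ ≫ g := by rw [reassoc_of% hfx, hxg]
    change (canonicalDescent p u hk.w B₀).1 ≫ lift p d₀ _ ≫ f ≫ lift p u W ≫ lift p v Z₀ =
      lift p d₁ _ ≫ f ≫ lift p u W ≫ lift p v Z₀
    rw [h₄]
    have h₅ := H ((canonicalDescent p u hk.w B₀).1 ≫ lift p d₀ _ ≫ θ) (lift p d₁ _ ≫ θ) (by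
      rw [Category.assoc, Category.assoc, Category.assoc, hθe, canonicalDescent_lift])
    simpa only [Category.assoc] using h₅
  have key : ∀ h : B₀ ⟶ W, (reindex p u).map h = f₁ ↔ e ≫ h.1 ≫ lift p v Z₀ = g := by
    intro h
    have hh := h.2
    have h₁ := reindex_map_lift p u h
    constructor
    · intro h₂
      rw [h₂] at h₁
      rw [← hθe', Category.assoc, ← reassoc_of% h₁]
      change θ' ≫ f ≫ _ = _
      rw [reassoc_of% hfx, hxg, reassoc_of% hθθ]
    · intro h₂
      apply Subtype.ext
      refine hom_ext_lift p u W (𝟙 _) (Subtype.property _) hf ?_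
      rw [h₁, hfx]
      refine hom_ext_lift p v Z₀ u inferInstance hx ?_
      rw [hxg, ← hθe, Category.assoc, Category.assoc, h₂]
  obtain ⟨h, hh, hu⟩ := hp u d₀ d₁ hr hk B₀ W f₁ cond
  have hhl := h.2
  refine ⟨h.1 ≫ lift p v Z₀, ⟨?_, (key h).1 hh⟩, ?_⟩
  · have : p.IsHomLift v (h.1 ≫ lift p v Z₀) := inferInstance
    exact (IsHomLift.eq_of_isHomLift p v _).symm
  · rintro h' ⟨h₁, h₂⟩
    obtain ⟨h'', hl'', rfl⟩ := exists_factor_lift p v Z₀ (𝟙 _) h'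
      (by rw [Category.id_comp, ← h₁]; infer_instance)
    rw [← hu ⟨h'', hl''⟩ ((key _).2 h₂)]

/-- A fibration in which cover-cartesian maps are relatively effective is a pre-stack. -/
lemma isPreStack_of_isEff [p.IsFibered]
    (hp : ∀ ⦃A B : E⦄ (e : A ⟶ B), IsCover p e → IsEff p e) : IsPreStack p := by
  intro K J I u d₀ d₁ hu hk A B f hf
  have hfl := f.2
  have hfl' := (canonicalDescent p u hk.w A).2
  have hfl'' := (canonicalDescent p u hk.w B).2
  have he : IsEff p (lift p u A) := hp _ (IsCover.of_lift p u _ hu)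
  have key : ∀ h : A ⟶ B, (reindex p u).map h = f ↔ lift p u A ≫ h.1 = f.1 ≫ lift p u B := by
    intro h
    rw [← reindex_map_lift]
    refine ⟨fun h => by rw [h], fun h => Subtype.ext ?_⟩
    exact hom_ext_lift p u B (𝟙 _) (Subtype.property _) f.2 h
  -- a map `f` of descent data descends if `f ≫ lift p u B` identifies the elements `a, b`
  -- identified by the lifting of `u`; such a pair is of the form `b' ≫ d₀*`, `b' ≫ d₁*` up to the
  -- descent datum of `A`
  obtain ⟨h, hh, hfac⟩ := he.desc (f.1 ≫ lift p u B) u (𝟙 I) inferInstance inferInstance (by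
    intro T a b hab
    obtain ⟨a₀, ha⟩ : ∃ a₀ : p.obj T ⟶ J, p.IsHomLift a₀ a :=
      ⟨p.map a ≫ eqToHom ((reindex p u).obj A).2, inferInstance⟩
    obtain ⟨b₀, hb⟩ : ∃ b₀ : p.obj T ⟶ J, p.IsHomLift b₀ b :=
      ⟨p.map b ≫ eqToHom ((reindex p u).obj A).2, inferInstance⟩
    have hw : a₀ ≫ u = b₀ ≫ u := by
      have h₁ : p.IsHomLift (b₀ ≫ u) (a ≫ lift p u A) := by rw [hab]; infer_instance
      rw [IsHomLift.fac p (a₀ ≫ u) (a ≫ lift p u A), IsHomLift.fac p (b₀ ≫ u) (a ≫ lift p u A)]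
    let t := hk.lift a₀ b₀ hw
    have ht₀ : t ≫ d₀ = a₀ := hk.lift_fst ..
    have ht₁ : t ≫ d₁ = b₀ := hk.lift_snd ..
    obtain ⟨b', hb', hbb⟩ := exists_factor_lift p d₁ ((reindex p u).obj A) t b (by rwa [ht₁])
    have h₀ : a = b' ≫ (canonicalDescent p u hk.w A).1 ≫ lift p d₀ _ := by
      refine hom_ext_lift p u A a₀ ha ?_ ?_
      · rw [← ht₀]
        infer_instance
      · rw [Category.assoc, Category.assoc, canonicalDescent_lift, reassoc_of% hbb, hab]
    have h₁ := congrArg Subtype.val hf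
    rw [fiber_comp_val, fiber_comp_val] at h₁
    have h₂ := reassoc_of% (reindex_map_lift p d₀ f)
    have h₃ := reassoc_of% (reindex_map_lift p d₁ f)
    have h₄ := canonicalDescent_lift u hk.w B
    rw [h₀, ← hbb]
    simp only [Category.assoc]
    rw [← h₂, reassoc_of% h₁, h₄, h₃])
  refine ⟨⟨h, hh⟩, (key _).2 hfac, fun h' hh' => Subtype.ext (he.ext ?_ ?_)⟩
  · exact map_eq_of_isHomLift p (𝟙 I) h'.2 hh
  · rw [(key _).1 hh', hfac]

/-- In a finite limit pre-stack, cover-cartesian maps are surjections. -/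
lemma IsCover.isSurj [Regular R] [IsLexPreStack p] {A B : E} {e : A ⟶ B} (he : IsCover p e) :
    IsSurj p e :=
  fun _ _ _ _ _ h => IsLexPreStack.isPreStack.isEff (IsCover.of_isPullback h he)

end PreStack

/-! ### Finite limit preserving fibered functors -/

section LexFunctors

variable {R : Type u₁} [Category.{v₁} R]
variable {C : BasedCategory.{v₂, u₂} R} {D : BasedCategory.{v₃, u₃} R}

lemma preservesFiniteLimits_of_isPullback {A : Type u₃} [Category.{v₃} A] {B : Type u₄}
    [Category.{v₄} B] (F : A ⥤ B) [HasFiniteLimits A] {t : A} (ht : IsTerminal t)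
    (ht' : Nonempty (IsTerminal (F.obj t)))
    (H : ∀ ⦃P X Y Z : A⦄ ⦃a : P ⟶ X⦄ ⦃b : P ⟶ Y⦄ ⦃f : X ⟶ Z⦄ ⦃g : Y ⟶ Z⦄,
      IsPullback a b f g → IsPullback (F.map a) (F.map b) (F.map f) (F.map g)) :
    PreservesFiniteLimits F := by
  obtain ⟨ht'⟩ := ht'
  have : PreservesLimit (Functor.empty.{0} A) F :=
    preservesLimit_of_preserves_limit_cone ht ((isLimitMapConeEmptyConeEquiv F t).symm ht')
  have := preservesLimitsOfShape_pempty_of_preservesTerminal F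
  have : PreservesLimitsOfShape WalkingCospan F :=
    preservesLimitsOfShape_walkingCospan_of_forall_isPullback fun X Y Z f g _ =>
      ⟨_, _, _, .of_hasPullback f g, H (.of_hasPullback f g)⟩
  exact preservesFiniteLimits_of_preservesTerminal_and_pullbacks F

lemma IsLexFunctor.map_isStronglyCartesian {F : BasedFunctor C D} (hF : IsLexFunctor F)
    {A B : C.obj} {J I : R} (u : J ⟶ I) {f : A ⟶ B} (hf : C.p.IsStronglyCartesian u f) :
    D.p.IsStronglyCartesian u (F.map f) :=
  IsCart.isStronglyCartesian D.p u (hF.map_cart f (IsCart.of_isStronglyCartesian C.p u f hf))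
    (have := hf.toIsHomLift; inferInstance)

/-- Finite limit preserving fibered functors preserve pullbacks of the total categories. -/
lemma IsLexFunctor.map_isPullback [HasPullbacks R] [IsLexFibration C.p] [IsLexFibration D.p]
    {F : BasedFunctor C D} (hF : IsLexFunctor F) {P A B Z : C.obj} {a : P ⟶ A} {b : P ⟶ B}
    {f : A ⟶ Z} {g : B ⟶ Z} (h : IsPullback a b f g) :
    IsPullback (F.map a) (F.map b) (F.map f) (F.map g) := by
  obtain ⟨P', A', B', Z', a', b', z', α, β, a₀, b₀, ha', hb', hz', hα, hβ, hP⟩ :=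
    exists_isPullback_of_cart C.p f g
  have hR := IsPullback.of_hasPullback (C.p.map f) (C.p.map g)
  have h' := isPullback_of_cart C.p hR inferInstance inferInstance ha' hb' hz' hα hβ hP
  have := hF.preservesFiniteLimits (pullback (C.p.map f) (C.p.map g))
  have key := isPullback_of_cart D.p hR (f := F.map f) (g := F.map g) inferInstance inferInstance
    (A' := (fiberFunctor F _).obj A') (B' := (fiberFunctor F _).obj B')
    (C' := (fiberFunctor F _).obj Z') (α := (fiberFunctor F _).map α)
    (β := (fiberFunctor F _).map β)
    (hF.map_isStronglyCartesian _ ha') (hF.map_isStronglyCartesian _ hb')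
    (hF.map_isStronglyCartesian _ hz')
    ((F.map_comp α.1 z').symm.trans ((congrArg F.map hα).trans (F.map_comp _ _)))
    ((F.map_comp β.1 z').symm.trans ((congrArg F.map hβ).trans (F.map_comp _ _)))
    (hP.map (fiberFunctor F _))
  refine key.of_iso (F.mapIso (h'.isoIsPullback _ _ h)) (.refl _) (.refl _) (.refl _)
    ?_ ?_ (by simp) (by simp)
  · exact (Category.comp_id _).trans ((F.map_comp _ _).symm.trans
      (congrArg F.map (h'.isoIsPullback_hom_fst _ _ h).symm) |>.trans (F.map_comp _ _))
  · exact (Category.comp_id _).trans ((F.map_comp _ _).symm.trans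
      (congrArg F.map (h'.isoIsPullback_hom_snd _ _ h).symm) |>.trans (F.map_comp _ _))

lemma IsLexFunctor.map_isFibTerminal [IsLexFibration C.p] [IsLexFibration D.p]
    {F : BasedFunctor C D} (hF : IsLexFunctor F) {O : C.obj} (hO : IsFibTerminal C.p O) :
    IsFibTerminal D.p (F.obj O) := by
  let O' : C.p.Fiber (C.p.obj O) := ⟨O, rfl⟩
  have := hF.preservesFiniteLimits (C.p.obj O)
  obtain ⟨h⟩ := IsFibTerminal.isTerminal (p := C.p) (O := O') hO
  exact isFibTerminal_of_isTerminal (h.isTerminalObj (fiberFunctor F _))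

lemma IsLexFunctor.preservesFiniteLimits_total [HasFiniteLimits R] [IsLexFibration C.p]
    [IsLexFibration D.p] {F : BasedFunctor C D} (hF : IsLexFunctor F) :
    PreservesFiniteLimits F.toFunctor := by
  have := hasFiniteLimits_total C.p
  let O := (one C.p (⊤_ R)).1
  have hO : IsFibTerminal C.p O := isFibTerminal_one (⊤_ R)
  have hO' : IsTerminal (C.p.obj O) := terminalIsTerminal.ofIso (eqToIso (one C.p (⊤_ R)).2.symm)
  have hO'' : IsTerminal (D.p.obj (F.obj O)) := hO'.ofIso (eqToIso (F.w_obj O).symm)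
  obtain ⟨t⟩ := hO.isTerminal_total hO'
  exact preservesFiniteLimits_of_isPullback F.toFunctor t
    ((hF.map_isFibTerminal hO).isTerminal_total hO'') fun _ _ _ _ _ _ _ _ h => hF.map_isPullback h

lemma IsLexFunctor.map_isCover [IsLexFibration C.p] [IsLexFibration D.p]
    {F : BasedFunctor C D} (hF : IsLexFunctor F) {A B : C.obj} {e : A ⟶ B} (he : IsCover C.p e) :
    IsCover D.p (F.map e) := by
  have := hF.map_isStronglyCartesian (C.p.map e) he.1
  exact IsCover.of_lift D.p (C.p.map e) _ he.2

lemma isIso_map_of_vertical {A B : D.obj} {I : R} (f : A ⟶ B) (hf : D.p.IsHomLift (𝟙 I) f) :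
    IsIso (D.p.map f) := by
  rw [IsHomLift.fac' D.p (𝟙 I) f]
  infer_instance

/-- A functor over the base which preserves pullbacks of the total categories and fiberwise terminal
objects is a finite limit preserving fibered functor. -/
lemma IsLexFunctor.of_isPullback [IsLexFibration C.p] [IsLexFibration D.p]
    {F : BasedFunctor C D} (h₁ : ∀ I, IsFibTerminal D.p (F.obj (one C.p I).1))
    (h₂ : ∀ ⦃P A B Z : C.obj⦄ ⦃a : P ⟶ A⦄ ⦃b : P ⟶ B⦄ ⦃f : A ⟶ Z⦄ ⦃g : B ⟶ Z⦄,
      IsPullback a b f g → IsPullback (F.map a) (F.map b) (F.map f) (F.map g)) :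
    IsLexFunctor F where
  map_cart A B f hf := by
    have hA := isFibTerminal_one (p := C.p) (C.p.obj A)
    have hB := isFibTerminal_one (p := C.p) (C.p.obj B)
    obtain ⟨a, ha⟩ := hA.exists_lift (T := A) rfl (one C.p _).2 (𝟙 (C.p.obj _))
    obtain ⟨b, hb⟩ := hB.exists_lift (T := B) rfl (one C.p _).2 (𝟙 (C.p.obj _))
    obtain ⟨o, ho⟩ := hB.exists_lift (one C.p (C.p.obj A)).2 (one C.p _).2 (C.p.map f)
    have := isIso_map_of_vertical a ha
    have := isIso_map_of_vertical b hb
    have := isIso_map_of_vertical (F.map a) (BasedFunctor.preserves_isHomLift F (𝟙 (C.p.obj A)) a)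
    have := isIso_map_of_vertical (F.map b) (BasedFunctor.preserves_isHomLift F (𝟙 (C.p.obj B)) b)
    have w : f ≫ b = a ≫ o :=
      hB.ext (map_eq_of_isHomLift C.p (C.p.map f) inferInstance inferInstance)
    have h := h₂ ((isCart_iff_isPullback hA hB w).1 hf)
    exact (isCart_iff_isPullback (h₁ _) (h₁ _) h.w).2 h
  preservesFiniteLimits I := by
    exact preservesFiniteLimits_of_isPullback (fiberFunctor F I) (t := one C.p I) terminalIsTerminal
      (IsFibTerminal.isTerminal (p := D.p) (O := (fiberFunctor F I).obj (one C.p I)) (h₁ I))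
      fun _ _ _ _ _ _ _ _ h => isPullback_fiber_of_total D.p (h₂ (isPullback_of_fiber C.p h))

end LexFunctors

/-! ### Surjections in fibered pretoposes -/

section Pretopos

variable {R : Type u₁} [Category.{v₁} R] {E : Type u₂} [Category.{v₂} E] {p : E ⥤ R}

lemma exists_cocart_factor {A B Z : E} {K J I : R} {u : J ⟶ I} {f : A ⟶ B}
    (hf : p.IsStronglyCocartesian u f) (v : I ⟶ K) (x : A ⟶ Z) (hx : p.IsHomLift (u ≫ v) x) :
    ∃ x' : B ⟶ Z, p.IsHomLift v x' ∧ f ≫ x' = x := by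
  obtain rfl : p.obj Z = K := IsHomLift.codomain_eq p (u ≫ v) x
  exact (hf.universal_property' v x).exists

/-- The naturality square of the cartesian liftings is a pullback. -/
lemma isPullback_reindex [p.IsFibered] {J I : R} (u : J ⟶ I) {A B : p.Fiber I} (f : A ⟶ B) :
    IsPullback (lift p u A) ((reindex p u).map f).1 f.1 (lift p u B) := by
  have hf := f.2
  have hf' := ((reindex p u).map f).2
  have comm := (reindex_map_lift p u f).symm
  have univ : ∀ {T : E} (x : T ⟶ A.1) (y : T ⟶ ((reindex p u).obj B).1), x ≫ f.1 = y ≫ lift p u B →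
      ∃! d : T ⟶ ((reindex p u).obj A).1,
        d ≫ lift p u A = x ∧ d ≫ ((reindex p u).map f).1 = y := by
    intro T x y hxy
    obtain ⟨t, hy⟩ : ∃ t : p.obj T ⟶ J, p.IsHomLift t y :=
      ⟨p.map y ≫ eqToHom ((reindex p u).obj B).2, inferInstance⟩
    have hx : p.IsHomLift (t ≫ u) x := by
      refine isHomLift_of_comp_vertical p _ x f.1 hf ?_
      rw [hxy]
      infer_instance
    obtain ⟨d, hd, hdx⟩ := exists_factor_lift p u A t x hx
    have key : d ≫ ((reindex p u).map f).1 = y := by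
      refine hom_ext_lift p u B t (x := d ≫ ((reindex p u).map f).1) inferInstance hy ?_
      rw [Category.assoc, reindex_map_lift, reassoc_of% hdx, hxy]
    refine ⟨d, ⟨hdx, key⟩, fun d' ⟨h₁, h₂⟩ => ?_⟩
    refine hom_ext_lift p u A t ?_ hd (by rw [h₁, hdx])
    refine isHomLift_of_comp_vertical p _ d' _ hf' ?_
    rw [h₂]
    exact hy
  exact ⟨⟨comm⟩, ⟨PullbackCone.IsLimit.mk comm (fun s => (univ s.fst s.snd s.condition).choose)
      (fun s => (univ s.fst s.snd s.condition).choose_spec.1.1)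
      (fun s => (univ s.fst s.snd s.condition).choose_spec.1.2)
      (fun s m h₀ h₁ => (univ s.fst s.snd s.condition).choose_spec.2 m ⟨h₀, h₁⟩)⟩⟩

/-- Regular epimorphisms of the fibers are relatively effective. -/
lemma isEff_of_regularEpi [p.IsFibered] {I : R} {A B : p.Fiber I} (q : A ⟶ B)
    [hq : IsRegularEpi q] : IsEff p q.1 := by
  intro Z g v hg H
  let Z₀ : p.Fiber (p.obj Z) := ⟨Z, rfl⟩
  let v' : I ⟶ p.obj Z := eqToHom B.2.symm ≫ v
  have hq₂ := q.2
  have lifts_of : ∀ {h : B.1 ⟶ Z}, p.map h = v → p.IsHomLift v' h := by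
    rintro h rfl
    infer_instance
  have hgl : p.IsHomLift v' g := by
    have h₁ : p.map q.1 = eqToHom (A.2.trans B.2.symm) := by
      rw [IsHomLift.fac' p (𝟙 I) q.1]
      simp
    have h₂ : v' = eqToHom A.2.symm ≫ p.map g := by
      rw [hg, h₁, eqToHom_trans_assoc]
    rw [h₂]
    infer_instance
  obtain ⟨g', hg', hgg⟩ := exists_factor_lift p v' Z₀ (𝟙 I) g (by rwa [Category.id_comp])
  let g₁ : A ⟶ (reindex p v').obj Z₀ := ⟨g', hg'⟩
  have w : IsRegularEpi.left q ≫ g₁ = IsRegularEpi.right q ≫ g₁ := by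
    have h₁ := (IsRegularEpi.left q ≫ g₁).2
    have h₂ := (IsRegularEpi.right q ≫ g₁).2
    apply Subtype.ext
    refine hom_ext_lift p v' Z₀ (𝟙 I) h₁ h₂ ?_
    rw [fiber_comp_val, fiber_comp_val, Category.assoc, Category.assoc]
    change _ ≫ g' ≫ _ = _ ≫ g' ≫ _
    rw [hgg]
    exact H _ _ (congrArg Subtype.val (IsRegularEpi.w q))
  let d := IsRegularEpi.desc q g₁ w
  have hd : q.1 ≫ d.1 = g' := congrArg Subtype.val (IsRegularEpi.fac q g₁ w)
  have hd₂ := d.2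
  have hl : p.IsHomLift v' (d.1 ≫ lift p v' Z₀) := inferInstance
  refine ⟨d.1 ≫ lift p v' Z₀, ⟨?_, ?_⟩, ?_⟩
  · have h₁ := IsHomLift.fac' p v' (d.1 ≫ lift p v' Z₀)
    refine h₁.trans ?_
    simp [v']
  · rw [reassoc_of% hd, hgg]
  · rintro h ⟨h₁, h₂⟩
    obtain ⟨h', hh', hhh⟩ := exists_factor_lift p v' Z₀ (𝟙 I) h
      (by rw [Category.id_comp]; exact lifts_of h₁)
    let h₃ : B ⟶ (reindex p v').obj Z₀ := ⟨h', hh'⟩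
    have : h₃ = d := by
      refine IsRegularEpi.uniq q g₁ w h₃ (Subtype.ext ?_)
      refine hom_ext_lift p v' Z₀ (𝟙 I) (Subtype.property (q ≫ h₃)) hg' ?_
      rw [hgg, ← h₂, ← hhh, fiber_comp_val, Category.assoc]
    rw [← hhh, ← this]

lemma regularEpi_of_isEff [IsLexFibration p] {I : R} {A B : p.Fiber I} (q : A ⟶ B)
    (hq : IsEff p q.1) :
    IsRegularEpi q := by
  have hk := IsPullback.of_hasPullback q q
  have hk' := isPullback_of_fiber p hk
  have hq₂ := q.2
  refine ⟨⟨⟨_, _, _, hk.w, ?_⟩⟩⟩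
  refine Cofork.IsColimit.mk' _ fun c => ?_
  have hc := c.π.2
  have h : ∃ h : B.1 ⟶ c.pt.1, p.IsHomLift (𝟙 I) h ∧ q.1 ≫ h = c.π.1 := by
    refine hq.desc c.π.1 (𝟙 I) (𝟙 I) hq₂ (by rw [Category.id_comp]; infer_instance) ?_
    intro T a b hab
    have h₁ := congrArg Subtype.val c.condition
    rw [fiber_comp_val, fiber_comp_val] at h₁
    rw [← hk'.lift_fst a b hab, Category.assoc, h₁, ← Category.assoc, hk'.lift_snd a b hab]
  refine ⟨⟨h.choose, h.choose_spec.1⟩, Subtype.ext h.choose_spec.2, fun {m} hm => Subtype.ext ?_⟩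
  refine hq.ext (map_eq_of_isHomLift p (𝟙 I) m.2 h.choose_spec.1) ?_
  exact (congrArg Subtype.val hm).trans h.choose_spec.2.symm

variable [IsFiberedPretopos p]

instance (I : R) : Regular (p.Fiber I) := (IsFiberedPretopos.isExact (p := p) I).regular

/-- Cocartesian maps of a fibered pretopos are surjections. -/
lemma IsCocart.isSurj {A B : E} {s : A ⟶ B} (hs : IsCocart p s) : IsSurj p s :=
  fun _ _ _ _ _ h => IsCocart.isEff
    ((IsFiberedPretopos.hasExtensiveSums (p := p)).stable h hs)

/-- Regular epimorphisms of the fibers are surjections. -/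
lemma isSurj_of_regularEpi [Regular R] {I : R} {A B : p.Fiber I} (q : A ⟶ B) [hq : IsRegularEpi q] :
    IsSurj p q.1 := by
  apply IsSurj.of_exists
  intro T b
  obtain ⟨t, ht⟩ : ∃ t : p.obj T ⟶ I, p.IsHomLift t b := ⟨p.map b ≫ eqToHom B.2, inferInstance⟩
  obtain ⟨b', hb', rfl⟩ := exists_factor_lift p t B (𝟙 _) b (by rwa [Category.id_comp])
  let T₀ : p.Fiber (p.obj T) := ⟨T, rfl⟩
  let b₁ : T₀ ⟶ (reindex p t).obj B := ⟨b', hb'⟩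
  -- the pullback of `q` along `b` is, up to the cartesian lifting, the pullback along `b'` of the
  -- reindexing of `q`, which is a regular epimorphism of the fiber
  have : IsRegularEpi ((reindex p t).map q) :=
    (IsFiberedPretopos.isRegularFunctor (p := p) t).map_regularEpi q hq
  have h₁ := isPullback_of_fiber p (IsPullback.of_hasPullback ((reindex p t).map q) b₁)
  exact ⟨_, _, _, h₁.paste_horiz (isPullback_reindex t q), isEff_of_regularEpi _⟩

/-- Elements identified by a cocartesian map are locally equal: sums are disjoint. -/
lemma IsCocart.locally_eq [Regular R] {A B T : E} {s : A ⟶ B} (hs : IsCocart p s) (a b : T ⟶ A)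
    (hab : a ≫ s = b ≫ s) : ∃ (T' : E) (t : T' ⟶ T), IsSurj p t ∧ t ≫ a = t ≫ b := by
  have := hasPullbacks_total p
  -- the diagonal of `s` is cocartesian, hence a surjection onto the kernel pair of `s`
  have hd : IsCocart p (pullback.lift (f := s) (g := s) (𝟙 A) (𝟙 A) rfl) :=
    (IsFiberedPretopos.hasExtensiveSums (p := p)).disjoint _ (.of_hasPullback s s) hs
      (pullback.lift_fst ..) (pullback.lift_snd ..)
  obtain ⟨T', t, c, ht, hc⟩ := hd.isSurj.exists_lift (pullback.lift a b hab)
  refine ⟨T', t, ht, ?_⟩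
  have h₁ := congrArg (· ≫ pullback.fst s s) hc
  have h₂ := congrArg (· ≫ pullback.snd s s) hc
  simp only [Category.assoc, pullback.lift_fst, pullback.lift_snd, Category.comp_id] at h₁ h₂
  rw [← h₁, h₂]

/-- Every map factors as a cocartesian map followed by a vertical map. -/
lemma exists_cocart_vertical {A B : E} {J I : R} (u : J ⟶ I) (f : A ⟶ B)
    (hf : p.IsHomLift u f) : ∃ (M : p.Fiber I) (s : A ⟶ M.1) (q : M.1 ⟶ B),
      p.IsStronglyCocartesian u s ∧ p.IsHomLift (𝟙 I) q ∧ s ≫ q = f := by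
  obtain rfl : p.obj A = J := IsHomLift.domain_eq p u f
  obtain ⟨M, s, hs⟩ := (IsFiberedPretopos.hasExtensiveSums (p := p)).exists_cocart A u
  obtain ⟨q, hq, hsq⟩ := exists_cocart_factor hs (𝟙 I) f (by rwa [Category.comp_id])
  exact ⟨⟨M, IsHomLift.codomain_eq p u s⟩, s, q, hs, hq, hsq⟩

end Pretopos

section Positive

variable {R : Type u₁} [Category.{v₁} R] [Regular R]
variable {C : BasedCategory.{v₂, u₂} R} {D : BasedCategory.{v₃, u₃} R}
variable [IsFiberedPretopos C.p] [IsFiberedPretopos D.p]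

/-- Positive functors preserve surjections. -/
lemma IsPositiveFunctor.map_isSurj {F : BasedFunctor C D} (hF : IsPositiveFunctor F) {A B : C.obj}
    {f : A ⟶ B} (hf : IsSurj C.p f) : IsSurj D.p (F.map f) := by
  have := hasPullbacks_total C.p
  have := hasPullbacks_total D.p
  let B₀ : C.p.Fiber (C.p.obj B) := ⟨B, rfl⟩
  obtain ⟨M, s, q, hs, hq, rfl⟩ := exists_cocart_vertical (p := C.p) (C.p.map f) f inferInstance
  let q₁ : M ⟶ B₀ := ⟨q, hq⟩
  -- `f` is a cocartesian map followed by a regular epimorphism of a fiber, and `F` preserves both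
  have h₁ : IsRegularEpi q₁ := regularEpi_of_isEff q₁ (IsSurj.of_comp hf).isEff
  have h₂ : IsRegularEpi ((fiberFunctor F _).map q₁) := (hF.isRegularFunctor _).map_regularEpi q₁ h₁
  have h₃ : IsSurj D.p (F.map q) := isSurj_of_regularEpi ((fiberFunctor F _).map q₁)
  rw [F.map_comp]
  exact (hF.map_cocart s (IsCocart.of_isStronglyCocartesian C.p _ s hs)).isSurj.comp h₃

/-- A finite limit preserving fibered functor which preserves surjections is positive. -/
lemma IsPositiveFunctor.of_isSurj {F : BasedFunctor C D} (hF : IsLexFunctor F)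
    (H : ∀ ⦃A B : C.obj⦄ (f : A ⟶ B), IsSurj C.p f → IsSurj D.p (F.map f)) :
    IsPositiveFunctor F where
  map_cart := hF.map_cart
  isRegularFunctor I := ⟨hF.preservesFiniteLimits I, fun A B f hf =>
    regularEpi_of_isEff _ (H f.1 (isSurj_of_regularEpi f)).isEff⟩
  map_cocart A B s hs := by
    have := hasPullbacks_total C.p
    have := hasPullbacks_total D.p
    refine (H s hs.isSurj).isEff.isCocart fun T a b hab => ?_
    -- elements identified by `F s` lift, locally, to the image of the diagonal of `s`, which `F`
    -- keeps surjective onto the kernel pair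
    have hd : IsCocart C.p (pullback.lift (f := s) (g := s) (𝟙 A) (𝟙 A) rfl) :=
      (IsFiberedPretopos.hasExtensiveSums (p := C.p)).disjoint _ (.of_hasPullback s s) hs
        (pullback.lift_fst ..) (pullback.lift_snd ..)
    have hP := hF.map_isPullback (IsPullback.of_hasPullback s s)
    obtain ⟨T', t, c, ht, hc⟩ := (H _ hd.isSurj).exists_lift (hP.lift a b hab)
    refine ⟨T', t, ht, ?_⟩
    have h₁ := congrArg (· ≫ F.map (pullback.fst s s)) hc
    have h₂ := congrArg (· ≫ F.map (pullback.snd s s)) hc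
    simp only [Category.assoc, hP.lift_fst, hP.lift_snd, ← F.map_comp, pullback.lift_fst,
      pullback.lift_snd, F.map_id, Category.comp_id] at h₁ h₂
    rw [← h₁, h₂]

end Positive

/-! ### Quotients of local equivalence relations -/

section Quotients

variable {R : Type u₁} [Category.{v₁} R] {E : Type u₂} [Category.{v₂} E] (p : E ⥤ R)

/-- The generalized elements `a, b` of `C` are locally related by the span `d₀, d₁ : D ⟶ C`, i.e.
after precomposition with a surjection they lift to `D`. -/
def LocRel {D C : E} (d₀ d₁ : D ⟶ C) {T : E} (a b : T ⟶ C) : Prop :=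
  ∃ (T' : E) (t : T' ⟶ T) (k : T' ⟶ D), IsSurj p t ∧ k ≫ d₀ = t ≫ a ∧ k ≫ d₁ = t ≫ b

variable {p}

/-- The image of a parallel pair of vertical maps, i.e. of a map into a product. -/
lemma exists_image [IsFiberedPretopos p] {I : R} {B' B : p.Fiber I} (b₀ b₁ : B' ⟶ B) :
    ∃ (M : p.Fiber I) (r : B' ⟶ M) (r₀ r₁ : M ⟶ B), IsRegularEpi r ∧ r ≫ r₀ = b₀ ∧ r ≫ r₁ = b₁ ∧
      ∀ ⦃T : E⦄ (z z' : T ⟶ M.1), z ≫ r₀.1 = z' ≫ r₀.1 → z ≫ r₁.1 = z' ≫ r₁.1 → z = z' := by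
  have hP := IsPullback.of_hasPullback (terminal.from B) (terminal.from B)
  have hP' := isPullback_of_fiber p hP
  let F := Regular.strongEpiMonoFactorisation (hP.lift b₀ b₁ (terminal.hom_ext _ _))
  have hm : Mono F.m := F.m_mono
  have hm' := isPullback_of_fiber p (IsKernelPair.id_of_mono F.m)
  refine ⟨F.I, F.e, F.m ≫ pullback.fst _ _, F.m ≫ pullback.snd _ _,
    inferInstanceAs (IsRegularEpi (Regular.strongEpiMonoFactorisation _).e), ?_, ?_, ?_⟩
  · rw [← Category.assoc]
    exact (congrArg (· ≫ _) F.fac).trans (hP.lift_fst ..)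
  · rw [← Category.assoc]
    exact (congrArg (· ≫ _) F.fac).trans (hP.lift_snd ..)
  · intro T z z' h₀ h₁
    have e : z ≫ F.m.1 = z' ≫ F.m.1 := by
      apply hP'.hom_ext
      · exact (Category.assoc _ _ _).trans (h₀.trans (Category.assoc _ _ _).symm)
      · exact (Category.assoc _ _ _).trans (h₁.trans (Category.assoc _ _ _).symm)
    rw [← hm'.lift_fst z z' e]
    exact hm'.lift_snd z z' e

/-- Equivalence relations in the fibers have quotients. -/
lemma exists_vertical_quotient [IsFiberedPretopos p] {I : R} {M B : p.Fiber I} (r₀ r₁ : M ⟶ B)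
    (h : IsEquivalenceRelation r₀ r₁) : ∃ (Q : p.Fiber I) (q : B ⟶ Q), IsRegularEpi q ∧
      IsKernelPair q.1 r₀.1 r₁.1 := by
  obtain ⟨Q, q, hq⟩ := (IsFiberedPretopos.isExact (p := p) I).effective r₀ r₁ h
  let F := Regular.strongEpiMonoFactorisation q
  have hm : Mono F.m := F.m_mono
  have hq' : IsKernelPair (F.e ≫ F.m) r₀ r₁ := by
    rw [F.fac]
    exact hq
  exact ⟨F.I, F.e, inferInstanceAs (IsRegularEpi (Regular.strongEpiMonoFactorisation _).e),
    isPullback_of_fiber p hq'.cancel_right_of_mono⟩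

lemma isEquivalenceRelation_fiber [IsFiberedPretopos p] {I : R} {M B : p.Fiber I} (r₀ r₁ : M ⟶ B)
    (hmono : ∀ ⦃T : E⦄ (z z' : T ⟶ M.1), z ≫ r₀.1 = z' ≫ r₀.1 → z ≫ r₁.1 = z' ≫ r₁.1 → z = z')
    (hrefl : ∃ z : B.1 ⟶ M.1, z ≫ r₀.1 = 𝟙 _ ∧ z ≫ r₁.1 = 𝟙 _)
    (hsymm : ∃ z : M.1 ⟶ M.1, z ≫ r₀.1 = r₁.1 ∧ z ≫ r₁.1 = r₀.1)
    (htrans : ∀ ⦃N : E⦄ (a b : N ⟶ M.1), p.map a = p.map b →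
      a ≫ r₁.1 = b ≫ r₀.1 → ∃ z : N ⟶ M.1, z ≫ r₀.1 = a ≫ r₀.1 ∧ z ≫ r₁.1 = b ≫ r₁.1) :
    IsEquivalenceRelation r₀ r₁ := by
  have hv : ∀ {N : p.Fiber I} (z : N.1 ⟶ M.1) (x : N ⟶ B), z ≫ r₀.1 = x.1 →
      p.IsHomLift (𝟙 I) z := fun z x h =>
    isHomLift_of_comp_vertical p _ z r₀.1 r₀.2 (by rw [h]; exact x.2)
  obtain ⟨z₁, h₁, h₁'⟩ := hrefl
  obtain ⟨z₂, h₂, h₂'⟩ := hsymm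
  have hN := IsPullback.of_hasPullback r₁ r₀
  have hN' := isPullback_of_fiber p hN
  obtain ⟨z₃, h₃, h₃'⟩ := htrans (pullback.fst r₁ r₀).1 (pullback.snd r₁ r₀).1
    (map_eq_of_isHomLift p (𝟙 I) (pullback.fst r₁ r₀).2 (pullback.snd r₁ r₀).2) hN'.w
  exact ⟨⟨{
    right_cancellation := fun N f g e₀ e₁ => Subtype.ext
      (hmono _ _ (congrArg Subtype.val e₀) (congrArg Subtype.val e₁))
    r := ⟨z₁, hv z₁ (𝟙 B) h₁⟩
    reflexivity₁ := Subtype.ext h₁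
    reflexivity₂ := Subtype.ext h₁'
    s := ⟨z₂, hv z₂ r₁ h₂⟩
    symmetry₁ := Subtype.ext h₂
    symmetry₂ := Subtype.ext h₂'
    c := _
    isLimit := hN.isLimit
    t := ⟨z₃, hv z₃ (pullback.fst r₁ r₀ ≫ r₀) h₃⟩
    transitivity₁ := Subtype.ext h₃
    transitivity₂ := Subtype.ext h₃' }⟩⟩

/-- For `s : C ⟶ B` and a span `D` from `C` to itself whose two composites with `s` agree in the
base, the image `M` of the internal sum of `D` in `B × B`. If `M` is an equivalence relation, then
it has a quotient. -/
lemma exists_image_of_cocart [Regular R] [IsFiberedPretopos p] {D C B : E} (d₀ d₁ : D ⟶ C)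
    {s : C ⟶ B} (h : p.map (d₀ ≫ s) = p.map (d₁ ≫ s)) :
    ∃ (M : E) (m₀ m₁ : M ⟶ B) (g : D ⟶ M), IsSurj p g ∧ g ≫ m₀ = d₀ ≫ s ∧ g ≫ m₁ = d₁ ≫ s ∧
      p.IsHomLift (𝟙 (p.obj B)) m₀ ∧ p.IsHomLift (𝟙 (p.obj B)) m₁ ∧
      (∀ ⦃T : E⦄ (z z' : T ⟶ M), z ≫ m₀ = z' ≫ m₀ → z ≫ m₁ = z' ≫ m₁ → z = z') ∧
      ((∃ z : B ⟶ M, z ≫ m₀ = 𝟙 _ ∧ z ≫ m₁ = 𝟙 _) → (∃ z : M ⟶ M, z ≫ m₀ = m₁ ∧ z ≫ m₁ = m₀) →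
        (∀ ⦃N : E⦄ (a b : N ⟶ M), p.map a = p.map b → a ≫ m₁ = b ≫ m₀ →
          ∃ z : N ⟶ M, z ≫ m₀ = a ≫ m₀ ∧ z ≫ m₁ = b ≫ m₁) →
        ∃ (Q : E) (q : B ⟶ Q), IsSurj p q ∧ p.IsHomLift (𝟙 (p.obj B)) q ∧
          IsKernelPair q m₀ m₁) := by
  have := hasPullbacks_total p
  obtain ⟨B', t, ht⟩ := (IsFiberedPretopos.hasExtensiveSums (p := p)).exists_cocart D
    (p.map (d₀ ≫ s))
  have ht' : IsCocart p t := IsCocart.of_isStronglyCocartesian p _ t ht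
  let B₁ : p.Fiber (p.obj B) := ⟨B, rfl⟩
  let B₂ : p.Fiber (p.obj B) := ⟨B', IsHomLift.codomain_eq p (p.map (d₀ ≫ s)) t⟩
  obtain ⟨b₀, hb₀, htb₀⟩ := exists_cocart_factor ht (𝟙 (p.obj B)) (d₀ ≫ s)
    (by rw [Category.comp_id]; infer_instance)
  obtain ⟨b₁, hb₁, htb₁⟩ := exists_cocart_factor ht (𝟙 (p.obj B)) (d₁ ≫ s)
    (by rw [Category.comp_id, h]; infer_instance)
  obtain ⟨M, r, r₀, r₁, hr, hrr₀, hrr₁, hmono⟩ :=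
    exists_image (B' := B₂) (B := B₁) ⟨b₀, hb₀⟩ ⟨b₁, hb₁⟩
  refine ⟨M.1, r₀.1, r₁.1, t ≫ r.1, ht'.isSurj.comp (isSurj_of_regularEpi r), ?_, ?_, r₀.2, r₁.2,
    hmono, fun h₁ h₂ h₃ => ?_⟩
  · rw [← htb₀, Category.assoc]
    exact congrArg (t ≫ ·) (congrArg Subtype.val hrr₀)
  · rw [← htb₁, Category.assoc]
    exact congrArg (t ≫ ·) (congrArg Subtype.val hrr₁)
  · obtain ⟨Q, q, hq, hk⟩ :=
      exists_vertical_quotient r₀ r₁ (isEquivalenceRelation_fiber r₀ r₁ hmono h₁ h₂ h₃)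
    exact ⟨Q.1, q.1, isSurj_of_regularEpi q, q.2, hk⟩

/-- A span from `C` to `C` which is locally an equivalence relation, over an object `I` of the base,
has a quotient in a fibered pretopos: a surjection over `C ⟶ I` whose kernel pair is covered by the
span. It is the quotient of the internal sum of `C` along the map to `I` by the image of the
internal sum of the span. -/
theorem exists_quotient [Regular R] [IsFiberedPretopos p] {D C : E} {I : R} (d₀ d₁ : D ⟶ C)
    (u : p.obj C ⟶ I) (hu : p.map d₀ ≫ u = p.map d₁ ≫ u)
    (hrefl : ∀ ⦃T : E⦄ (a : T ⟶ C), LocRel p d₀ d₁ a a)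
    (hsymm : ∀ ⦃T : E⦄ (a b : T ⟶ C), LocRel p d₀ d₁ a b → LocRel p d₀ d₁ b a)
    (htrans : ∀ ⦃T : E⦄ (a b c : T ⟶ C), LocRel p d₀ d₁ a b → LocRel p d₀ d₁ b c →
      LocRel p d₀ d₁ a c) :
    ∃ (Q : E) (q : C ⟶ Q), p.IsHomLift u q ∧ IsSurj p q ∧ d₀ ≫ q = d₁ ≫ q ∧
      ∀ ⦃T : E⦄ (a b : T ⟶ C), a ≫ q = b ≫ q → LocRel p d₀ d₁ a b := by
  have := hasPullbacks_total p
  obtain ⟨B, s, hs⟩ := (IsFiberedPretopos.hasExtensiveSums (p := p)).exists_cocart C u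
  have hs' : IsCocart p s := IsCocart.of_isStronglyCocartesian p u s hs
  obtain rfl : p.obj B = I := IsHomLift.codomain_eq p u s
  obtain rfl : u = p.map s := IsHomLift.eq_of_isHomLift p u s
  obtain ⟨M, m₀, m₁, g, hg, hg₀, hg₁, hl₀, hl₁, hmono, hquot⟩ := exists_image_of_cocart (p := p)
    d₀ d₁ (s := s) (by rw [p.map_comp, p.map_comp, hu])
  -- a vertical pair of elements of `B` belongs to `M` if it is, locally, the image of an element of
  -- `D`: as `M` is jointly monic, the local factorizations descend
  have key : ∀ {T : E} (x y : T ⟶ B), p.map x = p.map y →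
      (∃ (T' : E) (t' : T' ⟶ T) (k : T' ⟶ D), IsSurj p t' ∧ k ≫ d₀ ≫ s = t' ≫ x ∧
        k ≫ d₁ ≫ s = t' ≫ y) → ∃ z : T ⟶ M, z ≫ m₀ = x ∧ z ≫ m₁ = y := by
    rintro T x y hxy ⟨T', t', k, ht', h₀, h₁⟩
    have e₀ : (k ≫ g) ≫ m₀ = t' ≫ x := by rw [Category.assoc, hg₀, h₀]
    have e₁ : (k ≫ g) ≫ m₁ = t' ≫ y := by rw [Category.assoc, hg₁, h₁]
    obtain ⟨z, hz, hz'⟩ := ht'.isEff.desc (k ≫ g) (p.map t') (p.map x) inferInstance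
      (isHomLift_of_comp_vertical p _ _ m₀ hl₀ (by rw [e₀]; infer_instance)) (by
        intro T a b hab
        apply hmono
        · rw [Category.assoc, Category.assoc b, e₀, reassoc_of% hab]
        · rw [Category.assoc, Category.assoc b, e₁, reassoc_of% hab])
    have hz₁ : p.IsHomLift (p.map x) y := by rw [hxy]; infer_instance
    exact ⟨z, ht'.ext (map_eq_of_isHomLift p (p.map x) inferInstance inferInstance)
        (by rw [reassoc_of% hz', ← Category.assoc, e₀]),
      ht'.ext (map_eq_of_isHomLift p (p.map x) inferInstance hz₁)
        (by rw [reassoc_of% hz', ← Category.assoc, e₁])⟩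
  have hm : p.map m₀ = p.map m₁ := map_eq_of_isHomLift p (𝟙 _) hl₀ hl₁
  obtain ⟨Q, q, hq, hlq, hk⟩ := hquot
    (by
      obtain ⟨T, t, k, ht, h₀, h₁⟩ := hrefl (𝟙 C)
      rw [Category.comp_id] at h₀ h₁
      exact key _ _ rfl ⟨T, t ≫ s, k, ht.comp hs'.isSurj, by rw [reassoc_of% h₀, Category.comp_id],
        by rw [reassoc_of% h₁, Category.comp_id]⟩)
    (by
      obtain ⟨T, t, k, ht, h₀, h₁⟩ := hsymm d₀ d₁
        ⟨D, 𝟙 D, 𝟙 D, .of_isIso _, by simp, by simp⟩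
      exact key _ _ hm.symm ⟨T, t ≫ g, k, ht.comp hg,
        by rw [reassoc_of% h₀, Category.assoc, hg₁], by rw [reassoc_of% h₁, Category.assoc, hg₀]⟩)
    (by
      intro N a b hab hN
      -- locally, `a` and `b` come from elements `k₁, k₂` of `D`, and the inner ends of `k₁` and
      -- `k₂` agree after a further refinement because sums are disjoint
      obtain ⟨T₁, t₁, k₁, ht₁, h₁⟩ := hg.exists_lift a
      obtain ⟨T₂, t₂, k₂, ht₂, h₂⟩ := hg.exists_lift (t₁ ≫ b)
      have e : (t₂ ≫ k₁ ≫ d₁) ≫ s = (k₂ ≫ d₀) ≫ s := by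
        simp only [Category.assoc]
        rw [← hg₁, ← hg₀, reassoc_of% h₁, reassoc_of% h₂, hN]
      obtain ⟨T₃, t₃, ht₃, h₃⟩ := hs'.locally_eq _ _ e
      obtain ⟨T₄, t₄, k, ht₄, h₄, h₅⟩ := htrans (t₃ ≫ t₂ ≫ k₁ ≫ d₀) (t₃ ≫ k₂ ≫ d₀) (t₃ ≫ k₂ ≫ d₁)
        ⟨T₃, 𝟙 _, t₃ ≫ t₂ ≫ k₁, .of_isIso _, by simp, by simpa using h₃⟩
        ⟨T₃, 𝟙 _, t₃ ≫ k₂, .of_isIso _, by simp, by simp⟩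
      refine key _ _ (by rw [p.map_comp, p.map_comp, hab, hm])
        ⟨T₄, t₄ ≫ t₃ ≫ t₂ ≫ t₁, k, ht₄.comp (ht₃.comp (ht₂.comp ht₁)), ?_, ?_⟩
      · rw [reassoc_of% h₄, ← hg₀, reassoc_of% h₁]
        simp only [Category.assoc]
      · rw [reassoc_of% h₅, ← hg₁, reassoc_of% h₂]
        simp only [Category.assoc])
  refine ⟨Q, s ≫ q, ?_, hs'.isSurj.comp hq, ?_, ?_⟩
  · infer_instance
  · rw [← Category.assoc, ← Category.assoc, ← hg₀, ← hg₁, Category.assoc, Category.assoc, hk.w]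
  · intro T a b hab
    -- the pair `(a, b)` belongs to the kernel pair `M` of the quotient, hence is locally the image
    -- of an element `k` of `D`; disjointness of sums moves this back from `B` to `C`
    obtain ⟨T₁, t₁, k, ht₁, h₁⟩ := hg.exists_lift (hk.lift (a ≫ s) (b ≫ s) (by simpa using hab))
    have h₀ : (k ≫ d₀) ≫ s = (t₁ ≫ a) ≫ s := by
      rw [Category.assoc, Category.assoc, ← hg₀, reassoc_of% h₁, hk.lift_fst]
    have h₁ : (k ≫ d₁) ≫ s = (t₁ ≫ b) ≫ s := by
      rw [Category.assoc, Category.assoc, ← hg₁, reassoc_of% h₁, hk.lift_snd]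
    obtain ⟨T₂, t₂, ht₂, h₂⟩ := hs'.locally_eq _ _ h₀
    obtain ⟨T₃, t₃, ht₃, h₃⟩ := hs'.locally_eq (t₂ ≫ k ≫ d₁) (t₂ ≫ t₁ ≫ b) (by
      simpa only [Category.assoc] using congrArg (t₂ ≫ ·) h₁)
    refine ⟨T₃, t₃ ≫ t₂ ≫ t₁, t₃ ≫ t₂ ≫ k, ht₃.comp (ht₂.comp ht₁), ?_, ?_⟩
    · simp only [Category.assoc]
      rw [h₂]
    · simp only [Category.assoc]
      rw [h₃]

end Quotients

/-! ### Extension along a dense embedding: transformations -/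

section Dense

variable {R : Type u₁} [Category.{v₁} R]

lemma isHomLift_congr {E : Type u₂} [Category.{v₂} E] {p : E ⥤ R} {E' : Type u₃}
    [Category.{v₃} E'] {q : E' ⥤ R} {A B : E} {z : A ⟶ B} {A' B' : E'} {f : A' ⟶ B'}
    {J I J' I' : R} {u : J ⟶ I} {u' : J' ⟶ I'} (h : p.IsHomLift u z) (h' : p.IsHomLift u' z)
    (hf : q.IsHomLift u f) : q.IsHomLift u' f := by
  obtain ⟨⟩ := h
  obtain ⟨⟩ := h'
  exact hf

lemma map_comp_eq_of_isHomLift {E : Type u₂} [Category.{v₂} E] (p : E ⥤ R) {T A B B' : E}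
    {a b : T ⟶ A} {f : A ⟶ B} {g : A ⟶ B'} {K J I : R} (u : J ⟶ I) (v : I ⟶ K)
    (hf : p.IsHomLift u f) (hg : p.IsHomLift (u ≫ v) g) (h : a ≫ f = b ≫ f) :
    p.map (a ≫ g) = p.map (b ≫ g) := by
  have h' := congrArg p.map h
  rw [p.map_comp, p.map_comp, IsHomLift.fac' p u f] at h'
  rw [p.map_comp, p.map_comp, IsHomLift.fac' p (u ≫ v) g]
  simp only [← Category.assoc] at h' ⊢
  rw [(cancel_mono _).1 h']

variable {C : BasedCategory.{v₂, u₂} R} {D : BasedCategory.{v₃, u₃} R}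
variable {X : BasedCategory.{v₄, u₄} R}

/-- Full and faithful finite limit preserving fibered functors `Y : C ⟶ D` such that each object of
`D` is covered by one in the image of `Y`, and such that the surjections onto objects in the image
of `Y` are dominated by covers. These properties of the fibered Yoneda embedding suffice to derive
its universal property. -/
structure IsDense (Y : BasedFunctor C D) : Prop where
  isLexFunctor : IsLexFunctor Y
  full : Y.toFunctor.Full
  faithful : Y.toFunctor.Faithful
  exists_isSurj : ∀ Z : D.obj, ∃ (A : C.obj) (y : Y.obj A ⟶ Z), IsSurj D.p y
  exists_isCover : ∀ ⦃W : D.obj⦄ ⦃A : C.obj⦄ (w : W ⟶ Y.obj A), IsSurj D.p w →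
    ∃ (A' : C.obj) (e : A' ⟶ A) (k : Y.obj A' ⟶ W), IsCover C.p e ∧ k ≫ w = Y.map e

variable {Y : BasedFunctor C D}

lemma IsDense.exists_map (hY : IsDense Y) {A B : C.obj} (f : Y.obj A ⟶ Y.obj B) :
    ∃ g : A ⟶ B, Y.map g = f :=
  hY.full.map_surjective f

/-- Maps from the image of a dense embedding `Y` are locally liftable along surjections. -/
lemma IsDense.exists_lift [HasPullbacks D.obj] (hY : IsDense Y) {Z : D.obj} {A B : C.obj}
    {y : Y.obj A ⟶ Z} (hy : IsSurj D.p y) (z : Y.obj B ⟶ Z) :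
    ∃ (B' : C.obj) (e : B' ⟶ B) (k : B' ⟶ A), IsCover C.p e ∧ Y.map k ≫ y = Y.map e ≫ z := by
  obtain ⟨W, w, a, hw, ha⟩ := hy.exists_lift z
  obtain ⟨B', e, k, he, hk⟩ := hY.exists_isCover w hw
  obtain ⟨κ, hκ⟩ := hY.exists_map (k ≫ a)
  exact ⟨B', e, κ, he, by rw [hκ, Category.assoc, ha, reassoc_of% hk]⟩

/-- The kernel pair of a map out of the image of a dense embedding is covered by a span in the
domain of the embedding. -/
lemma IsDense.exists_span [HasPullbacks D.obj] (hY : IsDense Y) {Z : D.obj} {A : C.obj}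
    (y : Y.obj A ⟶ Z) : ∃ (K : C.obj) (δ₀ δ₁ : K ⟶ A) (r : Y.obj K ⟶ pullback y y),
      IsSurj D.p r ∧ r ≫ pullback.fst y y = Y.map δ₀ ∧ r ≫ pullback.snd y y = Y.map δ₁ := by
  obtain ⟨K, r, hr⟩ := hY.exists_isSurj (pullback y y)
  obtain ⟨δ₀, h₀⟩ := hY.exists_map (r ≫ pullback.fst y y)
  obtain ⟨δ₁, h₁⟩ := hY.exists_map (r ≫ pullback.snd y y)
  exact ⟨K, δ₀, δ₁, r, hr, h₀.symm, h₁.symm⟩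

variable [Regular R] [IsFiberedPretopos D.p] [IsFiberedPretopos X.p]

/-- The component at `Z` of the extension of a transformation along a dense embedding. -/
lemma IsDense.exists_app [IsLexPreStack C.p] (hY : IsDense Y) {G G' : BasedFunctor D X}
    (hG : IsPositiveFunctor G)
    (β : ∀ A, G.obj (Y.obj A) ⟶ G'.obj (Y.obj A))
    (hβ : ∀ A, X.p.IsHomLift (𝟙 (D.p.obj (Y.obj A))) (β A))
    (hnat : ∀ ⦃K B : C.obj⦄ (κ : K ⟶ B), G.map (Y.map κ) ≫ β B = β K ≫ G'.map (Y.map κ))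
    (Z : D.obj) :
    ∃ h : G.obj Z ⟶ G'.obj Z, X.p.IsHomLift (𝟙 (D.p.obj Z)) h ∧
      ∀ ⦃A : C.obj⦄ (y : Y.obj A ⟶ Z), G.map y ≫ h = β A ≫ G'.map y := by
  have := hasPullbacks_total D.p
  have := hasPullbacks_total X.p
  -- for a surjection `y : Y A ⟶ Z`, the map `β A ≫ G' y` descends along `G y`: the kernel pair of
  -- `y` is covered by some `Y K`, and `β` is natural for the two maps `K ⟶ A`
  obtain ⟨A, y, hy⟩ := hY.exists_isSurj Z
  have hg : X.p.IsHomLift (𝟙 (D.p.obj (Y.obj A)) ≫ D.p.map y) (β A ≫ G'.map y) :=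
    inferInstance
  rw [Category.id_comp] at hg
  obtain ⟨h, hh, hh'⟩ := (hG.map_isSurj hy).isEff.desc (β A ≫ G'.map y)
    (D.p.map y) (𝟙 _) inferInstance (by rwa [Category.comp_id]) (by
      intro T a b hab
      obtain ⟨K, δ₀, δ₁, r, hr, h₀, h₁⟩ := hY.exists_span y
      let c : T ⟶ G.obj (pullback y y) :=
        (hG.isLexFunctor.map_isPullback (IsPullback.of_hasPullback y y)).lift a b hab
      have hc₀ : c ≫ G.map (pullback.fst y y) = a := IsPullback.lift_fst ..
      have hc₁ : c ≫ G.map (pullback.snd y y) = b := IsPullback.lift_snd ..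
      obtain ⟨T', t, k, ht, hk⟩ := (hG.map_isSurj hr).exists_lift c
      have hk₀ : t ≫ a = k ≫ G.map (Y.map δ₀) := by
        rw [← h₀, G.map_comp, reassoc_of% hk, hc₀]
      have hk₁ : t ≫ b = k ≫ G.map (Y.map δ₁) := by
        rw [← h₁, G.map_comp, reassoc_of% hk, hc₁]
      refine ht.ext (map_comp_eq_of_isHomLift X.p (D.p.map y) (𝟙 _) (f := G.map y) inferInstance
        (by rwa [Category.comp_id]) hab) ?_
      have e : Y.map δ₀ ≫ y = Y.map δ₁ ≫ y := by
        rw [← h₀, ← h₁, Category.assoc, Category.assoc, pullback.condition]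
      rw [reassoc_of% hk₀, reassoc_of% hk₁, reassoc_of% (hnat δ₀), reassoc_of% (hnat δ₁),
        ← G'.map_comp, ← G'.map_comp, e])
  refine ⟨h, hh, fun B z => ?_⟩
  -- an arbitrary `z : Y B ⟶ Z` factors through `y` on a cover of `B`
  obtain ⟨B', e, k, he, hk⟩ := hY.exists_lift hy z
  have hsurj : IsSurj X.p (G.map (Y.map e)) :=
    ((hY.isLexFunctor.comp hG.isLexFunctor).map_isCover he).isSurj
  have h₁ : X.p.IsHomLift (D.p.map z ≫ 𝟙 _) (G.map z ≫ h) := inferInstance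
  have h₂ : X.p.IsHomLift (𝟙 (D.p.obj (Y.obj B)) ≫ D.p.map z) (β B ≫ G'.map z) :=
    inferInstance
  rw [Category.comp_id] at h₁
  rw [Category.id_comp] at h₂
  refine hsurj.ext (map_eq_of_isHomLift X.p (D.p.map z) h₁ h₂) ?_
  rw [← Category.assoc, ← G.map_comp, ← hk, G.map_comp, Category.assoc, hh', reassoc_of% (hnat k),
    reassoc_of% (hnat e), ← G'.map_comp, ← G'.map_comp, hk]

lemma IsDense.precomp_faithful (hY : IsDense Y) : (precomp Y hY.isLexFunctor X).Faithful where
  map_injective {G G'} α β h := by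
    apply fun_hom_ext
    intro Z
    obtain ⟨A, y, hy⟩ := hY.exists_isSurj Z
    have hα := α.hom.toNatTrans.naturality y
    have hβ := β.hom.toNatTrans.naturality y
    have e : α.hom.toNatTrans.app (Y.obj A) = β.hom.toNatTrans.app (Y.obj A) :=
      congrArg (fun γ => γ.hom.toNatTrans.app A) h
    refine (G.property.map_isSurj hy).ext (map_eq_of_isHomLift X.p (𝟙 (D.p.obj Z)) inferInstance
      inferInstance) ?_
    exact hα.trans ((congrArg (· ≫ G'.obj.map y) e).trans hβ.symm)

lemma IsDense.precomp_full [IsLexPreStack C.p] (hY : IsDense Y) :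
    (precomp Y hY.isLexFunctor X).Full where
  map_surjective {G G'} β := by
    have hβ (A : C.obj) := β.hom.isHomLift (Y.w_obj A).symm
    have hnat {K B : C.obj} (κ : K ⟶ B) := β.hom.toNatTrans.naturality κ
    choose h hh hh' using hY.exists_app (G := G.obj) (G' := G'.obj) G.property
      (fun A => β.hom.toNatTrans.app A) hβ (fun _ _ κ => hnat κ)
    refine ⟨ObjectProperty.homMk ⟨⟨h, ?_⟩, hh⟩, ?_⟩
    · intro Z Z' f
      obtain ⟨A, y, hy⟩ := hY.exists_isSurj Z
      have := hh Z
      have := hh Z'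
      have h₁ : X.p.IsHomLift (D.p.map f ≫ 𝟙 (D.p.obj Z')) (G.obj.map f ≫ h Z') := inferInstance
      have h₂ : X.p.IsHomLift (𝟙 (D.p.obj Z) ≫ D.p.map f) (h Z ≫ G'.obj.map f) := inferInstance
      rw [Category.comp_id] at h₁
      rw [Category.id_comp] at h₂
      refine (G.property.map_isSurj hy).ext (map_eq_of_isHomLift X.p _ h₁ h₂) ?_
      have e₁ := hh' Z' (y ≫ f)
      have e₂ := hh' Z y
      rw [G.obj.map_comp, G'.obj.map_comp, Category.assoc] at e₁
      exact e₁.trans ((Category.assoc _ _ _).symm.trans ((congrArg (· ≫ G'.obj.map f) e₂).symm.trans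
        (Category.assoc _ _ _)))
    · apply fun_hom_ext
      intro A
      have e := hh' (Y.obj A) (𝟙 _)
      exact (Category.id_comp _).symm.trans ((congrArg (· ≫ h (Y.obj A))
        (G.obj.map_id _).symm).trans (e.trans ((congrArg (β.hom.toNatTrans.app A ≫ ·)
        (G'.obj.map_id _)).trans (Category.comp_id _))))

end Dense

/-! ### Extension along a dense embedding: functors -/

section Extension

variable {R : Type u₁} [Category.{v₁} R]
variable {C : BasedCategory.{v₂, u₂} R} {D : BasedCategory.{v₃, u₃} R}
variable {X : BasedCategory.{v₄, u₄} R}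

section LocRel

variable {E : Type u₂} [Category.{v₂} E] {p : E ⥤ R} [HasPullbacks E]

lemma LocRel.of_isSurj {D C : E} {d₀ d₁ : D ⟶ C} {T T' : E} {a b : T ⟶ C} {t : T' ⟶ T}
    (ht : IsSurj p t) (h : LocRel p d₀ d₁ (t ≫ a) (t ≫ b)) : LocRel p d₀ d₁ a b := by
  obtain ⟨T₁, t₁, k, ht₁, h₀, h₁⟩ := h
  exact ⟨T₁, t₁ ≫ t, k, ht₁.comp ht, by rw [h₀, Category.assoc], by rw [h₁, Category.assoc]⟩

/-- Two local lifts along surjections onto the same object can be chosen over the same refinement.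
-/
lemma exists_common_refinement {T T₁ T₂ : E} {t₁ : T₁ ⟶ T} {t₂ : T₂ ⟶ T} (h₁ : IsSurj p t₁)
    (h₂ : IsSurj p t₂) : ∃ (S : E) (s₁ : S ⟶ T₁) (s₂ : S ⟶ T₂), IsSurj p (s₁ ≫ t₁) ∧
      IsSurj p s₁ ∧ s₁ ≫ t₁ = s₂ ≫ t₂ :=
  have := h₂.of_isPullback (IsPullback.of_hasPullback t₁ t₂).flip
  ⟨pullback t₁ t₂, pullback.fst _ _, pullback.snd _ _, this.comp h₁, this, pullback.condition⟩

end LocRel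

lemma isHomLift_map_map (Y : BasedFunctor C D) (F : BasedFunctor C X) {A B : C.obj} (κ : A ⟶ B) :
    X.p.IsHomLift (D.p.map (Y.map κ)) (F.map κ) :=
  isHomLift_congr (p := D.p) (u := C.p.map κ) (z := Y.map κ) inferInstance inferInstance inferInstance

variable [Regular R]

/-- The kernel pair of `y : Y A ⟶ Z`, covered by a span `δ₀, δ₁ : K ⟶ A` in the domain of the
dense embedding `Y`. -/
structure IsKernelSpan (Y : BasedFunctor C D) {A : C.obj} {Z : D.obj} (y : Y.obj A ⟶ Z) {K : C.obj}
    (δ₀ δ₁ : K ⟶ A) : Prop where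
  w : Y.map δ₀ ≫ y = Y.map δ₁ ≫ y
  exists_lift : ∀ ⦃T : C.obj⦄ (κ₀ κ₁ : T ⟶ A), Y.map κ₀ ≫ y = Y.map κ₁ ≫ y →
    ∃ (T' : C.obj) (e : T' ⟶ T) (k : T' ⟶ K), IsCover C.p e ∧ k ≫ δ₀ = e ≫ κ₀ ∧ k ≫ δ₁ = e ≫ κ₁

lemma IsDense.exists_isKernelSpan [IsFiberedPretopos D.p] {Y : BasedFunctor C D} (hY : IsDense Y)
    {A : C.obj} {Z : D.obj} (y : Y.obj A ⟶ Z) :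
    ∃ (K : C.obj) (δ₀ δ₁ : K ⟶ A), IsKernelSpan Y y δ₀ δ₁ := by
  have := hasPullbacks_total D.p
  have := hY.faithful
  obtain ⟨K, δ₀, δ₁, r, hr, h₀, h₁⟩ := hY.exists_span y
  refine ⟨K, δ₀, δ₁, ?_, fun T κ₀ κ₁ h => ?_⟩
  · rw [← h₀, ← h₁, Category.assoc, Category.assoc, pullback.condition]
  · obtain ⟨T', e, k, he, hk⟩ := hY.exists_lift hr (pullback.lift _ _ h)
    refine ⟨T', e, k, he, Y.toFunctor.map_injective ?_, Y.toFunctor.map_injective ?_⟩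
    · rw [Y.map_comp, ← h₀, reassoc_of% hk, pullback.lift_fst, Y.map_comp]
    · rw [Y.map_comp, ← h₁, reassoc_of% hk, pullback.lift_snd, Y.map_comp]

/-- Maps into `A` with the same composite with `y` are, after applying `F`, locally related by the
image of a span covering the kernel pair of `y`. -/
lemma IsKernelSpan.locRel [IsLexFibration C.p] [IsFiberedPretopos X.p] {Y : BasedFunctor C D}
    {F : BasedFunctor C X}
    (hF : IsLexFunctor F) {A : C.obj} {Z : D.obj} {y : Y.obj A ⟶ Z} {K : C.obj}
    {δ₀ δ₁ : K ⟶ A} (h : IsKernelSpan Y y δ₀ δ₁) {T : C.obj} (κ₀ κ₁ : T ⟶ A)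
    (w : Y.map κ₀ ≫ y = Y.map κ₁ ≫ y) {S : X.obj} (k : S ⟶ F.obj T) :
    LocRel X.p (F.map δ₀) (F.map δ₁) (k ≫ F.map κ₀) (k ≫ F.map κ₁) := by
  have := hasPullbacks_total X.p
  obtain ⟨T', e, l, he, h₀, h₁⟩ := h.exists_lift κ₀ κ₁ w
  obtain ⟨S', s, a, hs, ha⟩ := (hF.map_isCover he).isSurj.exists_lift k
  refine ⟨S', s, a ≫ F.map l, hs, ?_, ?_⟩
  · rw [Category.assoc, ← F.map_comp, h₀, F.map_comp, reassoc_of% ha]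
  · rw [Category.assoc, ← F.map_comp, h₁, F.map_comp, reassoc_of% ha]

/-- The value at `Z` of the extension of `F : C ⟶ X` along a dense embedding `Y : C ⟶ D`: an object
`pt` of `X` whose generalized elements are, locally, those of `F A` for `A` with a given map
`Y A ⟶ Z`, two of them being equal iff they are, locally, given by the same map into `Z`. -/
structure Realization (Y : BasedFunctor C D) (F : BasedFunctor C X) (Z : D.obj) where
  pt : X.obj
  proj : ∀ {A : C.obj}, (Y.obj A ⟶ Z) → (F.obj A ⟶ pt)
  isHomLift : ∀ {A : C.obj} (z : Y.obj A ⟶ Z), X.p.IsHomLift (D.p.map z) (proj z)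
  naturality : ∀ {A B : C.obj} (κ : A ⟶ B) (z : Y.obj B ⟶ Z),
    proj (Y.map κ ≫ z) = F.map κ ≫ proj z
  isSurj : ∀ {A : C.obj} (z : Y.obj A ⟶ Z), IsSurj D.p z → IsSurj X.p (proj z)
  exists_of_eq : ∀ {A B : C.obj} (z : Y.obj A ⟶ Z) (z' : Y.obj B ⟶ Z) {T : X.obj}
    (a : T ⟶ F.obj A) (b : T ⟶ F.obj B), a ≫ proj z = b ≫ proj z' →
    ∃ (T' : X.obj) (t : T' ⟶ T) (K : C.obj) (m : T' ⟶ F.obj K) (ε₀ : K ⟶ A) (ε₁ : K ⟶ B),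
      IsSurj X.p t ∧ m ≫ F.map ε₀ = t ≫ a ∧ m ≫ F.map ε₁ = t ≫ b ∧
      Y.map ε₀ ≫ z = Y.map ε₁ ≫ z'

variable [IsFiberedPretopos X.p] {Y : BasedFunctor C D} {F : BasedFunctor C X}

/-- The quotient of `F A` by the image of a span covering the kernel pair of `y : Y A ⟶ Z`. -/
lemma IsKernelSpan.exists_quotient [IsLexPreStack C.p] (hF : IsLexFunctor F) {A : C.obj}
    {Z : D.obj} {y : Y.obj A ⟶ Z} {K : C.obj} {δ₀ δ₁ : K ⟶ A} (h : IsKernelSpan Y y δ₀ δ₁) :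
    ∃ (Q : X.obj) (q : F.obj A ⟶ Q), X.p.IsHomLift (D.p.map y) q ∧ IsSurj X.p q ∧
      F.map δ₀ ≫ q = F.map δ₁ ≫ q ∧ ∀ ⦃T : X.obj⦄ (a b : T ⟶ F.obj A), a ≫ q = b ≫ q →
        LocRel X.p (F.map δ₀) (F.map δ₁) a b := by
  have := hasPullbacks_total X.p
  have := hasPullbacks_total C.p
  have hA : X.p.obj (F.obj A) = D.p.obj (Y.obj A) := (F.w_obj A).trans (Y.w_obj A).symm
  have hu : X.p.map (F.map δ₀) ≫ eqToHom hA ≫ D.p.map y =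
      X.p.map (F.map δ₁) ≫ eqToHom hA ≫ D.p.map y := by
    have e (δ : K ⟶ A) : X.p.map (F.map δ) ≫ eqToHom hA = eqToHom ((F.w_obj K).trans
        (Y.w_obj K).symm) ≫ D.p.map (Y.map δ) := by
      rw [IsHomLift.fac' X.p (C.p.map δ) (F.map δ), IsHomLift.fac' D.p (C.p.map δ) (Y.map δ)]
      simp
    rw [reassoc_of% (e δ₀), reassoc_of% (e δ₁), ← D.p.map_comp, ← D.p.map_comp, h.w]
  obtain ⟨Q, q, hq, h'⟩ := FibPsh.exists_quotient (F.map δ₀) (F.map δ₁) _ hu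
    (fun T a => by
      have := h.locRel hF (𝟙 A) (𝟙 A) rfl a
      rwa [F.map_id, Category.comp_id] at this)
    (fun T a b ⟨T', t, k, ht, h₀, h₁⟩ => by
      have := h.locRel hF δ₁ δ₀ h.w.symm k
      rw [h₀, h₁] at this
      exact this.of_isSurj ht)
    (fun T a b c ⟨T₁, t₁, k₁, ht₁, h₀, h₁⟩ ⟨T₂, t₂, k₂, ht₂, h₂, h₃⟩ => by
      obtain ⟨S, s₁, s₂, hs, -, e⟩ := exists_common_refinement ht₁ ht₂
      have e' : (s₁ ≫ k₁) ≫ F.map δ₁ = (s₂ ≫ k₂) ≫ F.map δ₀ := by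
        rw [Category.assoc, Category.assoc, h₁, h₂, reassoc_of% e]
      let l := (hF.map_isPullback (IsPullback.of_hasPullback δ₁ δ₀)).lift _ _ e'
      have hl₁ : l ≫ F.map (pullback.fst δ₁ δ₀) = s₁ ≫ k₁ := IsPullback.lift_fst ..
      have hl₂ : l ≫ F.map (pullback.snd δ₁ δ₀) = s₂ ≫ k₂ := IsPullback.lift_snd ..
      have := h.locRel hF (pullback.fst δ₁ δ₀ ≫ δ₀) (pullback.snd δ₁ δ₀ ≫ δ₁) (by
        rw [Y.map_comp, Category.assoc, h.w, ← Category.assoc, ← Y.map_comp, pullback.condition,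
          Y.map_comp, Category.assoc, h.w, Y.map_comp, Category.assoc]) l
      rw [F.map_comp, F.map_comp, reassoc_of% hl₁, reassoc_of% hl₂, h₀, h₃, ← reassoc_of% e,
        ← Category.assoc, ← Category.assoc] at this
      exact this.of_isSurj hs)
  exact ⟨Q, q, (IsHomLift.lift_eqToHom_comp_iff X.p _ _ _).1 hq, h'⟩

/-- The realization of `Z` is the quotient of `F A`, for a surjection `y : Y A ⟶ Z`, by the image of
the kernel pair of `y`. -/
theorem IsDense.exists_realization [IsLexPreStack C.p] [IsFiberedPretopos D.p] (hY : IsDense Y)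
    (hF : IsLexFunctor F) (Z : D.obj) : Nonempty (Realization Y F Z) := by
  have := hasPullbacks_total X.p
  have := hasPullbacks_total C.p
  have := hasPullbacks_total D.p
  obtain ⟨A, y, hy⟩ := hY.exists_isSurj Z
  obtain ⟨K, δ₀, δ₁, h⟩ := hY.exists_isKernelSpan y
  obtain ⟨Q, q, hq, hq', w, hrel⟩ := h.exists_quotient hF
  -- maps into `A` identified by `y` are identified by `q`
  have hw {T : C.obj} (κ₀ κ₁ : T ⟶ A) (e : Y.map κ₀ ≫ y = Y.map κ₁ ≫ y) :
      F.map κ₀ ≫ q = F.map κ₁ ≫ q := by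
    obtain ⟨S, s, k, hs, h₀, h₁⟩ := h.locRel hF κ₀ κ₁ e (𝟙 _)
    rw [Category.id_comp] at h₀ h₁
    have e₀ := isHomLift_map_map Y F κ₀
    have e₁ := isHomLift_map_map Y F κ₁
    have g₀ : X.p.IsHomLift (D.p.map (Y.map κ₀) ≫ D.p.map y) (F.map κ₀ ≫ q) := inferInstance
    have g₁ : X.p.IsHomLift (D.p.map (Y.map κ₁) ≫ D.p.map y) (F.map κ₁ ≫ q) := inferInstance
    rw [← D.p.map_comp, ← e, D.p.map_comp] at g₁
    refine hs.ext (map_eq_of_isHomLift X.p _ g₀ g₁) ?_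
    rw [← reassoc_of% h₀, ← reassoc_of% h₁, w]
  -- an arbitrary `z : Y B ⟶ Z` factors through `y` on a cover of `B`, and `proj z` descends from
  -- there; it satisfies the formula for every factorization, which gives all further properties
  have hproj {B : C.obj} (z : Y.obj B ⟶ Z) : ∃ g : F.obj B ⟶ Q, X.p.IsHomLift (D.p.map z) g ∧
      ∀ ⦃B' : C.obj⦄ (e : B' ⟶ B) (κ : B' ⟶ A), Y.map κ ≫ y = Y.map e ≫ z →
        F.map e ≫ g = F.map κ ≫ q := by
    obtain ⟨B', e, κ, he, hκ⟩ := hY.exists_lift hy z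
    have l₁ := isHomLift_map_map Y F e
    have l₂ := isHomLift_map_map Y F κ
    have l₃ : X.p.IsHomLift (D.p.map (Y.map κ) ≫ D.p.map y) (F.map κ ≫ q) := inferInstance
    rw [← D.p.map_comp, hκ, D.p.map_comp] at l₃
    obtain ⟨g, hg, hg'⟩ := (hF.map_isCover he).isSurj.isEff.desc (F.map κ ≫ q) _ _ l₁ l₃ (by
      intro T a b hab
      let l := (hF.map_isPullback (IsPullback.of_hasPullback e e)).lift _ _ hab
      have hl₁ : l ≫ F.map (pullback.fst e e) = a := IsPullback.lift_fst ..
      have hl₂ : l ≫ F.map (pullback.snd e e) = b := IsPullback.lift_snd ..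
      have := hw (pullback.fst e e ≫ κ) (pullback.snd e e ≫ κ) (by
        rw [Y.map_comp, Y.map_comp, Category.assoc, Category.assoc, hκ, ← Category.assoc,
          ← Category.assoc, ← Y.map_comp, ← Y.map_comp, pullback.condition])
      rw [F.map_comp, F.map_comp, Category.assoc, Category.assoc] at this
      rw [← hl₁, ← hl₂, Category.assoc, Category.assoc, this])
    refine ⟨g, hg, fun B'' e' κ' h' => ?_⟩
    have hc : IsCover C.p (pullback.snd e e') := he.of_isPullback (IsPullback.of_hasPullback e e')
    have l₄ := isHomLift_map_map Y F e'
    have l₅ := isHomLift_map_map Y F κ'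
    have l₆ : X.p.IsHomLift (D.p.map (Y.map κ') ≫ D.p.map y) (F.map κ' ≫ q) := inferInstance
    rw [← D.p.map_comp, h', D.p.map_comp] at l₆
    refine (hF.map_isCover hc).isSurj.ext (map_eq_of_isHomLift X.p (D.p.map (Y.map e') ≫
      D.p.map z) inferInstance l₆) ?_
    have := hw (pullback.fst e e' ≫ κ) (pullback.snd e e' ≫ κ') (by
        rw [Y.map_comp, Y.map_comp, Category.assoc, Category.assoc, hκ, h', ← Category.assoc,
          ← Category.assoc, ← Y.map_comp, ← Y.map_comp, pullback.condition])
    rw [F.map_comp, F.map_comp, Category.assoc, Category.assoc] at this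
    rw [← this, ← hg', ← Category.assoc, ← Category.assoc, ← F.map_comp, ← F.map_comp,
      pullback.condition]
  choose proj hproj₁ hproj₂ using @hproj
  refine ⟨⟨Q, proj, hproj₁, fun {B B₁} κ z => ?_, fun {B} z hz => ?_,
    fun {B B₁} z z' T a b hab => ?_⟩⟩
  · obtain ⟨B', e, k, he, hk⟩ := hY.exists_lift hy (Y.map κ ≫ z)
    have := hproj₁ z
    have := isHomLift_map_map Y F κ
    have l : X.p.IsHomLift (D.p.map (Y.map κ) ≫ D.p.map z) (F.map κ ≫ proj z) := inferInstance
    rw [← D.p.map_comp] at l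
    refine (hF.map_isCover he).isSurj.ext (map_eq_of_isHomLift X.p _ (hproj₁ _) l) ?_
    rw [hproj₂ _ e k hk, ← Category.assoc, ← F.map_comp, hproj₂ z (e ≫ κ) k]
    rw [hk, Y.map_comp, Category.assoc]
  · obtain ⟨A', e, k, he, hk⟩ := hY.exists_lift hz y
    exact IsSurj.of_comp_eq (hF.map_isCover he).isSurj hq' (hproj₂ z k e hk.symm)
  · -- on covers of `B` and `B₁`, the maps `z` and `z'` factor through `y` by `κ` and `κ'`; there
    -- `a` and `b` have related images in `F A`, and the iterated pullback of `κ`, the span and `κ'`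
    -- is the required object of `C`
    obtain ⟨B', e, κ, he, hκ⟩ := hY.exists_lift hy z
    obtain ⟨B₁', e', κ', he', hκ'⟩ := hY.exists_lift hy z'
    obtain ⟨T₁, t₁, a₁, ht₁, ha₁⟩ := (hF.map_isCover he).isSurj.exists_lift a
    obtain ⟨T₂, t₂, b₁, ht₂, hb₁⟩ := (hF.map_isCover he').isSurj.exists_lift b
    obtain ⟨S, s₁, s₂, hs, -, hs'⟩ := exists_common_refinement ht₁ ht₂
    obtain ⟨S', s, k, hs₀, hk₀, hk₁⟩ := hrel (s₁ ≫ a₁ ≫ F.map κ) (s₂ ≫ b₁ ≫ F.map κ') (by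
      simp only [Category.assoc]
      rw [← hproj₂ z e κ hκ, ← hproj₂ z' e' κ' hκ', reassoc_of% ha₁, reassoc_of% hb₁, hab,
        reassoc_of% hs'])
    let P₁ := IsPullback.of_hasPullback κ δ₀
    let P₂ := IsPullback.of_hasPullback (pullback.snd κ δ₀ ≫ δ₁) κ'
    let l₁ := (hF.map_isPullback P₁).lift (s ≫ s₁ ≫ a₁) k (by simp only [Category.assoc]; rw [hk₀])
    have hl₁ : l₁ ≫ F.map (pullback.fst κ δ₀) = s ≫ s₁ ≫ a₁ := IsPullback.lift_fst ..
    have hl₁' : l₁ ≫ F.map (pullback.snd κ δ₀) = k := IsPullback.lift_snd ..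
    let l₂ := (hF.map_isPullback P₂).lift l₁ (s ≫ s₂ ≫ b₁) (by
      rw [F.map_comp, reassoc_of% hl₁', hk₁]; simp only [Category.assoc])
    have hl₂ : l₂ ≫ F.map (pullback.fst (pullback.snd κ δ₀ ≫ δ₁) κ') = l₁ :=
      IsPullback.lift_fst ..
    have hl₂' : l₂ ≫ F.map (pullback.snd (pullback.snd κ δ₀ ≫ δ₁) κ') = s ≫ s₂ ≫ b₁ :=
      IsPullback.lift_snd ..
    refine ⟨S', s ≫ s₁ ≫ t₁, _, l₂, pullback.fst _ _ ≫ pullback.fst κ δ₀ ≫ e, pullback.snd _ _ ≫ e',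
      hs₀.comp hs, ?_, ?_, ?_⟩
    · rw [F.map_comp, F.map_comp, reassoc_of% hl₂, reassoc_of% hl₁, ha₁]
      simp only [Category.assoc]
    · rw [F.map_comp, reassoc_of% hl₂', hb₁, hs']
      simp only [Category.assoc]
    · simp only [Y.map_comp, Category.assoc]
      rw [← hκ, ← hκ', ← Y.map_comp_assoc (pullback.fst κ δ₀), pullback.condition,
        Y.map_comp_assoc, h.w, ← Y.map_comp_assoc, ← Y.map_comp_assoc, Category.assoc,
        pullback.condition, Y.map_comp_assoc]

end Extension

section Extension

variable {R : Type u₁} [Category.{v₁} R]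
variable {C : BasedCategory.{v₂, u₂} R} {D : BasedCategory.{v₃, u₃} R}
variable {X : BasedCategory.{v₄, u₄} R}
variable {Y : BasedFunctor C D} {F : BasedFunctor C X}

lemma IsFibTerminal.of_iso {E : Type u₂} [Category.{v₂} E] {p : E ⥤ R} {O O' : E}
    (hO : IsFibTerminal p O) (e : O ≅ O') : IsFibTerminal p O' := by
  intro T v
  obtain ⟨f, hf, hf'⟩ := hO (v ≫ p.map e.inv)
  refine ⟨f ≫ e.hom, ?_, fun g hg => ?_⟩
  · change p.map (f ≫ e.hom) = v
    rw [p.map_comp, hf, Category.assoc, ← p.map_comp, e.inv_hom_id, p.map_id, Category.comp_id]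
  · rw [← hf' (g ≫ e.inv) (by change p.map (g ≫ e.inv) = _; rw [p.map_comp, hg]),
      Category.assoc, e.inv_hom_id, Category.comp_id]

/-- An extension of `F` along `Y` on all of `D`, with its maps `proj z : F A ⟶ G Z` for
`z : Y A ⟶ Z` and the characterization of the generalized elements of `G Z` by these. -/
structure Extension (Y : BasedFunctor C D) (F : BasedFunctor C X) where
  functor : BasedFunctor D X
  proj : ∀ {A : C.obj} {Z : D.obj}, (Y.obj A ⟶ Z) → (F.obj A ⟶ functor.obj Z)
  isHomLift : ∀ {A : C.obj} {Z : D.obj} (z : Y.obj A ⟶ Z), X.p.IsHomLift (D.p.map z) (proj z)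
  naturality : ∀ {A B : C.obj} {Z : D.obj} (κ : A ⟶ B) (z : Y.obj B ⟶ Z),
    proj (Y.map κ ≫ z) = F.map κ ≫ proj z
  proj_map : ∀ {A : C.obj} {Z Z' : D.obj} (z : Y.obj A ⟶ Z) (f : Z ⟶ Z'),
    proj z ≫ functor.map f = proj (z ≫ f)
  isSurj : ∀ {A : C.obj} {Z : D.obj} (z : Y.obj A ⟶ Z), IsSurj D.p z → IsSurj X.p (proj z)
  exists_of_eq : ∀ {A B : C.obj} {Z : D.obj} (z : Y.obj A ⟶ Z) (z' : Y.obj B ⟶ Z) {T : X.obj}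
    (a : T ⟶ F.obj A) (b : T ⟶ F.obj B), a ≫ proj z = b ≫ proj z' →
    ∃ (T' : X.obj) (t : T' ⟶ T) (K : C.obj) (m : T' ⟶ F.obj K) (ε₀ : K ⟶ A) (ε₁ : K ⟶ B),
      IsSurj X.p t ∧ m ≫ F.map ε₀ = t ≫ a ∧ m ≫ F.map ε₁ = t ≫ b ∧
      Y.map ε₀ ≫ z = Y.map ε₁ ≫ z'

/-- The value of the extension at an object isomorphic to `Y A` is `F A`. -/
lemma Extension.isIso_proj (L : Extension Y F) (hY : IsDense Y) {A : C.obj} {Z : D.obj}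
    (z : Y.obj A ⟶ Z) [IsIso z] : IsIso (L.proj z) := by
  have := hY.faithful
  have l := L.isHomLift z
  have : IsIso (X.p.map (L.proj z)) := by
    rw [IsHomLift.fac' X.p (D.p.map z) (L.proj z)]
    infer_instance
  refine (L.isSurj z (.of_isIso z)).isEff.isIso fun T a b hab => ?_
  obtain ⟨T', t, K, m, ε₀, ε₁, ht, h₀, h₁, h₂⟩ := L.exists_of_eq z z a b hab
  refine ht.ext ?_ ?_
  · have := congrArg X.p.map hab
    rwa [X.p.map_comp, X.p.map_comp, cancel_mono] at this
  · rw [← h₀, ← h₁, Y.toFunctor.map_injective ((cancel_mono z).1 h₂)]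

lemma Realization.hom_ext (hY : IsDense Y) {Z : D.obj} (r : Realization Y F Z) {Q : X.obj} {J I : R}
    (u : J ⟶ I) {f g : r.pt ⟶ Q} (hf : X.p.IsHomLift u f) (hg : X.p.IsHomLift u g)
    (h : ∀ ⦃A : C.obj⦄ (z : Y.obj A ⟶ Z), r.proj z ≫ f = r.proj z ≫ g) : f = g := by
  obtain ⟨A, y, hy⟩ := hY.exists_isSurj Z
  exact (r.isSurj y hy).ext (map_eq_of_isHomLift X.p u hf hg) (h y)

/-- Maps `z, z'` into `Z` become equal on each generalized element at which they agree in the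
extension. -/
lemma Extension.exists_of_comp_eq [Regular R] [IsLexPreStack C.p] [IsFiberedPretopos X.p]
    (L : Extension Y F) (hF : IsLexFunctor F) {Z : D.obj} {A : C.obj}
    (z z' : Y.obj A ⟶ Z) {T : X.obj} (k : T ⟶ F.obj A) (h : k ≫ L.proj z = k ≫ L.proj z') :
    ∃ (T' : X.obj) (t : T' ⟶ T) (K : C.obj) (m : T' ⟶ F.obj K) (ε : K ⟶ A), IsSurj X.p t ∧
      m ≫ F.map ε = t ≫ k ∧ Y.map ε ≫ z = Y.map ε ≫ z' := by
  have := hasFiniteLimits_total C.p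
  have := hF.preservesFiniteLimits_total
  obtain ⟨T', t, K, m, ε₀, ε₁, ht, h₀, h₁, h₂⟩ := L.exists_of_eq z z' k k h
  have hl := isLimitForkMapOfIsLimit F.toFunctor (equalizer.condition ε₀ ε₁)
    (equalizerIsEqualizer ε₀ ε₁)
  obtain ⟨l, hl⟩ := Fork.IsLimit.lift' hl m (h₀.trans h₁.symm)
  replace hl : l ≫ F.map (equalizer.ι ε₀ ε₁) = m := hl
  refine ⟨T', t, _, l, equalizer.ι ε₀ ε₁ ≫ ε₀, ht, ?_, ?_⟩
  · rw [F.map_comp, reassoc_of% hl, h₀]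
  · have e := congrArg (fun k => Y.map k ≫ z') (equalizer.condition ε₀ ε₁)
    simp only [Y.map_comp, Category.assoc] at e ⊢
    rw [h₂, ← e]

variable [Regular R] [IsFiberedPretopos D.p] [IsFiberedPretopos X.p]

lemma Extension.map_isSurj (L : Extension Y F) (hY : IsDense Y) {Z Z' : D.obj} (f : Z ⟶ Z')
    (hf : IsSurj D.p f) :
    IsSurj X.p (L.functor.map f) := by
  have := hasPullbacks_total X.p
  have := hasPullbacks_total D.p
  obtain ⟨A, y, hy⟩ := hY.exists_isSurj Z
  have := L.isSurj (y ≫ f) (hy.comp hf)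
  rw [← L.proj_map] at this
  exact IsSurj.of_comp this

variable [IsLexPreStack C.p]

lemma Realization.exists_map (hY : IsDense Y) (hF : IsLexFunctor F) {Z Z' : D.obj}
    (r : Realization Y F Z) (r' : Realization Y F Z') (f : Z ⟶ Z') :
    ∃ h : r.pt ⟶ r'.pt, X.p.IsHomLift (D.p.map f) h ∧
      ∀ ⦃A : C.obj⦄ (z : Y.obj A ⟶ Z), r.proj z ≫ h = r'.proj (z ≫ f) := by
  have := hasPullbacks_total D.p
  obtain ⟨A, y, hy⟩ := hY.exists_isSurj Z
  have hp {B : C.obj} (z : Y.obj B ⟶ Z) : X.p.IsHomLift (D.p.map z ≫ D.p.map f)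
      (r'.proj (z ≫ f)) := by
    rw [← D.p.map_comp]
    exact r'.isHomLift _
  obtain ⟨h, hh, hh'⟩ := (r.isSurj y hy).isEff.desc (r'.proj (y ≫ f)) (D.p.map y) (D.p.map f)
    (r.isHomLift y) (hp y) (by
      intro T a b hab
      obtain ⟨T', t, K, m, ε₀, ε₁, ht, h₀, h₁, h₂⟩ := r.exists_of_eq y y a b hab
      refine ht.ext (map_comp_eq_of_isHomLift X.p _ _ (r.isHomLift y) (hp y) hab) ?_
      rw [← reassoc_of% h₀, ← reassoc_of% h₁, ← r'.naturality, ← r'.naturality,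
        reassoc_of% h₂])
  refine ⟨h, hh, fun B z => ?_⟩
  obtain ⟨B', e, k, he, hk⟩ := hY.exists_lift hy z
  have l₁ := r.isHomLift z
  refine (hF.map_isCover he).isSurj.ext (map_eq_of_isHomLift X.p (D.p.map z ≫ D.p.map f)
    inferInstance (hp z)) ?_
  rw [← r'.naturality, ← Category.assoc, ← r.naturality, ← hk, r.naturality, Category.assoc, hh',
    ← r'.naturality, reassoc_of% hk]

/-- Realizations of the objects assemble to a functor, as maps out of them are determined on the
maps `proj z`. -/
theorem IsDense.exists_extension (hY : IsDense Y) (hF : IsLexFunctor F) :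
    Nonempty (Extension Y F) := by
  have r (Z : D.obj) : Realization Y F Z := (hY.exists_realization hF Z).some
  choose m hm₁ hm₂ using fun Z Z' (f : Z ⟶ Z') => (r Z).exists_map hY hF (r Z') f
  have hobj (Z : D.obj) : X.p.obj (r Z).pt = D.p.obj Z := by
    obtain ⟨A, y, hy⟩ := hY.exists_isSurj Z
    have := (r Z).isHomLift y
    exact IsHomLift.codomain_eq X.p (D.p.map y) ((r Z).proj y)
  let G : D.obj ⥤ X.obj :=
    { obj Z := (r Z).pt
      map f := m _ _ f
      map_id Z := by
        refine (r Z).hom_ext hY (D.p.map (𝟙 Z)) (hm₁ _ _ _) ?_ fun A z => ?_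
        · rw [D.p.map_id]
          exact IsHomLift.id (hobj Z)
        · rw [hm₂, Category.comp_id, Category.comp_id]
      map_comp {Z₁ Z₂ Z₃} f g := by
        refine (r Z₁).hom_ext hY (D.p.map (f ≫ g)) (hm₁ _ _ _) ?_ fun A z => ?_
        · have := hm₁ _ _ f
          have := hm₁ _ _ g
          rw [D.p.map_comp]
          infer_instance
        · rw [hm₂, reassoc_of% (hm₂ _ _ f), hm₂, Category.assoc] }
  exact ⟨{
    functor := ⟨G, CategoryTheory.Functor.ext hobj fun Z Z' f =>
      have := hm₁ _ _ f
      IsHomLift.fac' X.p (D.p.map f) (m _ _ f)⟩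
    proj {A Z} z := (r Z).proj z
    isHomLift {A Z} z := (r Z).isHomLift z
    naturality {A B Z} κ z := (r Z).naturality κ z
    proj_map {A Z Z'} z f := hm₂ _ _ f z
    isSurj {A Z} z hz := (r Z).isSurj z hz
    exists_of_eq {A B Z} z z' {T} a b h := (r Z).exists_of_eq z z' a b h }⟩

namespace Extension

variable (L : Extension Y F)

/-- The legs of a pullback are jointly monic in the extension. -/
lemma jointly_mono (hY : IsDense Y) (hF : IsLexFunctor F) {P Z Z' W : D.obj} {a : P ⟶ Z}
    {b : P ⟶ Z'} {f : Z ⟶ W} {g : Z' ⟶ W}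
    (h : IsPullback a b f g) {T : X.obj} (d d' : T ⟶ L.functor.obj P)
    (h₀ : d ≫ L.functor.map a = d' ≫ L.functor.map a)
    (h₁ : d ≫ L.functor.map b = d' ≫ L.functor.map b) : d = d' := by
  have := hasPullbacks_total X.p
  obtain ⟨A, y, hy⟩ := hY.exists_isSurj P
  obtain ⟨T₁, t₁, n, ht₁, hn⟩ := (L.isSurj y hy).exists_lift d
  obtain ⟨T₂, t₂, n', ht₂, hn'⟩ := (L.isSurj y hy).exists_lift d'
  obtain ⟨S, s₁, s₂, hs, -, hs'⟩ := exists_common_refinement ht₁ ht₂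
  have e₁ : (s₁ ≫ n) ≫ L.proj (y ≫ a) = (s₂ ≫ n') ≫ L.proj (y ≫ a) := by
    rw [← L.proj_map, Category.assoc, Category.assoc, reassoc_of% hn, reassoc_of% hn',
      reassoc_of% hs', h₀]
  have e₂ : (s₁ ≫ n) ≫ L.proj (y ≫ b) = (s₂ ≫ n') ≫ L.proj (y ≫ b) := by
    rw [← L.proj_map, Category.assoc, Category.assoc, reassoc_of% hn, reassoc_of% hn',
      reassoc_of% hs', h₁]
  -- the elements agree in `Z`, hence on some `K` in `C`; restricting to an equalizer in `C` they
  -- agree in `Z'` as well, hence in the pullback `P`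
  obtain ⟨S', s, K, m, ε₀, ε₁, ht, k₀, k₁, k₂⟩ := L.exists_of_eq _ _ _ _ e₁
  have e₃ : m ≫ L.proj (Y.map ε₀ ≫ y ≫ b) = m ≫ L.proj (Y.map ε₁ ≫ y ≫ b) := by
    rw [L.naturality, L.naturality, reassoc_of% k₀, reassoc_of% k₁]
    simpa using s ≫= e₂
  obtain ⟨S'', s', K', m', ε, ht', k₃, k₄⟩ := L.exists_of_comp_eq hF _ _ _ e₃
  have e₄ : Y.map ε ≫ Y.map ε₀ ≫ y = Y.map ε ≫ Y.map ε₁ ≫ y := by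
    apply h.hom_ext
    · simpa using Y.map ε ≫= k₂
    · simpa using k₄
  refine ((ht'.comp ht).comp hs).ext ?_ ?_
  · have e₅ := congrArg X.p.map h₀
    have e₆ := congrArg X.p.map h₁
    have hP := FibPsh.map_isPullback D.p h
    rw [← L.functor.w] at hP
    rw [X.p.map_comp, X.p.map_comp] at e₅ e₆
    exact hP.hom_ext e₅ e₆
  · have e₅ := m' ≫= congrArg L.proj e₄
    simp only [L.naturality] at e₅
    rw [reassoc_of% k₃, reassoc_of% k₃, reassoc_of% k₀, reassoc_of% k₁, hn, hn'] at e₅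
    simpa only [Category.assoc, reassoc_of% hs'] using e₅

/-- A compatible pair of generalized elements comes locally from the pullback, since the extension
characterizes when elements of its values agree; the local lift descends. -/
lemma map_isPullback (hY : IsDense Y) (hF : IsLexFunctor F) {P Z Z' W : D.obj} {a : P ⟶ Z}
    {b : P ⟶ Z'} {f : Z ⟶ W}
    {g : Z' ⟶ W} (h : IsPullback a b f g) : IsPullback (L.functor.map a)
      (L.functor.map b) (L.functor.map f) (L.functor.map g) := by
  have := hasPullbacks_total X.p
  have comm : L.functor.map a ≫ L.functor.map f =
      L.functor.map b ≫ L.functor.map g := by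
    rw [← Functor.map_comp, ← Functor.map_comp, h.w]
  have hP := FibPsh.map_isPullback D.p h
  rw [← L.functor.w] at hP
  have univ : ∀ {T : X.obj} (x : T ⟶ L.functor.obj Z)
      (x' : T ⟶ L.functor.obj Z'),
      x ≫ L.functor.map f = x' ≫ L.functor.map g →
      ∃ d : T ⟶ L.functor.obj P,
        d ≫ L.functor.map a = x ∧ d ≫ L.functor.map b = x' := by
    intro T x x' e
    obtain ⟨A, y, hy⟩ := hY.exists_isSurj Z
    obtain ⟨A', y', hy'⟩ := hY.exists_isSurj Z'
    obtain ⟨T₁, t₁, n, ht₁, hn⟩ := (L.isSurj y hy).exists_lift x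
    obtain ⟨T₂, t₂, n', ht₂, hn'⟩ := (L.isSurj y' hy').exists_lift x'
    obtain ⟨S, s₁, s₂, hs, -, hs'⟩ := exists_common_refinement ht₁ ht₂
    have e₁ : (s₁ ≫ n) ≫ L.proj (y ≫ f) = (s₂ ≫ n') ≫ L.proj (y' ≫ g) := by
      rw [← L.proj_map, ← L.proj_map, Category.assoc, Category.assoc,
        reassoc_of% hn, reassoc_of% hn', reassoc_of% hs', e]
    -- locally, the pair is given by maps `Y K ⟶ Z` and `Y K ⟶ Z'` which agree in `W`, and so by a
    -- map `w : Y K ⟶ P`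
    obtain ⟨S', s, K, m, ε₀, ε₁, ht, k₀, k₁, k₂⟩ := L.exists_of_eq _ _ _ _ e₁
    let w := h.lift (Y.map ε₀ ≫ y) (Y.map ε₁ ≫ y') (by simpa using k₂)
    have hw₀ : w ≫ a = Y.map ε₀ ≫ y := h.lift_fst ..
    have hw₁ : w ≫ b = Y.map ε₁ ≫ y' := h.lift_snd ..
    let t := s ≫ s₁ ≫ t₁
    have ht : IsSurj X.p t := ht.comp hs
    let q := m ≫ L.proj w
    have hq₀ : q ≫ L.functor.map a = t ≫ x := by
      change (m ≫ L.proj w) ≫ _ = (s ≫ s₁ ≫ t₁) ≫ x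
      rw [Category.assoc, L.proj_map, hw₀, L.naturality, reassoc_of% k₀, hn]
      simp only [Category.assoc]
    have hq₁ : q ≫ L.functor.map b = t ≫ x' := by
      change (m ≫ L.proj w) ≫ _ = (s ≫ s₁ ≫ t₁) ≫ x'
      rw [Category.assoc, L.proj_map, hw₁, L.naturality, reassoc_of% k₁, hn']
      simp only [Category.assoc]
      rw [reassoc_of% hs']
    clear_value t q
    let v := hP.lift (X.p.map x) (X.p.map x') (by
      have := congrArg X.p.map e
      rwa [X.p.map_comp, X.p.map_comp] at this)
    have hv₀ : v ≫ X.p.map (L.functor.map a) = X.p.map x := hP.lift_fst ..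
    have hv₁ : v ≫ X.p.map (L.functor.map b) = X.p.map x' := hP.lift_snd ..
    -- the local lift `q` descends along `t` because the legs are jointly monic; the base component
    -- of the descended map is given by the pullback in the base
    obtain ⟨d, ⟨hd', hd⟩, -⟩ := ht.isEff q v (by
      apply hP.hom_ext
      · change _ ≫ X.p.map (L.functor.map a) = _ ≫ X.p.map (L.functor.map a)
        rw [Category.assoc, hv₀, ← X.p.map_comp, ← X.p.map_comp, hq₀]
      · change _ ≫ X.p.map (L.functor.map b) = _ ≫ X.p.map (L.functor.map b)
        rw [Category.assoc, hv₁, ← X.p.map_comp, ← X.p.map_comp, hq₁]) (by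
      intro N c c' hc
      apply L.jointly_mono hY hF h
      · rw [Category.assoc, Category.assoc, hq₀, reassoc_of% hc]
      · rw [Category.assoc, Category.assoc, hq₁, reassoc_of% hc])
    refine ⟨d, ht.ext ?_ (by rw [reassoc_of% hd, hq₀]), ht.ext ?_ (by rw [reassoc_of% hd, hq₁])⟩
    · rw [X.p.map_comp, hd', hv₀]
    · rw [X.p.map_comp, hd', hv₁]
  choose l hl₀ hl₁ using @univ
  exact ⟨⟨comm⟩, ⟨PullbackCone.IsLimit.mk comm (fun s => l s.fst s.snd s.condition)
    (fun s => hl₀ _ _ _) (fun s => hl₁ _ _ _) (fun s m h₀ h₁ => L.jointly_mono hY hF h _ _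
      (h₀.trans (hl₀ _ _ _).symm) (h₁.trans (hl₁ _ _ _).symm))⟩⟩

lemma isLexFunctor (hY : IsDense Y) (hF : IsLexFunctor F) : IsLexFunctor L.functor := by
  refine IsLexFunctor.of_isPullback (fun I => ?_) fun _ _ _ _ _ _ _ _ h => L.map_isPullback hY hF h
  have h₁ := isFibTerminal_one (p := D.p) I
  have h₂ := hY.isLexFunctor.map_isFibTerminal (isFibTerminal_one (p := C.p) I)
  have hI := (Y.w_obj _).trans (one C.p I).2
  obtain ⟨f, hf⟩ := h₁.exists_lift hI (one D.p I).2 (𝟙 I)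
  obtain ⟨g, hg⟩ := h₂.exists_lift (one D.p I).2 hI (𝟙 I)
  have l₁ : D.p.IsHomLift (𝟙 I ≫ 𝟙 I) (f ≫ g) := inferInstance
  have l₂ : D.p.IsHomLift (𝟙 I ≫ 𝟙 I) (g ≫ f) := inferInstance
  rw [Category.id_comp] at l₁ l₂
  have : IsIso f := ⟨g, h₂.ext (map_eq_of_isHomLift D.p (𝟙 I) l₁ (IsHomLift.id hI)),
    h₁.ext (map_eq_of_isHomLift D.p (𝟙 I) l₂ (IsHomLift.id (one D.p I).2))⟩
  have := L.isIso_proj hY f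
  exact (hF.map_isFibTerminal (isFibTerminal_one I)).of_iso (asIso (L.proj f))

lemma isPositiveFunctor (hY : IsDense Y) (hF : IsLexFunctor F) : IsPositiveFunctor L.functor :=
  IsPositiveFunctor.of_isSurj (L.isLexFunctor hY hF) fun _ _ f hf => L.map_isSurj hY f hf

end Extension

lemma IsDense.precomp_essSurj (hY : IsDense Y) : (precomp Y hY.isLexFunctor X).EssSurj where
  mem_essImage F := by
    obtain ⟨L⟩ := hY.exists_extension F.property
    have (A : C.obj) := L.isIso_proj hY (𝟙 (Y.obj A))
    refine ⟨⟨L.functor, L.isPositiveFunctor hY F.property⟩, ⟨(ObjectProperty.isoMk _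
      (BasedNatIso.mkNatIso (F := F.obj) (G := Y.comp L.functor)
        (NatIso.ofComponents (fun A => @asIso _ _ _ _ (L.proj (𝟙 (Y.obj A))) (this A))
        fun {A B} f => ?_) fun A => ?_)).symm⟩⟩
    · change F.obj.map f ≫ L.proj (𝟙 _) = L.proj (𝟙 _) ≫ L.functor.map (Y.map f)
      rw [← L.naturality, L.proj_map, Category.comp_id, Category.id_comp]
    · exact isHomLift_congr (p := D.p) (z := 𝟙 (Y.obj A)) (u := D.p.map (𝟙 (Y.obj A))) inferInstance
        inferInstance (L.isHomLift (𝟙 (Y.obj A)))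

/-- The universal property of dense embeddings: finite limit preserving fibered functors into
fibered pretoposes extend along them, uniquely up to isomorphism. -/
theorem IsDense.precomp_isEquivalence (hY : IsDense Y) (X : BasedCategory.{v₄, u₄} R)
    [IsFiberedPretopos X.p] : (precomp Y hY.isLexFunctor X).IsEquivalence where
  faithful := hY.precomp_faithful
  full := hY.precomp_full
  essSurj := hY.precomp_essSurj

end Extension

/-! ### A criterion for exactness -/

section Exactness

/-- Exactness from a class `S` of regular epimorphisms that is stable under pullback and contains
the first factor of a factorization of each morphism; such an `S` contains all regular
epimorphisms. -/
lemma isExact_of_factorization {A : Type u₁} [Category.{v₁} A] [HasFiniteLimits A]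
    (S : MorphismProperty A) (hS : ∀ ⦃X Y : A⦄ (f : X ⟶ Y), S f → IsRegularEpi f)
    (hpb : ∀ ⦃P X Y Z : A⦄ ⦃a : P ⟶ X⦄ ⦃b : P ⟶ Y⦄ ⦃f : X ⟶ Z⦄ ⦃g : Y ⟶ Z⦄,
      IsPullback a b f g → S f → S b)
    (hfac : ∀ ⦃X Y : A⦄ (f : X ⟶ Y), ∃ (M : A) (e : X ⟶ M) (m : M ⟶ Y), S e ∧ Mono m ∧ e ≫ m = f)
    (heff : ∀ ⦃K X : A⦄ (r₁ r₂ : K ⟶ X), IsEquivalenceRelation r₁ r₂ →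
      ∃ (Q : A) (q : X ⟶ Q), IsKernelPair q r₁ r₂) :
    IsExact A ∧ ∀ ⦃X Y : A⦄ (f : X ⟶ Y), IsRegularEpi f → S f := by
  have key ⦃X Y : A⦄ (f : X ⟶ Y) (hf : IsRegularEpi f) : S f := by
    obtain ⟨M, e, m, he, hm, rfl⟩ := hfac f
    have : StrongEpi m := strongEpi_of_strongEpi e m
    have : IsIso m := isIso_of_mono_of_strongEpi m
    exact hpb (a := 𝟙 X) (b := e ≫ m) (f := e) (g := inv m) (.of_horiz_isIso ⟨by simp⟩) he
  have hcoeq {X Y Z : A} {f : X ⟶ Y} {g₁ g₂ : Z ⟶ X} (h : IsKernelPair f g₁ g₂) :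
      HasCoequalizer g₁ g₂ := by
    obtain ⟨M, e, m, he, hm, rfl⟩ := hfac f
    have := hS _ he
    have hk : IsKernelPair e g₁ g₂ := h.cancel_right_of_mono
    exact ⟨⟨_, hk.toCoequalizer (IsRegularEpi.getStruct e)⟩⟩
  exact ⟨⟨⟨hcoeq, ⟨fun h hg => hS _ (hpb h (key _ hg))⟩⟩, heff⟩, key⟩

end Exactness

/-! ### Gluing along a functor -/

section Gluing

variable {R : Type u₁} [Category.{v₁} R] {A : Type u₂} [Category.{v₂} A]

/-- The gluing fibration of `Δ : R ⥤ A`: objects over `I` are maps `X ⟶ Δ I`. -/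
abbrev glue (Δ : R ⥤ A) : Comma (𝟭 A) Δ ⥤ R := Comma.snd (𝟭 A) Δ

variable {Δ : R ⥤ A}

/-- The map to `Δ` of the base displaying an object of the gluing. -/
abbrev display (X : Comma (𝟭 A) Δ) : X.left ⟶ Δ.obj X.right := X.hom

lemma display_w {X Y : Comma (𝟭 A) Δ} (f : X ⟶ Y) :
    f.left ≫ display Y = display X ≫ Δ.map f.right := f.w

/-- Maps of the gluing. -/
abbrev glueHom {X Y : Comma (𝟭 A) Δ} (l : X.left ⟶ Y.left) (r : X.right ⟶ Y.right)
    (w : l ≫ display Y = display X ≫ Δ.map r) : X ⟶ Y := ⟨l, r, w⟩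

lemma comma_left_comp {X Y Z : Comma (𝟭 A) Δ} (f : X ⟶ Y) (g : Y ⟶ Z) :
    (f ≫ g).left = f.left ≫ g.left := rfl

/-- Squares of the gluing with pullback components are pullbacks, if `Δ` maps the component in the
base to a pullback. -/
lemma isPullback_comma {P X Y Z : Comma (𝟭 A) Δ} {a : P ⟶ X} {b : P ⟶ Y} {f : X ⟶ Z} {g : Y ⟶ Z}
    (hl : IsPullback a.left b.left f.left g.left)
    (hr : IsPullback a.right b.right f.right g.right)
    (hr' : IsPullback (Δ.map a.right) (Δ.map b.right) (Δ.map f.right) (Δ.map g.right)) :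
    IsPullback a b f g := by
  have univ : ∀ {T : Comma (𝟭 A) Δ} (x : T ⟶ X) (y : T ⟶ Y), x ≫ f = y ≫ g →
      ∃ d : T ⟶ P, d ≫ a = x ∧ d ≫ b = y := by
    intro T x y h
    have hxl : x.left ≫ f.left = y.left ≫ g.left := congrArg CommaMorphism.left h
    have hxr : x.right ≫ f.right = y.right ≫ g.right := congrArg CommaMorphism.right h
    refine ⟨glueHom (hl.lift _ _ hxl) (hr.lift _ _ hxr) ?_, ?_, ?_⟩
    · apply hr'.hom_ext
      · rw [Category.assoc, Category.assoc, ← display_w, hl.lift_fst_assoc, display_w,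
          ← Δ.map_comp, hr.lift_fst]
      · rw [Category.assoc, Category.assoc, ← display_w, hl.lift_snd_assoc, display_w,
          ← Δ.map_comp, hr.lift_snd]
    · exact CommaMorphism.ext (hl.lift_fst _ _ hxl) (hr.lift_fst _ _ hxr)
    · exact CommaMorphism.ext (hl.lift_snd _ _ hxl) (hr.lift_snd _ _ hxr)
  choose l h₀ h₁ using @univ
  have comm : a ≫ f = b ≫ g := CommaMorphism.ext hl.w hr.w
  exact ⟨⟨comm⟩, ⟨PullbackCone.IsLimit.mk comm (fun s => l s.fst s.snd s.condition)
    (fun s => h₀ _ _ _) (fun s => h₁ _ _ _) (fun s m h h' => CommaMorphism.ext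
      (hl.hom_ext (congrArg CommaMorphism.left (h.trans (h₀ _ _ s.condition).symm))
        (congrArg CommaMorphism.left (h'.trans (h₁ _ _ s.condition).symm)))
      (hr.hom_ext (congrArg CommaMorphism.right (h.trans (h₀ _ _ s.condition).symm))
        (congrArg CommaMorphism.right (h'.trans (h₁ _ _ s.condition).symm))))⟩⟩

section

variable [HasPullbacks R] [HasPullbacks A] [PreservesLimitsOfShape WalkingCospan Δ]

lemma exists_isPullback_comma {X Y Z : Comma (𝟭 A) Δ} (f : X ⟶ Z) (g : Y ⟶ Z) :
    ∃ (P : Comma (𝟭 A) Δ) (a : P ⟶ X) (b : P ⟶ Y), IsPullback a b f g ∧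
      IsPullback a.left b.left f.left g.left := by
  have hl := IsPullback.of_hasPullback f.left g.left
  have hr := IsPullback.of_hasPullback f.right g.right
  have hr' := hr.map Δ
  let d : pullback f.left g.left ⟶ Δ.obj (pullback f.right g.right) :=
    hr'.lift (pullback.fst _ _ ≫ display X) (pullback.snd _ _ ≫ display Y) (by
      rw [Category.assoc, Category.assoc, ← display_w, ← display_w, reassoc_of% hl.w])
  let P : Comma (𝟭 A) Δ := ⟨_, _, d⟩
  let a : P ⟶ X := glueHom (pullback.fst _ _) (pullback.fst _ _) (hr'.lift_fst ..).symm
  let b : P ⟶ Y := glueHom (pullback.snd _ _) (pullback.snd _ _) (hr'.lift_snd ..).symm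
  exact ⟨P, a, b, isPullback_comma hl hr hr', hl⟩

lemma isPullback_left {P X Y Z : Comma (𝟭 A) Δ} {a : P ⟶ X} {b : P ⟶ Y} {f : X ⟶ Z} {g : Y ⟶ Z}
    (h : IsPullback a b f g) : IsPullback a.left b.left f.left g.left := by
  obtain ⟨P', a', b', h', hl⟩ := exists_isPullback_comma f g
  exact hl.of_iso ((Comma.fst (𝟭 A) Δ).mapIso (h'.isoIsPullback _ _ h)) (.refl _) (.refl _)
    (.refl _)
    ((Category.comp_id _).trans (congrArg CommaMorphism.left (h'.isoIsPullback_hom_fst _ _ h)).symm)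
    ((Category.comp_id _).trans (congrArg CommaMorphism.left (h'.isoIsPullback_hom_snd _ _ h)).symm)
    ((Category.comp_id _).trans (Category.id_comp _).symm)
    ((Category.comp_id _).trans (Category.id_comp _).symm)

variable (Δ) in
lemma hasPullbacks_comma : HasPullbacks (Comma (𝟭 A) Δ) :=
  haveI {X Y Z : Comma (𝟭 A) Δ} (f : X ⟶ Z) (g : Y ⟶ Z) : HasPullback f g :=
    (exists_isPullback_comma f g).choose_spec.choose_spec.choose_spec.1.hasPullback
  hasPullbacks_of_hasLimit_cospan _

end

/-- Cartesian maps of the gluing are given by pullbacks of the displayed maps. -/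
lemma isCart_of_isPullback {X Y : Comma (𝟭 A) Δ} {f : X ⟶ Y}
    (h : IsPullback f.left (display X) (display Y) (Δ.map f.right)) : IsCart (glue Δ) f := by
  rw [isCart_iff]
  intro T g v hg
  replace hg : g.right = v ≫ f.right := hg
  have e : g.left ≫ display Y = (display T ≫ Δ.map v) ≫ Δ.map f.right := by
    rw [display_w, hg, Δ.map_comp, Category.assoc]
  refine ⟨glueHom (h.lift _ _ e) v (h.lift_snd ..), ⟨rfl, CommaMorphism.ext (h.lift_fst ..) hg.symm⟩,
    ?_⟩
  rintro k ⟨rfl, hk⟩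
  refine CommaMorphism.ext (h.hom_ext ?_ ?_) rfl
  · exact (congrArg CommaMorphism.left hk).trans (h.lift_fst ..).symm
  · exact (display_w k).trans (h.lift_snd ..).symm

lemma exists_isPullback_display [HasPullbacks A] (Y : Comma (𝟭 A) Δ) {J : R} (u : J ⟶ Y.right) :
    ∃ (l : A) (d : l ⟶ Δ.obj J) (f : (⟨l, J, d⟩ : Comma (𝟭 A) Δ) ⟶ Y), f.right = u ∧
      IsPullback f.left d (display Y) (Δ.map f.right) :=
  ⟨_, pullback.snd (display Y) (Δ.map u), glueHom (pullback.fst (display Y) (Δ.map u)) u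
    pullback.condition, rfl, .of_hasPullback _ _⟩

lemma isFibered_glue [HasPullbacks A] : (glue Δ).IsFibered :=
  IsFibered.of_exists_isStronglyCartesian fun Y J u => by
    obtain ⟨l, d, f, rfl, h⟩ := exists_isPullback_display Y u
    exact ⟨_, f, isCart_of_isPullback h⟩

lemma isFibTerminal_of_isIso (O : Comma (𝟭 A) Δ) [IsIso (display O)] :
    IsFibTerminal (glue Δ) O := by
  intro T v
  refine ⟨glueHom (display T ≫ Δ.map v ≫ inv (display O)) v ?_, rfl, ?_⟩
  · rw [Category.assoc, Category.assoc, IsIso.inv_hom_id, Category.comp_id]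
  · rintro f rfl
    exact CommaMorphism.ext (((IsIso.eq_comp_inv _).2 (display_w f)).trans (Category.assoc _ _ _)) rfl

lemma isFibTerminal_glue (I : R) : IsFibTerminal (glue Δ) ⟨Δ.obj I, I, 𝟙 _⟩ :=
  have : IsIso (display (⟨Δ.obj I, I, 𝟙 _⟩ : Comma (𝟭 A) Δ)) := inferInstanceAs (IsIso (𝟙 (Δ.obj I)))
  isFibTerminal_of_isIso _

lemma exists_isCocart_glue (X : Comma (𝟭 A) Δ) {I : R} (u : X.right ⟶ I) :
    ∃ (d : X.left ⟶ Δ.obj I) (s : X ⟶ ⟨X.left, I, d⟩), s.left = 𝟙 _ ∧ s.right = u :=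
  ⟨display X ≫ Δ.map u, glueHom (𝟙 _) u (Category.id_comp _), rfl, rfl⟩

/-- Cocartesian maps of the gluing are those with invertible component in `A`: the internal sum
along `u` composes the displayed map with `Δ u`. -/
lemma isCocart_of_isIso_left {X Y : Comma (𝟭 A) Δ} (s : X ⟶ Y) [IsIso s.left] :
    IsCocart (glue Δ) s := by
  rw [isCocart_iff]
  intro Z g v hv
  replace hv : g.right = s.right ≫ v := hv
  refine ⟨glueHom (inv s.left ≫ g.left) v ?_, ⟨rfl, CommaMorphism.ext (by
    rw [comma_left_comp, IsIso.hom_inv_id_assoc]) hv.symm⟩, ?_⟩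
  · rw [Category.assoc, IsIso.inv_comp_eq, display_w, hv, Δ.map_comp, ← Category.assoc,
      ← display_w, Category.assoc]
  · rintro k ⟨rfl, rfl⟩
    exact CommaMorphism.ext (IsIso.inv_hom_id_assoc s.left k.left).symm rfl

lemma isIso_left_of_isCocart {X Y : Comma (𝟭 A) Δ} (s : X ⟶ Y) (hs : IsCocart (glue Δ) s) :
    IsIso s.left := by
  obtain ⟨d, s', hl, hr⟩ := exists_isCocart_glue X s.right
  have : IsIso s'.left := by rw [hl]; infer_instance
  obtain ⟨h, ⟨h₁, h₂⟩, -⟩ := (isCocart_iff (glue Δ)).1 hs s' (𝟙 _)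
    (hr.trans (Category.comp_id _).symm)
  obtain ⟨k, ⟨h₃, h₄⟩, -⟩ := (isCocart_iff (glue Δ)).1 (isCocart_of_isIso_left s') s (𝟙 _)
    ((Category.comp_id _).trans hr).symm
  have key : h ≫ k = 𝟙 Y := by
    refine ((isCocart_iff (glue Δ)).1 hs s (𝟙 _) (Category.comp_id _).symm).unique ⟨?_, ?_⟩
      ⟨(glue Δ).map_id Y, Category.comp_id s⟩
    · rw [(glue Δ).map_comp, h₁, h₃]
      exact Category.id_comp _
    · rw [← Category.assoc, h₂, h₄]
  have e₁ := congrArg CommaMorphism.left h₂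
  have e₂ := congrArg CommaMorphism.left h₄
  have e₃ := congrArg CommaMorphism.left key
  rw [comma_left_comp, hl] at e₁ e₂
  replace e₂ : k.left = s.left := (Category.id_comp _).symm.trans e₂
  rw [comma_left_comp, e₂] at e₃
  exact ⟨h.left, e₁, e₃⟩

section Fibers

variable {I : R}

lemma isIso_right_of_vertical {X Y : Comma (𝟭 A) Δ} {f : X ⟶ Y}
    (hf : (glue Δ).IsHomLift (𝟙 I) f) : IsIso f.right := by
  change IsIso ((glue Δ).map f)
  rw [IsHomLift.fac' (glue Δ) (𝟙 I) f]
  infer_instance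

variable (Δ I) in
lemma exists_isTerminal_fiber : ∃ O : (glue Δ).Fiber I, IsFibTerminal (glue Δ) O.1 :=
  ⟨⟨_, rfl⟩, isFibTerminal_glue I⟩

lemma exists_isPullback_fiber [HasPullbacks A] {X Y Z : (glue Δ).Fiber I} (f : X ⟶ Z) (g : Y ⟶ Z) :
    ∃ (P : (glue Δ).Fiber I) (a : P ⟶ X) (b : P ⟶ Y), IsPullback a.1 b.1 f.1 g.1 := by
  obtain ⟨Z, rfl⟩ := Z
  have hf := isIso_right_of_vertical f.2
  have hg := isIso_right_of_vertical g.2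
  have hl := IsPullback.of_hasPullback f.1.left g.1.left
  have hr : IsPullback (inv f.1.right) (inv g.1.right) f.1.right g.1.right :=
    .of_horiz_isIso ⟨(IsIso.inv_hom_id _).trans (IsIso.inv_hom_id _).symm⟩
  let P : Comma (𝟭 A) Δ := ⟨pullback f.1.left g.1.left, Z.right,
    pullback.fst f.1.left g.1.left ≫ f.1.left ≫ display Z⟩
  let a : P ⟶ X.1 := glueHom (pullback.fst f.1.left g.1.left) (inv f.1.right) (by
    change _ = (pullback.fst f.1.left g.1.left ≫ f.1.left ≫ display Z) ≫ _
    rw [display_w, Category.assoc, Category.assoc, ← Δ.map_comp]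
    simp)
  let b : P ⟶ Y.1 := glueHom (pullback.snd f.1.left g.1.left) (inv g.1.right) (by
    change _ = (pullback.fst f.1.left g.1.left ≫ f.1.left ≫ display Z) ≫ _
    rw [pullback.condition_assoc, display_w, Category.assoc, Category.assoc, ← Δ.map_comp]
    simp)
  have h : IsPullback a b f.1 g.1 := isPullback_comma hl hr (hr.map Δ)
  have haf : (glue Δ).IsHomLift (𝟙 ((glue Δ).obj Z)) (a ≫ f.1) := by
    have e : (glue Δ).map (a ≫ f.1) = 𝟙 ((glue Δ).obj Z) := IsIso.inv_hom_id f.1.right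
    exact IsHomLift.of_fac' (glue Δ) (𝟙 _) (a ≫ f.1) rfl rfl
      (e.trans ((Category.id_comp _).trans (Category.comp_id _)).symm)
  exact ⟨⟨P, rfl⟩, ⟨a, isHomLift_of_comp_vertical _ _ a f.1 f.2 haf⟩,
    ⟨b, isHomLift_of_comp_vertical _ _ b g.1 g.2 (h.w ▸ haf)⟩, h⟩

variable [HasPullbacks A]

lemma isPullback_total_of_fiber {P X Y Z : (glue Δ).Fiber I} {a : P ⟶ X} {b : P ⟶ Y} {f : X ⟶ Z}
    {g : Y ⟶ Z} (h : IsPullback a b f g) : IsPullback a.1 b.1 f.1 g.1 := by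
  obtain ⟨P', a', b', h'⟩ := exists_isPullback_fiber f g
  have h'' := isPullback_fiber_of_total _ h'
  exact h'.of_iso (Fiber.fiberInclusion.mapIso (h''.isoIsPullback _ _ h)) (.refl _) (.refl _)
    (.refl _)
    ((Category.comp_id _).trans (congrArg Subtype.val (h''.isoIsPullback_hom_fst _ _ h)).symm)
    ((Category.comp_id _).trans (congrArg Subtype.val (h''.isoIsPullback_hom_snd _ _ h)).symm)
    ((Category.comp_id _).trans (Category.id_comp _).symm)
    ((Category.comp_id _).trans (Category.id_comp _).symm)

variable (Δ I) in
lemma hasFiniteLimits_fiber : HasFiniteLimits ((glue Δ).Fiber I) := by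
  obtain ⟨O, hO⟩ := exists_isTerminal_fiber Δ I
  have := hO.isTerminal.some.hasTerminal
  have {X Y Z : (glue Δ).Fiber I} (f : X ⟶ Z) (g : Y ⟶ Z) : HasPullback f g :=
    (isPullback_fiber_of_total _
      (exists_isPullback_fiber f g).choose_spec.choose_spec.choose_spec).hasPullback
  have := hasPullbacks_of_hasLimit_cospan ((glue Δ).Fiber I)
  exact hasFiniteLimits_of_hasTerminal_and_pullbacks

variable (Δ) in
lemma isLexFibration_glue : IsLexFibration (glue Δ) where
  toIsFibered := isFibered_glue
  hasFiniteLimits I := hasFiniteLimits_fiber Δ I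
  preservesFiniteLimits J I u := by
    have := isFibered_glue (Δ := Δ)
    have := hasFiniteLimits_fiber Δ I
    obtain ⟨O, hO⟩ := exists_isTerminal_fiber Δ I
    refine preservesFiniteLimits_of_isPullback _ hO.isTerminal.some ?_ fun P X Y Z a b f g h => ?_
    · apply IsFibTerminal.isTerminal
      intro T v
      let v' := v ≫ eqToHom ((reindex (glue Δ) u).obj O).2
      obtain ⟨f, hf⟩ := hO.exists_lift rfl O.2 (v' ≫ u)
      obtain ⟨f', hf', -⟩ := exists_factor_lift (glue Δ) u O v' f hf
      refine ⟨f', ?_, fun g hg => ?_⟩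
      · change (glue Δ).map f' = v
        rw [IsHomLift.fac' (glue Δ) v' f']
        simp [v']
      · have hg' : (glue Δ).IsHomLift v' g := by
          change (glue Δ).IsHomLift (v ≫ _) g
          rw [← hg]
          infer_instance
        refine hom_ext_lift (glue Δ) u O v' hg' hf' (hO.ext ?_)
        exact map_eq_of_isHomLift _ (v' ≫ u) inferInstance inferInstance
    · have h₁ := isPullback_total_of_fiber h
      have h₂ := (isPullback_reindex u b).paste_horiz h₁
      rw [← reindex_map_lift, ← reindex_map_lift] at h₂
      refine isPullback_fiber_of_total _ (.of_right h₂ ?_ (isPullback_reindex u f))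
      exact congrArg Subtype.val (((reindex (glue Δ) u).map_comp a f).symm.trans
        ((congrArg _ h.w).trans ((reindex (glue Δ) u).map_comp b g)))

end Fibers

section Pretopos

variable [Regular R] [Regular A] [PreservesFiniteLimits Δ]

/-- The kernel pair of `f` in the gluing has the kernel pair of `f.left` as its component in `A`. -/
lemma isEff_of_left {X Y : Comma (𝟭 A) Δ} (f : X ⟶ Y) [IsRegularEpi f.left] :
    IsEff (glue Δ) f := by
  intro Z g v hv H
  replace hv : g.right = f.right ≫ v := hv
  obtain ⟨P, a, b, h, hl⟩ := exists_isPullback_comma f f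
  have hk : IsKernelPair f.left a.left b.left := hl
  have hd := hk.toCoequalizer (IsRegularEpi.getStruct f.left)
  obtain ⟨l, hl⟩ := Cofork.IsColimit.desc' hd g.left (congrArg CommaMorphism.left (H a b h.w))
  replace hl : f.left ≫ l = g.left := hl
  refine ⟨glueHom l v ?_, ⟨rfl, CommaMorphism.ext hl hv.symm⟩, ?_⟩
  · rw [← cancel_epi f.left, reassoc_of% hl, display_w, hv, Δ.map_comp, ← Category.assoc,
      ← display_w, Category.assoc]
  · rintro k ⟨rfl, rfl⟩
    refine CommaMorphism.ext ?_ rfl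
    rw [← cancel_epi f.left]
    exact hl.symm

/-- Maps of the gluing with regular epimorphic component in `A` are surjections. -/
lemma isSurj_of_left {X Y : Comma (𝟭 A) Δ} (f : X ⟶ Y) (hf : IsRegularEpi f.left) :
    IsSurj (glue Δ) f := by
  intro P T a f' b h
  have : IsRegularEpi f'.left :=
    Regular.regularEpiIsStableUnderBaseChange.of_isPullback (isPullback_left h) hf
  exact isEff_of_left f'

/-- The component in `A` of a surjection of the gluing is a regular epimorphism. -/
lemma isRegularEpi_left {X Y : Comma (𝟭 A) Δ} (f : X ⟶ Y) (hf : IsSurj (glue Δ) f) :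
    IsRegularEpi f.left := by
  have := hasPullbacks_comma Δ
  let F := Regular.strongEpiMonoFactorisation f.left
  have hm : Mono F.m := F.m_mono
  let M : Comma (𝟭 A) Δ := ⟨F.I, Y.right, F.m ≫ display Y⟩
  let e : X ⟶ M := glueHom F.e f.right ((Category.assoc _ _ _).symm.trans
    ((congrArg (· ≫ display Y) F.fac).trans (display_w f)))
  let m : M ⟶ Y := glueHom F.m (𝟙 _) (by rw [Δ.map_id, Category.comp_id])
  -- `m` is a monomorphism and, as the second factor of a surjection, relatively effective
  have hem : e ≫ m = f := CommaMorphism.ext F.fac (Category.comp_id _)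
  rw [← hem] at hf
  have : IsIso ((glue Δ).map m) := inferInstanceAs (IsIso (𝟙 Y.right))
  have : IsIso m := (IsEff.of_comp hf).isIso fun T a b hab => CommaMorphism.ext
    ((cancel_mono F.m).1 (congrArg CommaMorphism.left hab))
    ((Category.comp_id _).symm.trans ((congrArg CommaMorphism.right hab).trans (Category.comp_id _)))
  have : IsIso F.m := inferInstanceAs (IsIso ((Comma.fst (𝟭 A) Δ).map m))
  have he : IsRegularEpi F.e := inferInstanceAs
    (IsRegularEpi (Regular.strongEpiMonoFactorisation f.left).e)
  exact Regular.regularEpiIsStableUnderBaseChange.of_isPullback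
    (IsPullback.of_horiz_isIso (fst := 𝟙 _) (snd := f.left) (f := F.e) (g := inv F.m)
      ⟨by rw [Category.id_comp, IsIso.eq_comp_inv, F.fac]⟩) he

lemma hasExtensiveSums_glue : HasExtensiveSums (glue Δ) where
  exists_cocart X I u := by
    obtain ⟨d, s, hl, rfl⟩ := exists_isCocart_glue X u
    have : IsIso s.left := by rw [hl]; infer_instance
    exact ⟨_, s, isCocart_of_isIso_left s⟩
  beckChevalley P X Y Z g' s' s g h hs _ := by
    have := isIso_left_of_isCocart s hs
    have : IsIso s'.left := (isPullback_left h).isIso_snd_of_isIso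
    exact isCocart_of_isIso_left s'
  stable P X Y Z g' s' s g h hs := by
    have := isIso_left_of_isCocart s hs
    have : IsIso s'.left := (isPullback_left h).isIso_snd_of_isIso
    exact isCocart_of_isIso_left s'
  disjoint P X Y q₀ q₁ s d h hs h₀ _ := by
    have := isIso_left_of_isCocart s hs
    have : IsIso q₀.left := (isPullback_left h).isIso_fst_of_isIso
    have e := congrArg CommaMorphism.left h₀
    have : IsIso (d.left ≫ q₀.left) := by
      rw [← comma_left_comp, e]
      exact inferInstanceAs (IsIso (𝟙 X.left))
    have := IsIso.of_isIso_comp_right d.left q₀.left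
    exact isCocart_of_isIso_left d

lemma isPreStack_glue (hΔ : ∀ ⦃J I : R⦄ (u : J ⟶ I), IsRegularEpi u → IsRegularEpi (Δ.map u)) :
    haveI := isLexFibration_glue Δ
    IsPreStack (glue Δ) := by
  have := isLexFibration_glue Δ
  refine isPreStack_of_isEff fun X Y f hf => ?_
  obtain ⟨l, d, f', hf', h⟩ := exists_isPullback_display Y f.right
  obtain ⟨k, ⟨-, hk⟩, -⟩ := (isCart_iff (glue Δ)).1 hf.1 f' (𝟙 _)
    (hf'.trans (Category.id_comp _).symm)
  -- the component of a cover is, up to an isomorphism, a pullback of the image under `Δ` of a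
  -- regular epimorphism
  have h₁ : IsRegularEpi f'.left := Regular.regularEpiIsStableUnderBaseChange.of_isPullback h.flip
    (hΔ _ (by rw [hf']; exact hf.2))
  have h₂ : StrongEpi (k.left ≫ f.left) := by
    rw [← comma_left_comp, hk]
    infer_instance
  have h₃ : StrongEpi f.left := strongEpi_of_strongEpi k.left f.left
  exact isEff_of_left f

/-- An equivalence relation in a fiber of the gluing is one in `A`. -/
lemma isEquivalenceRelation_left {I : R} {K X : (glue Δ).Fiber I} (r₁ r₂ : K ⟶ X)
    (h : IsEquivalenceRelation r₁ r₂) : IsEquivalenceRelation r₁.1.left r₂.1.left := by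
  obtain ⟨⟨h⟩⟩ := h
  have hc := isPullback_left (isPullback_total_of_fiber (IsPullback.of_isLimit h.isLimit))
  have := isIso_right_of_vertical r₁.2
  refine ⟨⟨{
    right_cancellation := fun T f g h₁ h₂ => ?_
    r := h.r.1.left
    reflexivity₁ := congrArg (fun k => k.1.left) h.reflexivity₁
    reflexivity₂ := congrArg (fun k => k.1.left) h.reflexivity₂
    s := h.s.1.left
    symmetry₁ := congrArg (fun k => k.1.left) h.symmetry₁
    symmetry₂ := congrArg (fun k => k.1.left) h.symmetry₂
    c := hc.cone
    isLimit := hc.isLimit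
    t := h.t.1.left
    transitivity₁ := congrArg (fun k => k.1.left) h.transitivity₁
    transitivity₂ := congrArg (fun k => k.1.left) h.transitivity₂ }⟩⟩
  have e : f ≫ display K.1 = g ≫ display K.1 := by
    have e' := h₁ =≫ display X.1
    rw [Category.assoc, Category.assoc, display_w] at e'
    simp only [← Category.assoc] at e'
    exact (cancel_mono _).1 e'
  let T' : (glue Δ).Fiber I := ⟨⟨T, K.1.right, f ≫ display K.1⟩, K.2⟩
  have hl {k : T'.1 ⟶ K.1} (hk : k.right = 𝟙 _) : (glue Δ).IsHomLift (𝟙 I) k :=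
    IsHomLift.of_fac' (glue Δ) (𝟙 I) k K.2 K.2 (hk.trans (by simp; rfl))
  let f' : T' ⟶ K := ⟨glueHom f (𝟙 _) (by rw [Δ.map_id]; exact (Category.comp_id _).symm), hl rfl⟩
  let g' : T' ⟶ K := ⟨glueHom g (𝟙 _) (by
    rw [Δ.map_id]
    exact e.symm.trans (Category.comp_id _).symm), hl rfl⟩
  have : f' = g' := h.right_cancellation f' g' (Subtype.ext (CommaMorphism.ext h₁ rfl))
    (Subtype.ext (CommaMorphism.ext h₂ rfl))
  exact congrArg (fun k => k.1.left) this

variable (Δ) in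
/-- The fibers of the gluing are exact; their regular epimorphisms are those of `A`. -/
lemma isExact_fiber (hA : IsExact A) (I : R) : IsExact ((glue Δ).Fiber I) ∧
    ∀ ⦃X Y : (glue Δ).Fiber I⦄ (f : X ⟶ Y), IsRegularEpi f → IsRegularEpi f.1.left := by
  have := isLexFibration_glue Δ
  have hmem {X : (glue Δ).Fiber I} {Q : A} (d : Q ⟶ Δ.obj X.1.right) {k : X.1 ⟶ ⟨Q, X.1.right, d⟩}
      (hk : k.right = 𝟙 _) : (glue Δ).IsHomLift (𝟙 I) k :=
    IsHomLift.of_fac' (glue Δ) (𝟙 I) k X.2 X.2 (hk.trans (by simp; rfl))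
  have hmem' {X : (glue Δ).Fiber I} {Q : A} (d : Q ⟶ Δ.obj X.1.right)
      {k : (⟨Q, X.1.right, d⟩ : Comma (𝟭 A) Δ) ⟶ X.1} (hk : k.right = 𝟙 _) :
      (glue Δ).IsHomLift (𝟙 I) k :=
    IsHomLift.of_fac' (glue Δ) (𝟙 I) k X.2 X.2 (hk.trans (by simp; rfl))
  refine isExact_of_factorization
    (fun X Y f => IsRegularEpi ((Fiber.fiberInclusion ⋙ Comma.fst (𝟭 A) Δ).map f)) ?_ ?_ ?_ ?_
  · intro X Y f hf
    have : IsRegularEpi f.1.left := hf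
    exact regularEpi_of_isEff f (isEff_of_left f.1)
  · intro P X Y Z a b f g h hf
    exact Regular.regularEpiIsStableUnderBaseChange.of_isPullback
      (isPullback_left (isPullback_total_of_fiber h)) hf
  · intro X Y f
    let F := Regular.strongEpiMonoFactorisation f.1.left
    have hm : Mono F.m := F.m_mono
    let M : (glue Δ).Fiber I := ⟨⟨F.I, Y.1.right, F.m ≫ display Y.1⟩, Y.2⟩
    let m₀ : M.1 ⟶ Y.1 := glueHom F.m (𝟙 _) (by rw [Δ.map_id, Category.comp_id])
    let m : M ⟶ Y := ⟨m₀, hmem' _ rfl⟩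
    let e₀ : X.1 ⟶ M.1 := glueHom F.e f.1.right ((Category.assoc _ _ _).symm.trans
      ((congrArg (· ≫ display Y.1) F.fac).trans (display_w f.1)))
    have hem : e₀ ≫ m₀ = f.1 := CommaMorphism.ext F.fac (Category.comp_id _)
    have hfl := f.2
    refine ⟨M, ⟨e₀, isHomLift_of_comp_vertical _ _ e₀ m₀ m.2 (hem ▸ hfl)⟩, m,
      inferInstanceAs (IsRegularEpi (Regular.strongEpiMonoFactorisation f.1.left).e), ⟨?_⟩,
      Subtype.ext hem⟩
    intro T k l h
    refine Subtype.ext (CommaMorphism.ext ((cancel_mono F.m).1 ?_) ?_)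
    · exact congrArg (fun k => k.1.left) h
    · exact map_eq_of_isHomLift (glue Δ) (𝟙 I) k.2 l.2
  · intro K X r₁ r₂ h
    -- the quotient in `A` lies over `Δ I` because the displayed map coequalizes the relation
    obtain ⟨Q₀, q₀, hq₀⟩ := hA.effective _ _ (isEquivalenceRelation_left r₁ r₂ h)
    let F := Regular.strongEpiMonoFactorisation q₀
    have hm : Mono F.m := F.m_mono
    have hq : IsKernelPair (F.e ≫ F.m) r₁.1.left r₂.1.left := by
      rw [F.fac]
      exact hq₀
    have hq : IsKernelPair F.e r₁.1.left r₂.1.left := hq.cancel_right_of_mono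
    have he : IsRegularEpi F.e := inferInstanceAs
      (IsRegularEpi (Regular.strongEpiMonoFactorisation q₀).e)
    have hr : r₁.1.right = r₂.1.right := map_eq_of_isHomLift (glue Δ) (𝟙 I) r₁.2 r₂.2
    obtain ⟨d, hd⟩ := Cofork.IsColimit.desc' (hq.toCoequalizer (IsRegularEpi.getStruct F.e))
      (display X.1) (by rw [display_w, display_w, hr])
    replace hd : F.e ≫ d = display X.1 := hd
    let Q : (glue Δ).Fiber I := ⟨⟨F.I, X.1.right, d⟩, X.2⟩
    let q : X ⟶ Q := ⟨glueHom F.e (𝟙 _) (by rw [Δ.map_id, Category.comp_id, hd]), hmem _ rfl⟩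
    have h₁ := isIso_right_of_vertical r₁.2
    have h₂ := isIso_right_of_vertical r₂.2
    have hp : IsPullback r₁.1.right r₂.1.right (𝟙 X.1.right) (𝟙 X.1.right) :=
      .of_horiz_isIso ⟨by rw [hr]⟩
    exact ⟨Q, q, isPullback_fiber_of_total _ (isPullback_comma hq hp (hp.map Δ))⟩

/-- Gluing an exact category along a functor on `R` preserving finite limits and regular
epimorphisms yields a fibered pretopos. -/
theorem isFiberedPretopos_glue (hA : IsExact A)
    (hΔ : ∀ ⦃J I : R⦄ (u : J ⟶ I), IsRegularEpi u → IsRegularEpi (Δ.map u)) :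
    IsFiberedPretopos (glue Δ) where
  toIsFibered := isFibered_glue
  isPreStack := isPreStack_glue hΔ
  isExact I := (isExact_fiber Δ hA I).1
  isRegularFunctor J I u := by
    have := isLexFibration_glue Δ
    refine ⟨IsLexFibration.preservesFiniteLimits u, fun X Y q hq => ?_⟩
    have h₁ := (isExact_fiber Δ hA I).2 q hq
    have h₂ : IsRegularEpi ((reindex (glue Δ) u).map q).1.left :=
      Regular.regularEpiIsStableUnderBaseChange.of_isPullback
        (isPullback_left (isPullback_reindex u q)) h₁
    exact regularEpi_of_isEff _ (isEff_of_left _)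
  hasExtensiveSums := hasExtensiveSums_glue

end Pretopos

end Gluing

/-! ### Generalized elements of total equivalence relations -/

section Relations

variable {R : Type u₁} [Category.{v₁} R] {E : Type u₂} [Category.{v₂} E] {p : E ⥤ R}

namespace SieveRel

/-- The converse of a relation. -/
abbrev converse {X Y : E} (ρ : SieveRel X Y) : SieveRel Y X := ⟨ρ.pt, ρ.snd, ρ.fst⟩

lemma holds_converse_iff {X Y : E} {ρ : SieveRel X Y} {T : E} (x : T ⟶ X) (y : T ⟶ Y) :
    ρ.converse.Holds p y x ↔ ρ.Holds p x y :=
  ⟨fun ⟨T', e, k, h₁, h₂, h₃⟩ => ⟨T', e, k, h₁, h₃, h₂⟩,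
    fun ⟨T', e, k, h₁, h₂, h₃⟩ => ⟨T', e, k, h₁, h₃, h₂⟩⟩

/-- Substitution in a relation is pullback. -/
lemma exists_substitution [Regular R] [p.IsFibered] [HasPullbacks E] {X Y X' Y' : E}
    (ρ : SieveRel X Y) (α : X' ⟶ X) (β : Y' ⟶ Y) : ∃ τ : SieveRel X' Y',
      ∀ {T : E} (x : T ⟶ X') (y : T ⟶ Y'), τ.Holds p x y ↔ ρ.Holds p (x ≫ α) (y ≫ β) := by
  obtain ⟨P, a, b, hP⟩ : ∃ (P : E) (a : P ⟶ ρ.pt) (b : P ⟶ X'), IsPullback a b ρ.fst α :=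
    ⟨_, _, _, .of_hasPullback _ _⟩
  obtain ⟨Q, c, d, hQ⟩ : ∃ (Q : E) (c : Q ⟶ P) (d : Q ⟶ Y'), IsPullback c d (a ≫ ρ.snd) β :=
    ⟨_, _, _, .of_hasPullback _ _⟩
  refine ⟨⟨Q, c ≫ b, d⟩, fun x y => ⟨?_, ?_⟩⟩
  · rintro ⟨T', e, k, he, h₁, h₂⟩
    replace h₁ : k ≫ c ≫ b = e ≫ x := h₁
    replace h₂ : k ≫ d = e ≫ y := h₂
    refine ⟨T', e, k ≫ c ≫ a, he, ?_, ?_⟩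
    · rw [← reassoc_of% h₁, Category.assoc, Category.assoc, hP.w]
    · rw [← reassoc_of% h₂, Category.assoc, Category.assoc, hQ.w]
  · rintro ⟨T', e, k, he, h₁, h₂⟩
    refine ⟨T', e, hQ.lift (hP.lift k (e ≫ x) (h₁.trans (Category.assoc _ _ _).symm)) (e ≫ y) ?_,
      he, ?_, hQ.lift_snd _ _ _⟩
    · rw [hP.lift_fst_assoc, h₂, Category.assoc]
    · exact (hQ.lift_fst_assoc _ _ _ _).trans (hP.lift_snd _ _ _)

lemma prod_lift_eq_iff [HasFiniteLimits E] {T X Y : E} {x x' : T ⟶ X} {y y' : T ⟶ Y} :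
    prod.lift x y = prod.lift x' y' ↔ x = x' ∧ y = y' := by
  refine ⟨fun h => ⟨?_, ?_⟩, fun ⟨h₁, h₂⟩ => h₁ ▸ h₂ ▸ rfl⟩
  · exact (prod.lift_fst x y).symm.trans ((congrArg (· ≫ prod.fst) h).trans (prod.lift_fst x' y'))
  · exact (prod.lift_snd x y).symm.trans ((congrArg (· ≫ prod.snd) h).trans (prod.lift_snd x' y'))

/-- Conjunction of relations is pullback over the product. -/
lemma exists_inter [Regular R] [p.IsFibered] [HasFiniteLimits E] {X Y : E} (ρ σ : SieveRel X Y) :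
    ∃ τ : SieveRel X Y, ∀ {T : E} (x : T ⟶ X) (y : T ⟶ Y),
      τ.Holds p x y ↔ ρ.Holds p x y ∧ σ.Holds p x y := by
  obtain ⟨P, a, b, hP⟩ : ∃ (P : E) (a : P ⟶ ρ.pt) (b : P ⟶ σ.pt),
    IsPullback a b (prod.lift ρ.fst ρ.snd) (prod.lift σ.fst σ.snd) := ⟨_, _, _, .of_hasPullback _ _⟩
  obtain ⟨hw₁, hw₂⟩ := prod_lift_eq_iff.1
    ((prod.comp_lift a _ _).symm.trans (hP.w.trans (prod.comp_lift b _ _)))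
  refine ⟨⟨P, a ≫ ρ.fst, a ≫ ρ.snd⟩, fun x y => ⟨?_, ?_⟩⟩
  · rintro ⟨T', e, k, he, h₁, h₂⟩
    replace h₁ : k ≫ a ≫ ρ.fst = e ≫ x := h₁
    replace h₂ : k ≫ a ≫ ρ.snd = e ≫ y := h₂
    exact ⟨⟨T', e, k ≫ a, he, (Category.assoc _ _ _).trans h₁, (Category.assoc _ _ _).trans h₂⟩,
      ⟨T', e, k ≫ b, he, by rw [← h₁, hw₁, Category.assoc], by rw [← h₂, hw₂, Category.assoc]⟩⟩
  · rintro ⟨⟨T₁, e₁, k₁, he₁, h₁, h₂⟩, hσ⟩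
    refine .of_cover he₁ ?_
    obtain ⟨T₂, e₂, k₂, he₂, h₃, h₄⟩ := hσ.precomp e₁
    refine ⟨T₂, e₂, hP.lift (e₂ ≫ k₁) k₂ ?_, he₂, ?_, ?_⟩
    · refine (prod.comp_lift _ _ _).trans ((prod_lift_eq_iff.2 ⟨?_, ?_⟩).trans
        (prod.comp_lift _ _ _).symm)
      · rw [Category.assoc, h₁, h₃]
      · rw [Category.assoc, h₂, h₄]
    · exact (hP.lift_fst_assoc _ _ _ _).trans ((Category.assoc _ _ _).trans (by rw [h₁]))
    · exact (hP.lift_fst_assoc _ _ _ _).trans ((Category.assoc _ _ _).trans (by rw [h₂]))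

end SieveRel

lemma holds_of_eq {A : EqvObj p} {T : E} {x y : T ⟶ A.carrier} (h : x = y) : A.rel.Holds p x y :=
  h ▸ A.refl x

end Relations

section Elements

variable {R : Type u₁} [Category.{v₁} R] {E : Type u₂} [Category.{v₂} E] {p : E ⥤ R}
  [Regular R] [IsLexFibration p]

/-- `Ev f x y`: the judgment `⊢ f(x) = y` for generalized elements `x` and `y`. -/
def Ev {A B : EqvObj p} (f : A ⟶ B) {T : E} (x : T ⟶ A.carrier) (y : T ⟶ B.carrier) : Prop :=
  Quotient.liftOn f (fun φ => φ.toRel.Holds p x y)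
    fun _ _ h => propext (FunRel.holds_iff_of_equiv h x y)

variable {A B C : EqvObj p} {T T' : E}

lemma exists_rel (f : A ⟶ B) : ∃ φ : FunRel A B, f = ⟦φ⟧ ∧
    ∀ {T : E} (x : T ⟶ A.carrier) (y : T ⟶ B.carrier), Ev f x y ↔ φ.toRel.Holds p x y := by
  obtain ⟨φ⟩ := f
  exact ⟨φ, rfl, fun _ _ => Iff.rfl⟩

lemma Ev.of_cover {f : A ⟶ B} {e : T' ⟶ T} (he : IsCover p e) {x : T ⟶ A.carrier}
    {y : T ⟶ B.carrier} (h : Ev f (e ≫ x) (e ≫ y)) : Ev f x y := by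
  obtain ⟨φ, -, hφ⟩ := exists_rel f
  rw [hφ] at h ⊢
  exact .of_cover he h

lemma Ev.precomp {f : A ⟶ B} {x : T ⟶ A.carrier} {y : T ⟶ B.carrier} (h : Ev f x y) (t : T' ⟶ T) :
    Ev f (t ≫ x) (t ≫ y) := by
  obtain ⟨φ, -, hφ⟩ := exists_rel f
  rw [hφ] at h ⊢
  exact h.precomp t

lemma Ev.congr {f : A ⟶ B} {x x' : T ⟶ A.carrier} {y y' : T ⟶ B.carrier} (h : Ev f x y)
    (hx : A.rel.Holds p x x') (hy : B.rel.Holds p y y') : Ev f x' y' := by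
  obtain ⟨φ, -, hφ⟩ := exists_rel f
  rw [hφ] at h ⊢
  exact φ.cong _ _ _ _ h hx hy

lemma Ev.unique {f : A ⟶ B} {x : T ⟶ A.carrier} {y y' : T ⟶ B.carrier} (h : Ev f x y)
    (h' : Ev f x y') : B.rel.Holds p y y' := by
  obtain ⟨φ, -, hφ⟩ := exists_rel f
  rw [hφ] at h h'
  exact φ.singval _ _ _ h h'

lemma exists_ev (f : A ⟶ B) (x : T ⟶ A.carrier) :
    ∃ (T' : E) (e : T' ⟶ T) (y : T' ⟶ B.carrier), IsCover p e ∧ Ev f (e ≫ x) y := by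
  obtain ⟨φ, -, hφ⟩ := exists_rel f
  obtain ⟨T', e, y, he, h⟩ := φ.exists_holds x
  exact ⟨T', e, y, he, (hφ _ _).2 h⟩

lemma ev_comp_iff {f : A ⟶ B} {g : B ⟶ C} {x : T ⟶ A.carrier} {z : T ⟶ C.carrier} :
    Ev (f ≫ g) x z ↔ ∃ (T' : E) (e : T' ⟶ T) (y : T' ⟶ B.carrier), IsCover p e ∧
      Ev f (e ≫ x) y ∧ Ev g y (e ≫ z) := by
  obtain ⟨φ⟩ := f
  obtain ⟨ψ⟩ := g
  exact FunRel.holds_comp_iff φ ψ x z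

lemma Ev.comp {f : A ⟶ B} {g : B ⟶ C} {x : T ⟶ A.carrier} {y : T ⟶ B.carrier} {z : T ⟶ C.carrier}
    (hf : Ev f x y) (hg : Ev g y z) : Ev (f ≫ g) x z :=
  ev_comp_iff.2 ⟨T, 𝟙 T, y, IsCover.id p T, by simpa using hf, by simpa using hg⟩

lemma ev_id_iff {x y : T ⟶ A.carrier} : Ev (𝟙 A) x y ↔ A.rel.Holds p x y := Iff.rfl

/-- An implication between the judgments suffices, because functional relations are total and
single-valued. -/
lemma hom_ext_of_ev {f g : A ⟶ B}
    (h : ∀ {T : E} (x : T ⟶ A.carrier) (y : T ⟶ B.carrier), Ev f x y → Ev g x y) : f = g := by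
  have h' : ∀ {T : E} (x : T ⟶ A.carrier) (y : T ⟶ B.carrier), Ev g x y → Ev f x y := by
    intro T x y hy
    obtain ⟨T', e, y', he, hy'⟩ := exists_ev f x
    exact .of_cover he (hy'.congr (A.refl _) ((h _ _ hy').unique (hy.precomp e)))
  obtain ⟨φ, rfl, hφ⟩ := exists_rel f
  obtain ⟨ψ, rfl, hψ⟩ := exists_rel g
  exact Quotient.sound (FunRel.equiv_of_holds_iff fun x y =>
    ⟨fun hxy => (hψ x y).1 (h x y ((hφ x y).2 hxy)), fun hxy => (hφ x y).1 (h' x y ((hψ x y).2 hxy))⟩)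

/-- Functional relations define morphisms; totality is stated for generalized elements. -/
lemma exists_hom_of_rel (ρ : SieveRel A.carrier B.carrier)
    (hc : ∀ {T : E} (x x' : T ⟶ A.carrier) (y y' : T ⟶ B.carrier), ρ.Holds p x y →
      A.rel.Holds p x x' → B.rel.Holds p y y' → ρ.Holds p x' y')
    (hs : ∀ {T : E} (x : T ⟶ A.carrier) (y y' : T ⟶ B.carrier), ρ.Holds p x y →
      ρ.Holds p x y' → B.rel.Holds p y y')
    (ht : ∀ {T : E} (x : T ⟶ A.carrier), ∃ (T' : E) (e : T' ⟶ T) (y : T' ⟶ B.carrier),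
      IsCover p e ∧ ρ.Holds p (e ≫ x) y) :
    ∃ f : A ⟶ B, ∀ {T : E} (x : T ⟶ A.carrier) (y : T ⟶ B.carrier), Ev f x y ↔ ρ.Holds p x y := by
  -- totality for the generic element is the totality of the relation
  obtain ⟨T', e, y, he, h⟩ := ht (𝟙 A.carrier)
  exact ⟨⟦⟨ρ, hc, hs, FunRel.tot_of_exists_holds _ ⟨T', e, y, he, by simpa using h⟩⟩⟧,
    fun _ _ => Iff.rfl⟩

/-- A morphism of the carriers which respects the equivalence relations defines a morphism. -/
lemma exists_hom_of_map (α : A.carrier ⟶ B.carrier)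
    (h : ∀ {T : E} (x x' : T ⟶ A.carrier), A.rel.Holds p x x' →
      B.rel.Holds p (x ≫ α) (x' ≫ α)) :
    ∃ f : A ⟶ B, ∀ {T : E} (x : T ⟶ A.carrier) (y : T ⟶ B.carrier),
      Ev f x y ↔ B.rel.Holds p (x ≫ α) y := by
  have := hasPullbacks_total p
  obtain ⟨τ, hτ⟩ := B.rel.exists_substitution (p := p) α (𝟙 _)
  simp only [Category.comp_id] at hτ
  obtain ⟨f, hf⟩ := exists_hom_of_rel (A := A) (B := B) τ
    (fun x x' y y' h₁ h₂ h₃ => by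
      rw [hτ] at h₁ ⊢
      exact B.trans _ _ _ (B.symm _ _ (h _ _ h₂)) (B.trans _ _ _ h₁ h₃))
    (fun x y y' h₁ h₂ => by
      rw [hτ] at h₁ h₂
      exact B.trans _ _ _ (B.symm _ _ h₁) h₂)
    (fun {T} x => ⟨T, 𝟙 T, x ≫ α, IsCover.id p T, by
      rw [hτ, Category.id_comp]
      exact B.refl _⟩)
  exact ⟨f, fun x y => (hf x y).trans (hτ x y)⟩

lemma holds_discrete_iff {X : E} {x y : T ⟶ X} : ((discrete p).obj X).rel.Holds p x y ↔
    ∃ (T' : E) (e : T' ⟶ T), IsCover p e ∧ e ≫ x = e ≫ y := by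
  refine (SieveRel.holds_graph_iff x y).trans ?_
  simp only [Category.comp_id]

lemma ev_discrete {X Y : E} (f : X ⟶ Y) (x : T ⟶ X) : Ev ((discrete p).map f) x (x ≫ f) :=
  SieveRel.holds_graph x

lemma exists_elt (x : T ⟶ A.carrier) : ∃ f : (discrete p).obj T ⟶ A,
    ∀ {S : E} (t : S ⟶ T) (y : S ⟶ A.carrier), Ev f t y ↔ A.rel.Holds p (t ≫ x) y := by
  refine exists_hom_of_map (A := (discrete p).obj T) x fun t t' h => ?_
  obtain ⟨S, e, he, h⟩ := holds_discrete_iff.1 h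
  exact .of_cover he (holds_of_eq ((Category.assoc _ _ _).symm.trans
    ((congrArg (· ≫ x) h).trans (Category.assoc _ _ _))))

/-- The morphism from a discrete object that is named by a generalized element. -/
noncomputable def elt (x : T ⟶ A.carrier) : (discrete p).obj T ⟶ A := (exists_elt x).choose

lemma ev_elt_iff {x : T ⟶ A.carrier} {S : E} {t : S ⟶ T} {y : S ⟶ A.carrier} :
    Ev (elt x) t y ↔ A.rel.Holds p (t ≫ x) y :=
  (exists_elt x).choose_spec t y

lemma ev_elt (x : T ⟶ A.carrier) : Ev (elt x) (𝟙 T) x :=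
  ev_elt_iff.2 (holds_of_eq (Category.id_comp x))

lemma eq_elt {f : (discrete p).obj T ⟶ A} {x : T ⟶ A.carrier} (h : Ev f (𝟙 T) x) : f = elt x := by
  refine (hom_ext_of_ev fun t y hy => ?_).symm
  exact (h.precomp t).congr (holds_of_eq (Category.comp_id t)) (ev_elt_iff.1 hy)

/-- The judgment `⊢ f(x) = y` is an equation between morphisms out of a discrete object. -/
lemma elt_comp_eq_iff {f : A ⟶ B} {x : T ⟶ A.carrier} {y : T ⟶ B.carrier} :
    elt x ≫ f = elt y ↔ Ev f x y := by
  constructor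
  · intro h
    have h₁ : Ev (elt x ≫ f) (𝟙 T) y := h ▸ ev_elt y
    obtain ⟨S, e, x', he, h₂, h₃⟩ := ev_comp_iff.1 h₁
    have h₄ := ev_elt_iff.1 h₂
    exact .of_cover he (h₃.congr (A.trans _ _ _ (A.symm _ _ h₄)
      (holds_of_eq (congrArg (· ≫ x) (Category.comp_id e)))) (B.refl _))
  · exact fun h => eq_elt ((ev_elt x).comp h)

lemma elt_eq_iff {x y : T ⟶ A.carrier} : elt x = elt y ↔ A.rel.Holds p x y := by
  rw [← ev_id_iff, ← elt_comp_eq_iff, Category.comp_id]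

lemma map_comp_elt (e : T' ⟶ T) (x : T ⟶ A.carrier) :
    (discrete p).map e ≫ elt x = elt (e ≫ x) := by
  exact eq_elt ((ev_discrete e (𝟙 T')).comp (ev_elt_iff.2
    (holds_of_eq (congrArg (· ≫ x) (Category.id_comp e)))))

/-- Every morphism from a discrete object is locally named by a generalized element. -/
lemma exists_map_comp_eq_elt (f : (discrete p).obj T ⟶ A) :
    ∃ (T' : E) (e : T' ⟶ T) (x : T' ⟶ A.carrier), IsCover p e ∧ (discrete p).map e ≫ f = elt x := by
  obtain ⟨T', e, x, he, h⟩ := exists_ev f (𝟙 T)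
  exact ⟨T', e, x, he, eq_elt (Ev.comp (ev_discrete e (𝟙 T'))
    (h.congr (holds_of_eq ((Category.comp_id e).trans (Category.id_comp e).symm)) (A.refl x)))⟩

end Elements

/-! ### Exactness of the category of total equivalence relations -/

section Exact

variable {R : Type u₁} [Category.{v₁} R] {E : Type u₂} [Category.{v₂} E] {p : E ⥤ R}
  [Regular R] [IsLexFibration p]

variable {A B C : EqvObj p} {T T' : E}

lemma exists_elt_comp_eq_elt (f : A ⟶ B) (x : T ⟶ A.carrier) :
    ∃ (T' : E) (e : T' ⟶ T) (y : T' ⟶ B.carrier), IsCover p e ∧ elt (e ≫ x) ≫ f = elt y := by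
  obtain ⟨T', e, y, he, h⟩ := exists_ev f x
  exact ⟨T', e, y, he, elt_comp_eq_iff.2 h⟩

lemma elt_comp_eq_precomp {f : A ⟶ B} {x : T ⟶ A.carrier} {y : T ⟶ B.carrier}
    (h : elt x ≫ f = elt y) (e : T' ⟶ T) : elt (e ≫ x) ≫ f = elt (e ≫ y) := by
  rw [← map_comp_elt, ← map_comp_elt, Category.assoc, h]

/-- `f` is locally surjective on generalized elements: `⊢ ∃ x. f(x) = y`. -/
def IsLocSurj (f : A ⟶ B) : Prop :=
  ∀ ⦃T : E⦄ (y : T ⟶ B.carrier), ∃ (T' : E) (e : T' ⟶ T) (x : T' ⟶ A.carrier),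
    IsCover p e ∧ elt x ≫ f = elt (e ≫ y)

lemma IsLocSurj.hom_ext {f : A ⟶ B} (hf : IsLocSurj f) {u v : B ⟶ C} (h : f ≫ u = f ≫ v) :
    u = v := by
  refine hom_ext_of_ev fun y z hyz => ?_
  obtain ⟨T', e, x, he, hx⟩ := hf y
  refine .of_cover he (elt_comp_eq_iff.1 ?_)
  rw [← elt_comp_eq_precomp (elt_comp_eq_iff.2 hyz) e, ← hx, Category.assoc, Category.assoc, h]

lemma elt_discrete {X : E} (x : T ⟶ X) : elt (A := (discrete p).obj X) x = (discrete p).map x :=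
  (eq_elt ((ev_discrete x (𝟙 T)).congr (holds_of_eq rfl) (holds_of_eq (Category.id_comp x)))).symm

lemma IsCover.isLocSurj {e : T' ⟶ T} (he : IsCover p e) : IsLocSurj ((discrete p).map e) := by
  intro S y
  obtain ⟨S', e', y', he', h⟩ := he.exists_pullback p y
  refine ⟨S', e', y', he', (congrArg (· ≫ _) (elt_discrete y')).trans (Eq.trans ?_
    (elt_discrete _).symm)⟩
  exact ((discrete p).map_comp _ _).symm.trans (congrArg _ h)

lemma IsLocSurj.exists_lift {f : A ⟶ B} (hf : IsLocSurj f) (y : (discrete p).obj T ⟶ B) :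
    ∃ (T' : E) (e : T' ⟶ T) (x : T' ⟶ A.carrier),
      IsCover p e ∧ elt x ≫ f = (discrete p).map e ≫ y := by
  obtain ⟨T₁, e₁, z, he₁, h₁⟩ := exists_map_comp_eq_elt y
  obtain ⟨T₂, e₂, x, he₂, h₂⟩ := hf z
  exact ⟨T₂, e₂ ≫ e₁, x, he₂.comp p he₁, by
    rw [h₂, Functor.map_comp, Category.assoc, h₁, map_comp_elt]⟩

/-- Morphisms are equal if they locally agree on generalized elements. -/
lemma hom_ext_locally {f g : A ⟶ B} (h : ∀ {T : E} (x : T ⟶ A.carrier),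
    ∃ (T' : E) (e : T' ⟶ T), IsCover p e ∧ elt (e ≫ x) ≫ f = elt (e ≫ x) ≫ g) : f = g := by
  refine hom_ext_of_ev fun x y hxy => ?_
  obtain ⟨T', e, he, h⟩ := h x
  refine .of_cover he (elt_comp_eq_iff.1 (h.symm.trans (elt_comp_eq_iff.2 (hxy.precomp e))))

/-- The judgment `⊢ f(x) = g(y)` is given by a relation. -/
lemma exists_rel_cospan (f : A ⟶ C) (g : B ⟶ C) : ∃ τ : SieveRel A.carrier B.carrier,
    ∀ {T : E} (x : T ⟶ A.carrier) (y : T ⟶ B.carrier),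
      τ.Holds p x y ↔ elt x ≫ f = elt y ≫ g := by
  have := hasPullbacks_total p
  obtain ⟨φ, -, hφ⟩ := exists_rel f
  obtain ⟨ψ, -, hψ⟩ := exists_rel g
  refine ⟨φ.toRel.comp ψ.toRel.converse, fun x y => ?_⟩
  simp only [SieveRel.holds_comp_iff, SieveRel.holds_converse_iff, ← hφ, ← hψ, ← elt_comp_eq_iff]
  constructor
  · rintro ⟨T', e, z, he, h₁, h₂⟩
    apply he.isLocSurj.hom_ext
    rw [← Category.assoc, ← Category.assoc, map_comp_elt, map_comp_elt, h₁, h₂]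
  · intro h
    obtain ⟨T', e, z, he, hz⟩ := exists_elt_comp_eq_elt f x
    refine ⟨T', e, z, he, hz, ?_⟩
    rw [← hz, ← map_comp_elt, ← map_comp_elt, Category.assoc, Category.assoc, h]

/-- The judgment `⊢ ∃ z. f(z) = x ∧ g(z) = y` is given by a relation. -/
lemma exists_rel_span (f : C ⟶ A) (g : C ⟶ B) : ∃ τ : SieveRel A.carrier B.carrier,
    ∀ {T : E} (x : T ⟶ A.carrier) (y : T ⟶ B.carrier), τ.Holds p x y ↔
      ∃ (T' : E) (e : T' ⟶ T) (z : T' ⟶ C.carrier), IsCover p e ∧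
        elt z ≫ f = elt (e ≫ x) ∧ elt z ≫ g = elt (e ≫ y) := by
  have := hasPullbacks_total p
  obtain ⟨φ, -, hφ⟩ := exists_rel f
  obtain ⟨ψ, -, hψ⟩ := exists_rel g
  refine ⟨φ.toRel.converse.comp ψ.toRel, fun x y => ?_⟩
  simp only [SieveRel.holds_comp_iff, SieveRel.holds_converse_iff, ← hφ, ← hψ, ← elt_comp_eq_iff]

/-- Functional relations define morphisms; the relation is given by a condition `Φ` on morphisms
from discrete objects. -/
lemma exists_hom_of_elt (Φ : ∀ ⦃T : E⦄, ((discrete p).obj T ⟶ A) → ((discrete p).obj T ⟶ B) → Prop)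
    (hΦ : ∃ τ : SieveRel A.carrier B.carrier, ∀ {T : E} (x : T ⟶ A.carrier) (y : T ⟶ B.carrier),
      τ.Holds p x y ↔ Φ (elt x) (elt y))
    (hs : ∀ ⦃T : E⦄ (x : T ⟶ A.carrier) (y y' : T ⟶ B.carrier),
      Φ (elt x) (elt y) → Φ (elt x) (elt y') → elt y = elt y')
    (ht : ∀ ⦃T : E⦄ (x : T ⟶ A.carrier), ∃ (T' : E) (e : T' ⟶ T) (y : T' ⟶ B.carrier),
      IsCover p e ∧ Φ (elt (e ≫ x)) (elt y)) :
    ∃ f : A ⟶ B, ∀ {T : E} (x : T ⟶ A.carrier) (y : T ⟶ B.carrier),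
      elt x ≫ f = elt y ↔ Φ (elt x) (elt y) := by
  obtain ⟨τ, hτ⟩ := hΦ
  obtain ⟨f, hf⟩ := exists_hom_of_rel τ
    (fun x x' y y' h h₁ h₂ => by
      rw [hτ] at h ⊢
      rwa [← elt_eq_iff.2 h₁, ← elt_eq_iff.2 h₂])
    (fun x y y' h h' => elt_eq_iff.1 (hs x y y' ((hτ _ _).1 h) ((hτ _ _).1 h')))
    (fun x => by
      obtain ⟨T', e, y, he, h⟩ := ht x
      exact ⟨T', e, y, he, (hτ _ _).2 h⟩)
  exact ⟨f, fun x y => elt_comp_eq_iff.trans ((hf x y).trans (hτ x y))⟩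

/-- A square is a pullback if this holds locally on generalized elements. -/
lemma isPullback_of_elt {P : EqvObj p} {a : P ⟶ A} {b : P ⟶ B} {f : A ⟶ C} {g : B ⟶ C}
    (w : a ≫ f = b ≫ g)
    (hi : ∀ ⦃T : E⦄ (t t' : T ⟶ P.carrier), elt t ≫ a = elt t' ≫ a → elt t ≫ b = elt t' ≫ b →
      elt t = elt t')
    (hs : ∀ ⦃T : E⦄ (x : T ⟶ A.carrier) (y : T ⟶ B.carrier), elt x ≫ f = elt y ≫ g →
      ∃ (T' : E) (e : T' ⟶ T) (t : T' ⟶ P.carrier), IsCover p e ∧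
        elt t ≫ a = elt (e ≫ x) ∧ elt t ≫ b = elt (e ≫ y)) :
    IsPullback a b f g := by
  have := hasPullbacks_total p
  have := hasFiniteLimits_total p
  have key : ∀ {S : EqvObj p} (u : S ⟶ A) (v : S ⟶ B), u ≫ f = v ≫ g →
      ∃ h : S ⟶ P, (h ≫ a = u ∧ h ≫ b = v) ∧ ∀ h', h' ≫ a = u → h' ≫ b = v → h' = h := by
    intro S u v huv
    -- the mediating morphism is the relation `u(s) = a(t) ∧ v(s) = b(t)`
    obtain ⟨τ₁, hτ₁⟩ := exists_rel_cospan u a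
    obtain ⟨τ₂, hτ₂⟩ := exists_rel_cospan v b
    obtain ⟨τ, hτ⟩ := SieveRel.exists_inter (p := p) τ₁ τ₂
    obtain ⟨h, hh⟩ := exists_hom_of_elt (A := S) (B := P)
      (fun T s t => s ≫ u = t ≫ a ∧ s ≫ v = t ≫ b)
      ⟨τ, fun x y => by rw [hτ, hτ₁, hτ₂]⟩
      (fun T x y y' h h' => hi y y' (h.1.symm.trans h'.1) (h.2.symm.trans h'.2))
      (fun T s => by
        obtain ⟨T₁, e₁, x, he₁, h₁⟩ := exists_elt_comp_eq_elt u s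
        obtain ⟨T₂, e₂, y, he₂, h₂⟩ := exists_elt_comp_eq_elt v (e₁ ≫ s)
        have h₃ := elt_comp_eq_precomp h₁ e₂
        obtain ⟨T₃, e₃, t, he₃, h₄, h₅⟩ := hs (e₂ ≫ x) y (by
          rw [← h₃, ← h₂, Category.assoc, Category.assoc, huv])
        refine ⟨T₃, e₃ ≫ e₂ ≫ e₁, t, he₃.comp p (he₂.comp p he₁), ?_, ?_⟩
        · rw [h₄, Category.assoc, Category.assoc, elt_comp_eq_precomp h₃]
        · rw [h₅, Category.assoc, Category.assoc, elt_comp_eq_precomp h₂])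
    refine ⟨h, ⟨hom_ext_locally fun s => ?_, hom_ext_locally fun s => ?_⟩, fun h' h₁ h₂ =>
      hom_ext_locally fun s => ?_⟩
    · obtain ⟨T', e, t, he, ht⟩ := exists_elt_comp_eq_elt h s
      exact ⟨T', e, he, by rw [((hh _ _).1 ht).1, reassoc_of% ht]⟩
    · obtain ⟨T', e, t, he, ht⟩ := exists_elt_comp_eq_elt h s
      exact ⟨T', e, he, by rw [((hh _ _).1 ht).2, reassoc_of% ht]⟩
    · obtain ⟨T', e, t, he, ht⟩ := exists_elt_comp_eq_elt h' s
      refine ⟨T', e, he, ht.trans ((hh _ _).2 ⟨?_, ?_⟩).symm⟩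
      · rw [← ht, Category.assoc, h₁]
      · rw [← ht, Category.assoc, h₂]
  exact ⟨⟨w⟩, ⟨PullbackCone.IsLimit.mk w (fun s => (key s.fst s.snd s.condition).choose)
    (fun s => (key s.fst s.snd s.condition).choose_spec.1.1)
    (fun s => (key s.fst s.snd s.condition).choose_spec.1.2)
    (fun s m h₁ h₂ => (key s.fst s.snd s.condition).choose_spec.2 m h₁ h₂)⟩⟩

lemma exists_hom_elt_comp (α : A.carrier ⟶ B.carrier)
    (h : ∀ {T : E} (x x' : T ⟶ A.carrier), A.rel.Holds p x x' →
      B.rel.Holds p (x ≫ α) (x' ≫ α)) :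
    ∃ f : A ⟶ B, ∀ {T : E} (x : T ⟶ A.carrier), elt x ≫ f = elt (x ≫ α) := by
  obtain ⟨f, hf⟩ := exists_hom_of_map α h
  exact ⟨f, fun x => elt_comp_eq_iff.2 ((hf _ _).2 (B.refl _))⟩

/-- The pullback of `f` and `g` is carried by the object of triples `(x, z, y)` with `f(x) = z` and
`g(y) = z`, two of which are equal if their components in `A` and `B` are. -/
lemma exists_isPullback_eqvObj (f : A ⟶ C) (g : B ⟶ C) :
    ∃ (P : EqvObj p) (a : P ⟶ A) (b : P ⟶ B), IsPullback a b f g := by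
  have := hasPullbacks_total p
  have := hasFiniteLimits_total p
  obtain ⟨φ, -, hφ⟩ := exists_rel f
  obtain ⟨ψ, -, hψ⟩ := exists_rel g
  obtain ⟨W, i, j, hW⟩ : ∃ (W : E) (i : W ⟶ φ.toRel.pt) (j : W ⟶ ψ.toRel.pt),
    IsPullback i j φ.toRel.snd ψ.toRel.snd := ⟨_, _, _, .of_hasPullback _ _⟩
  obtain ⟨τ₁, h₁⟩ := A.rel.exists_substitution (p := p) (i ≫ φ.toRel.fst) (i ≫ φ.toRel.fst)
  obtain ⟨τ₂, h₂⟩ := B.rel.exists_substitution (p := p) (j ≫ ψ.toRel.fst) (j ≫ ψ.toRel.fst)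
  obtain ⟨τ, h⟩ := SieveRel.exists_inter (p := p) τ₁ τ₂
  simp only [h₁, h₂] at h
  let P : EqvObj p :=
    { carrier := W
      rel := τ
      refl x := (h _ _).2 ⟨A.refl _, B.refl _⟩
      symm x y hxy := (h _ _).2 ⟨A.symm _ _ ((h _ _).1 hxy).1, B.symm _ _ ((h _ _).1 hxy).2⟩
      trans x y z hxy hyz := (h _ _).2 ⟨A.trans _ _ _ ((h _ _).1 hxy).1 ((h _ _).1 hyz).1,
        B.trans _ _ _ ((h _ _).1 hxy).2 ((h _ _).1 hyz).2⟩ }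
  obtain ⟨a, ha⟩ := exists_hom_elt_comp (A := P) (B := A) (i ≫ φ.toRel.fst)
    fun x y hxy => ((h _ _).1 hxy).1
  obtain ⟨b, hb⟩ := exists_hom_elt_comp (A := P) (B := B) (j ≫ ψ.toRel.fst)
    fun x y hxy => ((h _ _).1 hxy).2
  have hf {T : E} (t : T ⟶ W) : elt (t ≫ i ≫ φ.toRel.fst) ≫ f = elt (t ≫ i ≫ φ.toRel.snd) := by
    rw [elt_comp_eq_iff, hφ]
    simpa only [Category.assoc] using (SieveRel.Holds.self (p := p) φ.toRel).precomp (t ≫ i)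
  have hg {T : E} (t : T ⟶ W) : elt (t ≫ j ≫ ψ.toRel.fst) ≫ g = elt (t ≫ j ≫ ψ.toRel.snd) := by
    rw [elt_comp_eq_iff, hψ]
    simpa only [Category.assoc] using (SieveRel.Holds.self (p := p) ψ.toRel).precomp (t ≫ j)
  refine ⟨P, a, b, isPullback_of_elt ?_ ?_ ?_⟩
  · refine hom_ext_locally fun {T} t => ⟨T, 𝟙 T, IsCover.id p T, ?_⟩
    rw [← Category.assoc, ← Category.assoc, ha, hb]
    exact (hf _).trans ((congrArg (fun k => elt ((𝟙 T ≫ t) ≫ k)) hW.w).trans (hg _).symm)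
  · intro T t t' h₃ h₄
    rw [ha, ha, elt_eq_iff] at h₃
    rw [hb, hb, elt_eq_iff] at h₄
    exact elt_eq_iff.2 ((h _ _).2 ⟨h₃, h₄⟩)
  · intro T x y hxy
    obtain ⟨T₁, e₁, z, he₁, h₃⟩ := exists_elt_comp_eq_elt f x
    have h₄ : elt (e₁ ≫ y) ≫ g = elt z := by
      rw [← h₃, ← map_comp_elt, ← map_comp_elt, Category.assoc, Category.assoc, hxy]
    rw [elt_comp_eq_iff, hφ] at h₃
    obtain ⟨T₂, e₂, k, he₂, h₅, h₆⟩ := h₃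
    have h₇ := elt_comp_eq_precomp h₄ e₂
    rw [elt_comp_eq_iff, hψ] at h₇
    obtain ⟨T₃, e₃, l, he₃, h₈, h₉⟩ := h₇
    refine ⟨T₃, e₃ ≫ e₂ ≫ e₁, hW.lift (e₃ ≫ k) l (by rw [Category.assoc, h₆, h₉]),
      he₃.comp p (he₂.comp p he₁), ?_, ?_⟩
    · rw [ha]
      refine congrArg elt ?_
      rw [hW.lift_fst_assoc, Category.assoc, h₅]
      simp only [Category.assoc]
    · rw [hb]
      refine congrArg elt ?_
      rw [hW.lift_snd_assoc, h₈]
      simp only [Category.assoc]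

lemma nonempty_isTerminal_discrete {O : E} (hO : IsTerminal O) :
    Nonempty (IsTerminal ((discrete p).obj O)) := by
  have h (A : EqvObj p) : Nonempty (Unique (A ⟶ (discrete p).obj O)) := by
    obtain ⟨f, -⟩ := exists_hom_elt_comp (A := A) (B := (discrete p).obj O) (hO.from _)
      fun x y _ => holds_of_eq (hO.hom_ext _ _)
    refine ⟨⟨⟨f⟩, fun g => hom_ext_of_ev fun {T} x y hxy => ?_⟩⟩
    obtain ⟨T', e, z, he, hz⟩ := exists_ev f x
    exact .of_cover he (hz.congr (A.refl _) (holds_of_eq (hO.hom_ext _ _)))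
  have (A : EqvObj p) := (h A).some
  exact ⟨IsTerminal.ofUnique _⟩

variable (p) in
lemma hasFiniteLimits_eqvObj : HasFiniteLimits (EqvObj p) := by
  have := hasFiniteLimits_total p
  have := (nonempty_isTerminal_discrete (p := p) (terminalIsTerminal (C := E))).some.hasTerminal
  have {A B C : EqvObj p} (f : A ⟶ C) (g : B ⟶ C) : HasPullback f g :=
    (exists_isPullback_eqvObj f g).choose_spec.choose_spec.choose_spec.hasPullback
  have := hasPullbacks_of_hasLimit_cospan (EqvObj p)
  exact hasFiniteLimits_of_hasTerminal_and_pullbacks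

/-- The induced morphism is the relation `∃ x. f(x) = y ∧ g(x) = z` in `y` and `z`. -/
lemma IsLocSurj.exists_desc {f : A ⟶ B} (hf : IsLocSurj f) (g : A ⟶ C)
    (h : ∀ ⦃T : E⦄ (x x' : T ⟶ A.carrier), elt x ≫ f = elt x' ≫ f → elt x ≫ g = elt x' ≫ g) :
    ∃ k : B ⟶ C, f ≫ k = g := by
  obtain ⟨τ, hτ⟩ := exists_rel_span f g
  obtain ⟨k, hk⟩ := exists_hom_of_elt (A := B) (B := C)
    (fun T y z => ∃ (T' : E) (e : T' ⟶ T) (x : T' ⟶ A.carrier), IsCover p e ∧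
      elt x ≫ f = (discrete p).map e ≫ y ∧ elt x ≫ g = (discrete p).map e ≫ z)
    ⟨τ, fun y z => by simp only [hτ, map_comp_elt]⟩
    (fun T y z z' => by
      rintro ⟨T₁, e₁, x₁, he₁, h₁, h₂⟩ ⟨T₂, e₂, x₂, he₂, h₃, h₄⟩
      obtain ⟨T₃, e₃, t, he₃, h₅⟩ := he₂.exists_pullback p e₁
      have h₆ : (discrete p).map t ≫ (discrete p).map e₂ =
          (discrete p).map e₃ ≫ (discrete p).map e₁ := by
        rw [← Functor.map_comp, ← Functor.map_comp, h₅]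
      have h₇ := h (e₃ ≫ x₁) (t ≫ x₂) (by
        rw [← map_comp_elt, ← map_comp_elt, Category.assoc, Category.assoc, h₁, h₃,
          reassoc_of% h₆])
      rw [← map_comp_elt, ← map_comp_elt, Category.assoc, Category.assoc, h₂, h₄,
          reassoc_of% h₆] at h₇
      exact he₁.isLocSurj.hom_ext (he₃.isLocSurj.hom_ext h₇))
    (fun T y => by
      obtain ⟨T₁, e₁, x, he₁, h₁⟩ := hf y
      obtain ⟨T₂, e₂, z, he₂, h₂⟩ := exists_elt_comp_eq_elt g x
      refine ⟨T₂, e₂ ≫ e₁, z, he₂.comp p he₁, T₂, 𝟙 _, e₂ ≫ x, IsCover.id p _, ?_, ?_⟩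
      · rw [CategoryTheory.Functor.map_id, Category.id_comp, elt_comp_eq_precomp h₁, Category.assoc]
      · rw [h₂, CategoryTheory.Functor.map_id, Category.id_comp])
  refine ⟨k, hom_ext_locally fun x => ?_⟩
  obtain ⟨T₁, e₁, y, he₁, h₁⟩ := exists_elt_comp_eq_elt f x
  obtain ⟨T₂, e₂, z, he₂, h₂⟩ := exists_elt_comp_eq_elt g (e₁ ≫ x)
  refine ⟨T₂, e₂ ≫ e₁, he₂.comp p he₁, ?_⟩
  rw [Category.assoc, h₂, reassoc_of% (elt_comp_eq_precomp h₁ e₂), hk]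
  refine ⟨T₂, 𝟙 _, e₂ ≫ e₁ ≫ x, IsCover.id p _, ?_, ?_⟩
  · rw [CategoryTheory.Functor.map_id, Category.id_comp, elt_comp_eq_precomp h₁]
  · rw [h₂, CategoryTheory.Functor.map_id, Category.id_comp]

lemma IsLocSurj.isRegularEpi {f : A ⟶ B} (hf : IsLocSurj f) : IsRegularEpi f := by
  obtain ⟨K, r₁, r₂, hK⟩ := exists_isPullback_eqvObj f f
  have key {C : EqvObj p} (g : A ⟶ C) (hg : r₁ ≫ g = r₂ ≫ g) : ∃ k : B ⟶ C, f ≫ k = g := by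
    refine hf.exists_desc g fun T x x' h => ?_
    rw [← hK.lift_fst (elt x) (elt x') h, Category.assoc, hg, ← Category.assoc, hK.lift_snd]
  exact ⟨⟨{ W := K, left := r₁, right := r₂, w := hK.w
            isColimit := Cofork.IsColimit.mk _ (fun s => (key s.π s.condition).choose)
              (fun s => (key s.π s.condition).choose_spec)
              (fun s m hm => hf.hom_ext (hm.trans (key s.π s.condition).choose_spec.symm)) }⟩⟩

lemma IsLocSurj.of_isPullback {P : EqvObj p} {a : P ⟶ A} {b : P ⟶ B} {f : A ⟶ C} {g : B ⟶ C}
    (h : IsPullback a b f g) (hf : IsLocSurj f) : IsLocSurj b := by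
  intro T y
  obtain ⟨T₁, e₁, x, he₁, h₁⟩ := hf.exists_lift (elt y ≫ g)
  obtain ⟨T₂, e₂, t, he₂, h₂⟩ := exists_map_comp_eq_elt
    (h.lift (elt x) (elt (e₁ ≫ y)) (by rw [h₁, ← map_comp_elt, Category.assoc]))
  refine ⟨T₂, e₂ ≫ e₁, t, he₂.comp p he₁, ?_⟩
  rw [← h₂, Category.assoc, h.lift_snd, map_comp_elt, Category.assoc]

/-- The quotient of the carrier of `A` by the kernel of `f` gives the image of `f`. -/
lemma exists_isLocSurj_mono_fac (f : A ⟶ B) :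
    ∃ (M : EqvObj p) (e : A ⟶ M) (m : M ⟶ B), IsLocSurj e ∧ Mono m ∧ e ≫ m = f := by
  obtain ⟨τ, hτ⟩ := exists_rel_cospan f f
  obtain ⟨φ, -, hφ⟩ := exists_rel f
  let M : EqvObj p :=
    { carrier := A.carrier
      rel := τ
      refl x := (hτ _ _).2 rfl
      symm x y h := (hτ _ _).2 ((hτ _ _).1 h).symm
      trans x y z h h' := (hτ _ _).2 (((hτ _ _).1 h).trans ((hτ _ _).1 h')) }
  -- `e` is the identity of the carrier, and `m` is the relation of `f`
  obtain ⟨e, he⟩ := exists_hom_elt_comp (A := A) (B := M) (𝟙 A.carrier) fun x x' h => (hτ _ _).2 (by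
    rw [Category.comp_id, Category.comp_id, elt_eq_iff.2 h])
  obtain ⟨m, hm⟩ := exists_hom_of_rel (A := M) (B := B) φ.toRel
    (fun x x' y y' h h₁ h₂ => by
      have h₃ := (hτ _ _).1 h₁
      rw [← hφ, ← elt_comp_eq_iff] at h ⊢
      rw [← h₃, h, elt_eq_iff.2 h₂])
    φ.singval
    (fun x => φ.exists_holds x)
  have hm' {T : E} {x : T ⟶ A.carrier} {y : T ⟶ B.carrier} :
      elt (A := M) x ≫ m = elt y ↔ elt x ≫ f = elt y := by
    rw [elt_comp_eq_iff, elt_comp_eq_iff, hφ, hm]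
  have he' {T : E} (x : T ⟶ A.carrier) : elt x ≫ e = elt (A := M) x :=
    (he x).trans (congrArg elt (Category.comp_id x))
  refine ⟨M, e, m, fun T y => ⟨T, 𝟙 T, y, IsCover.id p T, (he' y).trans
    (congrArg elt (Category.id_comp y).symm)⟩, ⟨fun {S} u v huv => hom_ext_locally fun s => ?_⟩,
    hom_ext_locally fun x => ?_⟩
  · obtain ⟨T₁, e₁, x, he₁, h₁⟩ := exists_elt_comp_eq_elt u s
    obtain ⟨T₂, e₂, x', he₂, h₂⟩ := exists_elt_comp_eq_elt v (e₁ ≫ s)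
    obtain ⟨T₃, e₃, y, he₃, h₃⟩ := exists_elt_comp_eq_elt m (e₂ ≫ x)
    have h₄ := elt_comp_eq_precomp (elt_comp_eq_precomp h₁ e₂) e₃
    have h₅ := elt_comp_eq_precomp h₂ e₃
    have h₆ : elt (A := M) (e₃ ≫ x') ≫ m = elt y := by
      rw [← h₅, ← h₃, ← h₄, Category.assoc, Category.assoc, huv]
    refine ⟨T₃, e₃ ≫ e₂ ≫ e₁, he₃.comp p (he₂.comp p he₁), ?_⟩
    rw [Category.assoc, Category.assoc, h₄, h₅, elt_eq_iff]
    exact (hτ _ _).2 ((hm'.1 h₃).trans (hm'.1 h₆).symm)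
  · obtain ⟨T₁, e₁, y, he₁, h₁⟩ := exists_elt_comp_eq_elt f x
    refine ⟨T₁, e₁, he₁, ?_⟩
    rw [← Category.assoc, he', h₁]
    exact hm'.2 h₁

/-- An equivalence relation in the sense of category theory is one in the logic of generalized
elements, and the quotient of the carrier by it is the effective quotient. -/
lemma exists_isKernelPair {K X : EqvObj p} (r₁ r₂ : K ⟶ X) (h : IsEquivalenceRelation r₁ r₂) :
    ∃ (Q : EqvObj p) (q : X ⟶ Q), IsKernelPair q r₁ r₂ := by
  obtain ⟨⟨h⟩⟩ := h
  obtain ⟨τ, hτ⟩ := exists_rel_span r₁ r₂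
  have hτ' {T : E} {x y : T ⟶ X.carrier} (k : (discrete p).obj T ⟶ K) (h₁ : k ≫ r₁ = elt x)
      (h₂ : k ≫ r₂ = elt y) : τ.Holds p x y := by
    obtain ⟨T', e, k', he, h'⟩ := exists_map_comp_eq_elt k
    exact (hτ _ _).2 ⟨T', e, k', he, by rw [← h', Category.assoc, h₁, map_comp_elt],
      by rw [← h', Category.assoc, h₂, map_comp_elt]⟩
  let Q : EqvObj p :=
    { carrier := X.carrier
      rel := τ
      refl x := hτ' (elt x ≫ h.r)
        (by rw [Category.assoc, h.reflexivity₁, Category.comp_id])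
        (by rw [Category.assoc, h.reflexivity₂, Category.comp_id])
      -- symmetry and transitivity can be checked on a cover, where the relation is given by
      -- elements of `K`
      symm x y hxy := by
        obtain ⟨T, e, k, he, h₁, h₂⟩ := (hτ _ _).1 hxy
        exact .of_cover he (hτ' (elt k ≫ h.s) (by rw [Category.assoc, h.symmetry₁, h₂])
          (by rw [Category.assoc, h.symmetry₂, h₁]))
      trans x y z hxy hyz := by
        obtain ⟨T, e, k, he, h₁, h₂⟩ := (hτ _ _).1 hxy
        obtain ⟨T', e', k', he', h₃, h₄⟩ := (hτ _ _).1 (hyz.precomp e)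
        have h₅ := elt_comp_eq_precomp h₂ e'
        let l := PullbackCone.IsLimit.lift h.isLimit _ _ (h₅.trans h₃.symm)
        have hl₁ : l ≫ h.c.fst = _ := PullbackCone.IsLimit.lift_fst _ _ _ _
        have hl₂ : l ≫ h.c.snd = _ := PullbackCone.IsLimit.lift_snd _ _ _ _
        refine .of_cover he (.of_cover he' (hτ' (l ≫ h.t) ?_ ?_))
        · rw [Category.assoc, h.transitivity₁, reassoc_of% hl₁, elt_comp_eq_precomp h₁]
        · rw [Category.assoc, h.transitivity₂, reassoc_of% hl₂, h₄] }
  obtain ⟨q, hq⟩ := exists_hom_elt_comp (A := X) (B := Q) (𝟙 X.carrier) fun x x' hx => by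
    rw [Category.comp_id, Category.comp_id]
    exact hτ' (elt x ≫ h.r) (by rw [Category.assoc, h.reflexivity₁, Category.comp_id])
      (by rw [Category.assoc, h.reflexivity₂, Category.comp_id, elt_eq_iff.2 hx])
  have hq' {T : E} (x : T ⟶ X.carrier) : elt x ≫ q = elt (A := Q) x :=
    (hq x).trans (congrArg elt (Category.comp_id x))
  refine ⟨Q, q, isPullback_of_elt (hom_ext_locally fun k => ?_)
    (fun T t t' h₁ h₂ => h.right_cancellation _ _ h₁ h₂) fun T x y hxy => ?_⟩
  · obtain ⟨T₁, e₁, x, he₁, h₁⟩ := exists_elt_comp_eq_elt r₁ k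
    obtain ⟨T₂, e₂, y, he₂, h₂⟩ := exists_elt_comp_eq_elt r₂ (e₁ ≫ k)
    have h₃ := elt_comp_eq_precomp h₁ e₂
    refine ⟨T₂, e₂ ≫ e₁, he₂.comp p he₁, ?_⟩
    rw [Category.assoc, reassoc_of% h₃, reassoc_of% h₂, hq', hq', elt_eq_iff]
    exact hτ' _ h₃ h₂
  · rw [hq', hq', elt_eq_iff] at hxy
    exact (hτ _ _).1 hxy

variable (p) in
/-- The category of total equivalence relations is exact, with the locally surjective morphisms as
regular epimorphisms. -/
lemma isExact_eqvObj : IsExact (EqvObj p) ∧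
    ∀ ⦃A B : EqvObj p⦄ (f : A ⟶ B), IsRegularEpi f → IsLocSurj f := by
  have := hasFiniteLimits_eqvObj p
  exact isExact_of_factorization (fun A B f => IsLocSurj f) (fun A B f hf => hf.isRegularEpi)
    (fun P X Y Z a b f g h hf => hf.of_isPullback h) (fun A B f => exists_isLocSurj_mono_fac f)
    (fun K X r₁ r₂ h => exists_isKernelPair r₁ r₂ h)

end Exact

/-! ### Density of the fibered Yoneda embedding -/

section ConstantObjects

variable {R : Type u₁} [Category.{v₁} R] {E : Type u₂} [Category.{v₂} E] {p : E ⥤ R}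

lemma isPullback_of_isFibTerminal {P X Y Z : E} {a : P ⟶ X} {b : P ⟶ Y} {f : X ⟶ Z} {g : Y ⟶ Z}
    (hP : IsFibTerminal p P) (hX : IsFibTerminal p X) (hY : IsFibTerminal p Y)
    (hZ : IsFibTerminal p Z) (h : IsPullback (p.map a) (p.map b) (p.map f) (p.map g)) :
    IsPullback a b f g := by
  have w : a ≫ f = b ≫ g := hZ.ext (by rw [p.map_comp, p.map_comp, h.w])
  have key {T : E} (x : T ⟶ X) (y : T ⟶ Y) (hxy : x ≫ f = y ≫ g) :
      ∃ t : T ⟶ P, t ≫ a = x ∧ t ≫ b = y := by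
    have e : p.map x ≫ p.map f = p.map y ≫ p.map g := by rw [← p.map_comp, ← p.map_comp, hxy]
    obtain ⟨t, ht, -⟩ := hP (h.lift _ _ e)
    exact ⟨t, hX.ext (by rw [p.map_comp, ht, h.lift_fst]),
      hY.ext (by rw [p.map_comp, ht, h.lift_snd])⟩
  exact ⟨⟨w⟩, ⟨PullbackCone.IsLimit.mk w (fun s => (key _ _ s.condition).choose)
    (fun s => (key _ _ s.condition).choose_spec.1) (fun s => (key _ _ s.condition).choose_spec.2)
    (fun s m h₁ h₂ => hP.ext (h.hom_ext
      (by rw [← p.map_comp, ← p.map_comp, h₁, (key _ _ s.condition).choose_spec.1])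
      (by rw [← p.map_comp, ← p.map_comp, h₂, (key _ _ s.condition).choose_spec.2])))⟩⟩

lemma IsFibTerminal.isIso {O O' : E} (hO : IsFibTerminal p O) (hO' : IsFibTerminal p O')
    (f : O ⟶ O') [IsIso (p.map f)] : IsIso f := by
  obtain ⟨g, hg, -⟩ := hO (inv (p.map f))
  exact ⟨g, hO.ext (by simp [hg]), hO'.ext (by simp [hg])⟩

lemma IsFibTerminal.isCart {O O' : E} (hO : IsFibTerminal p O) (hO' : IsFibTerminal p O')
    (f : O ⟶ O') : IsCart p f := by
  rw [isCart_iff]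
  intro T g v hg
  obtain ⟨h, hh, hu⟩ := hO v
  exact ⟨h, ⟨hh, hO'.ext (by rw [p.map_comp, hh, hg])⟩, fun h' hh' => hu h' hh'.1⟩

lemma eq_of_isHomLift {A B : E} (f : A ⟶ B) {J I : R} {u v : J ⟶ I} (hu : p.IsHomLift u f)
    (hv : p.IsHomLift v f) : u = v :=
  (IsHomLift.fac p u f).trans (IsHomLift.fac p v f).symm

lemma eqToHom_comp_of_isHomLift {A B : E} {J I : R} (u : J ⟶ I) (f : A ⟶ B) [p.IsHomLift u f]
    (hA : p.obj A = J) (hB : p.obj B = I) : p.map f ≫ eqToHom hB = eqToHom hA ≫ u := by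
  rw [IsHomLift.fac' p u f]
  simp

lemma isHomLift_comp_eqToHom {A B : E} {I : R} (f : A ⟶ B) (hB : p.obj B = I) :
    p.IsHomLift (p.map f ≫ eqToHom hB) f := by
  subst hB
  rw [eqToHom_refl, Category.comp_id]
  infer_instance

variable (p) in
/-- The functor of fiberwise terminal objects is a section of the fibration. -/
noncomputable def oneFunctorCompIso [IsLexFibration p] : oneFunctor p ⋙ p ≅ 𝟭 R :=
  NatIso.ofComponents (fun I => eqToIso (one p I).2) fun {J I} u =>
    eqToHom_comp_of_isHomLift u (toOne p (one p J).2 u) (one p J).2 (one p I).2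

variable (p) in
lemma isPullback_oneFunctor [IsLexFibration p] {P X Y Z : R} {a : P ⟶ X} {b : P ⟶ Y} {f : X ⟶ Z}
    {g : Y ⟶ Z} (h : IsPullback a b f g) : IsPullback ((oneFunctor p).map a) ((oneFunctor p).map b)
      ((oneFunctor p).map f) ((oneFunctor p).map g) := by
  have := preservesLimitsOfShape_of_natIso (J := WalkingCospan) (oneFunctorCompIso p).symm
  exact isPullback_of_isFibTerminal (p := p) (isFibTerminal_one _) (isFibTerminal_one _)
    (isFibTerminal_one _) (isFibTerminal_one _) (h.map (oneFunctor p ⋙ p))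

variable [Regular R] [IsLexFibration p]

variable (p) in
lemma isCover_oneFunctor {J I : R} (u : J ⟶ I) [IsRegularEpi u] :
    IsCover p ((oneFunctor p).map u) := by
  refine ⟨(isFibTerminal_one _).isCart (isFibTerminal_one _) _, ?_⟩
  have h : p.map ((oneFunctor p).map u) =
    (oneFunctorCompIso p).hom.app J ≫ u ≫ (oneFunctorCompIso p).inv.app I :=
      ((oneFunctorCompIso p).hom.naturality_assoc u ((oneFunctorCompIso p).inv.app I)).symm.trans
        ((congrArg _ ((oneFunctorCompIso p).hom_inv_id_app I)).trans (Category.comp_id _)) |>.symm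
  rw [h]
  infer_instance

variable {T T' X Y : E}

lemma discrete_map_eq_iff {x y : T ⟶ X} : (discrete p).map x = (discrete p).map y ↔
    ∃ (T' : E) (e : T' ⟶ T), IsCover p e ∧ e ≫ x = e ≫ y := by
  rw [← elt_discrete x, ← elt_discrete y]
  exact elt_eq_iff.trans holds_discrete_iff

/-- Equality in discrete objects is local equality, so that a pullback square of the total category
remains one locally on generalized elements. -/
lemma discrete_isPullback {P X Y Z : E} {a : P ⟶ X} {b : P ⟶ Y} {f : X ⟶ Z} {g : Y ⟶ Z}
    (h : IsPullback a b f g) : IsPullback ((discrete p).map a) ((discrete p).map b)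
      ((discrete p).map f) ((discrete p).map g) := by
  have hd {T X Y : E} (x : T ⟶ X) (f : X ⟶ Y) :
      elt (A := (discrete p).obj X) x ≫ (discrete p).map f = (discrete p).map (x ≫ f) :=
    (congrArg (· ≫ _) (elt_discrete x)).trans ((discrete p).map_comp x f).symm
  refine isPullback_of_elt (by rw [← Functor.map_comp, ← Functor.map_comp, h.w]) ?_ ?_
  · intro T (t : T ⟶ P) (t' : T ⟶ P) h₁ h₂
    replace h₁ := (hd t a).symm.trans (h₁.trans (hd t' a))
    replace h₂ := (hd t b).symm.trans (h₂.trans (hd t' b))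
    obtain ⟨T₁, e₁, he₁, h₃⟩ := discrete_map_eq_iff.1 h₁
    have h₄ : (discrete p).map ((e₁ ≫ t) ≫ b) = (discrete p).map ((e₁ ≫ t') ≫ b) := by
      rw [Category.assoc, Category.assoc, Functor.map_comp, h₂, ← Functor.map_comp]
    obtain ⟨T₂, e₂, he₂, h₅⟩ := discrete_map_eq_iff.1 h₄
    refine (elt_discrete t).trans (Eq.trans (discrete_map_eq_iff.2 ⟨T₂, e₂ ≫ e₁, he₂.comp p he₁,
      h.hom_ext ?_ ?_⟩) (elt_discrete t').symm)
    · simp only [Category.assoc, h₃]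
    · simpa only [Category.assoc] using h₅
  · intro T (x : T ⟶ X) (y : T ⟶ Y) hxy
    replace hxy := (hd x f).symm.trans (hxy.trans (hd y g))
    obtain ⟨T₁, e₁, he₁, h₁⟩ := discrete_map_eq_iff.1 hxy
    simp only [← Category.assoc] at h₁
    refine ⟨T₁, e₁, h.lift (e₁ ≫ x) (e₁ ≫ y) h₁, he₁, (hd _ a).trans (Eq.trans ?_
      (elt_discrete _).symm), (hd _ b).trans (Eq.trans ?_ (elt_discrete _).symm)⟩
    · exact congrArg _ (h.lift_fst _ _ _)
    · exact congrArg _ (h.lift_snd _ _ _)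

variable (p) in
lemma isPullback_constObj {P X Y Z : R} {a : P ⟶ X} {b : P ⟶ Y} {f : X ⟶ Z} {g : Y ⟶ Z}
    (h : IsPullback a b f g) : IsPullback ((constObj p).map a) ((constObj p).map b)
      ((constObj p).map f) ((constObj p).map g) :=
  discrete_isPullback (isPullback_oneFunctor p h)

variable (p) in
lemma preservesFiniteLimits_constObj : PreservesFiniteLimits (constObj p) := by
  obtain ⟨h⟩ := (isFibTerminal_one (p := p) (⊤_ R)).isTerminal_total
    (terminalIsTerminal.ofIso (eqToIso (one p (⊤_ R)).2.symm))
  exact preservesFiniteLimits_of_isPullback _ (terminalIsTerminal (C := R))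
    (nonempty_isTerminal_discrete h) fun _ _ _ _ _ _ _ _ h => isPullback_constObj p h

variable (p) in
/-- Presheaves are the gluing of the exact category of total equivalence relations along the
constant objects. -/
theorem isFiberedPretopos_presheaves : IsFiberedPretopos (presheaves p).p := by
  have := (isExact_eqvObj p).1.regular
  have := preservesFiniteLimits_constObj p
  exact isFiberedPretopos_glue (isExact_eqvObj p).1 fun J I u hu =>
    (isCover_oneFunctor p u).isLocSurj.isRegularEpi

variable (p) in
theorem isLexFunctor_yoneda : IsLexFunctor (yoneda p) := by
  have := isFiberedPretopos_presheaves p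
  have : IsLexFibration (BasedCategory.ofFunctor p).p := inferInstanceAs (IsLexFibration p)
  refine IsLexFunctor.of_isPullback (fun I => ?_) fun P X Y Z a b f g h => ?_
  · have : IsIso (p.map (toOne p (A := (one p I).1) rfl (𝟙 (p.obj (one p I).1)))) := by
      rw [IsHomLift.fac' p (𝟙 (p.obj (one p I).1)) (toOne p _ _)]
      infer_instance
    have := (isFibTerminal_one (p := p) I).isIso (isFibTerminal_one _)
      (toOne p rfl (𝟙 (p.obj (one p I).1)))
    -- the object displaying `Y 1` is terminal, since its displayed map is the image of an
    -- isomorphism of fiberwise terminal objects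
    have : IsIso ((discrete p).map (toOne p rfl (𝟙 (p.obj (one p I).1)))) := inferInstance
    exact @isFibTerminal_of_isIso _ _ _ _ (constObj p)
      (Comma.mk _ _ ((discrete p).map (toOne p rfl (𝟙 (p.obj (one p I).1))))) this
  · exact isPullback_comma (Δ := constObj p) (discrete_isPullback (p := p) h) (map_isPullback p h)
      (isPullback_constObj p (map_isPullback p h))

/-- Maps out of discrete objects are locally maps of the fibration of presheaves. -/
lemma exists_yoneda_hom (Z : Comma (𝟭 (EqvObj p)) (constObj p)) (m : (discrete p).obj T ⟶ Z.left) :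
    ∃ (T' : E) (e : T' ⟶ T) (k : (yonedaFunctor p).obj T' ⟶ Z), IsCover p e ∧
      k.left = (discrete p).map e ≫ m := by
  obtain ⟨T', e, x, he, hx⟩ := exists_map_comp_eq_elt (m ≫ display Z)
  replace hx : (discrete p).map e ≫ m ≫ display Z = (discrete p).map x :=
    hx.trans (elt_discrete x)
  let u : p.obj T' ⟶ Z.right := p.map x ≫ eqToHom (one p Z.right).2
  refine ⟨T', e, ⟨(discrete p).map e ≫ m, u, ?_⟩, he, rfl⟩
  refine (Category.assoc _ _ _).trans (hx.trans ?_)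
  have h₁ : p.IsHomLift u x := isHomLift_comp_eqToHom x _
  have h₂ : p.IsHomLift u (toOne p rfl (𝟙 (p.obj T')) ≫ toOne p (one p (p.obj T')).2 u) :=
    inferInstance
  exact (congrArg _ ((isFibTerminal_one _).ext (map_eq_of_isHomLift p u h₁ h₂))).trans
    ((discrete p).map_comp _ _)

end ConstantObjects

section Yoneda

variable {R : Type u₁} [Category.{v₁} R] {E : Type u₂} [Category.{v₂} E] {p : E ⥤ R}
  [Regular R] [IsLexPreStack p]

/-- In a pre-stack, covers are epimorphisms, so local equality is equality. -/
lemma IsCover.cancel {T T' X : E} {e : T' ⟶ T} (he : IsCover p e) {x y : T ⟶ X}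
    (h : e ≫ x = e ≫ y) : x = y := by
  have := he.2
  refine he.isSurj.ext ?_ h
  rw [← cancel_epi (p.map e), ← p.map_comp, h, p.map_comp]

variable (p) in
lemma faithful_discrete : (discrete p).Faithful where
  map_injective h := by
    obtain ⟨T, e, he, h⟩ := discrete_map_eq_iff.1 h
    exact he.cancel h

variable (p) in
theorem faithful_yoneda : (yonedaFunctor p).Faithful where
  map_injective h := (faithful_discrete p).map_injective (congrArg CommaMorphism.left h)

/-- A map of discrete objects over a map `r` of the base is given on a cover, from where it
descends. -/
lemma exists_discrete_map_eq {X Y O O' : E} {x : X ⟶ O} {y : Y ⟶ O'} {o : O ⟶ O'}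
    (l : (discrete p).obj X ⟶ (discrete p).obj Y) (r : p.obj X ⟶ p.obj Y)
    (hx : p.IsHomLift (𝟙 (p.obj X)) x) (hy : p.IsHomLift (𝟙 (p.obj Y)) y) (ho : p.IsHomLift r o)
    (hw : l ≫ (discrete p).map y = (discrete p).map x ≫ (discrete p).map o) :
    ∃ k : X ⟶ Y, p.map k = r ∧ (discrete p).map k = l := by
  have := faithful_discrete p
  obtain ⟨T, e, d, he, hd⟩ : ∃ (T : E) (e : T ⟶ X) (d : T ⟶ Y), IsCover p e ∧
      (discrete p).map e ≫ l = (discrete p).map d := by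
    obtain ⟨T, e, d, he, hd⟩ := exists_map_comp_eq_elt l
    exact ⟨T, e, d, he, hd.trans (elt_discrete d)⟩
  have hw : d ≫ y = e ≫ x ≫ o := by
    apply (discrete p).map_injective
    rw [Functor.map_comp, Functor.map_comp, Functor.map_comp, ← hd, Category.assoc, hw]
  have hr : p.map d = p.map e ≫ r := by
    have h₁ : p.IsHomLift (p.map d ≫ 𝟙 (p.obj Y)) (d ≫ y) := inferInstance
    have h₂ : p.IsHomLift (p.map e ≫ 𝟙 (p.obj X) ≫ r) (e ≫ x ≫ o) := inferInstance
    rw [← hw, Category.id_comp] at h₂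
    rw [Category.comp_id] at h₁
    exact eq_of_isHomLift _ h₁ h₂
  -- `d` identifies the pairs identified by `e`, since it represents `l` on the cover and `discrete`
  -- is faithful
  obtain ⟨k, ⟨hk₁, hk₂⟩, -⟩ := he.isSurj.isEff d r hr fun S a b hab =>
    (discrete p).map_injective (by
      rw [Functor.map_comp, Functor.map_comp, ← hd, ← Category.assoc, ← Functor.map_comp, hab,
        Functor.map_comp, Category.assoc])
  exact ⟨k, hk₁, he.isLocSurj.hom_ext (by rw [hd, ← hk₂, Functor.map_comp])⟩

variable (p) in
theorem full_yoneda : (yonedaFunctor p).Full where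
  map_surjective {X Y} h := by
    have hx : p.IsHomLift (𝟙 (p.obj X)) (toOne p (A := X) rfl (𝟙 (p.obj X))) := inferInstance
    have hy : p.IsHomLift (𝟙 (p.obj Y)) (toOne p (A := Y) rfl (𝟙 (p.obj Y))) := inferInstance
    let r : p.obj X ⟶ p.obj Y := h.right
    have ho : p.IsHomLift r (toOne p (one p (p.obj X)).2 r) := inferInstance
    obtain ⟨k, hk₁, hk₂⟩ := exists_discrete_map_eq (p := p) (X := X) (Y := Y) h.left r hx hy ho h.w
    exact ⟨k, CommaMorphism.ext hk₂ hk₁⟩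

variable (p) in
/-- A presheaf is covered by the representable of its carrier, and a surjection onto a representable
has a section on a cover because surjections are locally surjective on generalized elements. -/
theorem isDense_yoneda : IsDense (yoneda p) where
  isLexFunctor := isLexFunctor_yoneda p
  full := full_yoneda p
  faithful := faithful_yoneda p
  exists_isSurj Z := by
    have := (isExact_eqvObj p).1.regular
    have := preservesFiniteLimits_constObj p
    let Z' : Comma (𝟭 (EqvObj p)) (constObj p) := Z
    -- the quotient map from the discrete object on the carrier, made a map of presheaves on a cover
    obtain ⟨T, e, k, he, hk⟩ := exists_yoneda_hom Z' (elt (𝟙 Z'.left.carrier))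
    refine ⟨T, k, isSurj_of_left k ?_⟩
    rw [hk]
    refine IsLocSurj.isRegularEpi fun S y => ?_
    obtain ⟨S', e', y', he', h⟩ := he.exists_pullback p y
    refine ⟨S', e', y', he', ?_⟩
    rw [map_comp_elt]
    refine (congrArg (· ≫ _) (elt_discrete y')).trans ((map_comp_elt _ _).trans (congrArg elt ?_))
    rw [Category.comp_id, h]
  exists_isCover W A w hw := by
    have := (isExact_eqvObj p).1.regular
    have := preservesFiniteLimits_constObj p
    have := faithful_discrete p
    let W' : Comma (𝟭 (EqvObj p)) (constObj p) := W
    let w' : W' ⟶ (yonedaFunctor p).obj A := w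
    -- the generic element of `A` lifts along `w` on a cover of `A`
    obtain ⟨T, e, x, he, hx⟩ := (isExact_eqvObj p).2 _ (isRegularEpi_left w' hw) (𝟙 A)
    replace hx : elt x ≫ w'.left = (discrete p).map e :=
      hx.trans ((congrArg elt (Category.comp_id e)).trans (elt_discrete e))
    obtain ⟨T', e', k, he', hk⟩ := exists_yoneda_hom W' (elt x)
    obtain ⟨g, hg⟩ := (full_yoneda p).map_surjective (k ≫ w')
    have h : g = e' ≫ e := by
      apply (discrete p).map_injective
      refine (congrArg CommaMorphism.left hg).trans ?_
      exact (congrArg (· ≫ w'.left) hk).trans ((Category.assoc _ _ _).trans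
        ((congrArg (_ ≫ ·) hx).trans ((discrete p).map_comp e' e).symm))
    subst h
    exact ⟨T', e' ≫ e, k, he'.comp p he, hg.symm⟩

end Yoneda

/-! ### The left biadjoint defined by universal arrows -/

section Biadjoint

open BasedFunctor BasedNatTrans Bicategory

variable {R : Type u₁} [Category.{v₁} R]

/-- Composition of finite limit preserving fibered functors. -/
abbrev compLex {C : BasedCategory.{v₂, u₂} R} {D : BasedCategory.{v₃, u₃} R}
    {X : BasedCategory.{v₄, u₄} R} (F : LexFun C D) (G : LexFun D X) : LexFun C X :=
  ⟨F.obj.comp G.obj, F.property.comp G.property⟩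

variable (R) in
/-- A choice of universal arrows from the finite-limit pre-stacks to the forgetful functor from
fibered pretoposes. -/
structure UniversalArrows where
  obj : Lex.{w} R → Pretop.{w} R
  unit (C : Lex.{w} R) : LexFun C.toBased (obj C).toBased
  isEquivalence (C : Lex.{w} R) (X : Pretop.{w} R) :
    (precomp (unit C).obj (unit C).property X.toBased).IsEquivalence

namespace UniversalArrows

variable (U : UniversalArrows.{w} R)

/-- The equivalence given by precomposition with a universal arrow. -/
abbrev restrict (C : Lex.{w} R) (X : Pretop.{w} R) :
    PosFun (U.obj C).toBased X.toBased ⥤ LexFun C.toBased X.toBased :=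
  precomp (U.unit C).obj (U.unit C).property X.toBased

instance (C : Lex.{w} R) (X : Pretop.{w} R) : (U.restrict C X).IsEquivalence := U.isEquivalence C X

section

variable {C D : Lex.{w} R} {X : Pretop.{w} R} {G G' : PosFun (U.obj C).toBased X.toBased}

/-- Transformations between positive functors on a universal pretopos are determined by their
components at the images of the universal arrow. -/
lemma hom_ext {α β : G ⟶ G'} (h : ∀ c, α.hom.toNatTrans.app ((U.unit C).obj.obj c) =
    β.hom.toNatTrans.app ((U.unit C).obj.obj c)) : α = β :=
  (U.restrict C X).map_injective (fun_hom_ext h)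

lemma preimage_app (β : (U.restrict C X).obj G ⟶ (U.restrict C X).obj G') (c : C.toBased.obj) :
    ((U.restrict C X).preimage β).hom.toNatTrans.app ((U.unit C).obj.obj c) =
      β.hom.toNatTrans.app c :=
  congrArg (fun γ : (U.restrict C X).obj G ⟶ (U.restrict C X).obj G' => γ.hom.toNatTrans.app c)
    ((U.restrict C X).map_preimage β)

/-- The extension of a finite limit preserving fibered functor to the universal pretoposes. -/
noncomputable def ext (F : LexFun C.toBased D.toBased) :
    PosFun (U.obj C).toBased (U.obj D).toBased :=
  (U.restrict C (U.obj D)).objPreimage (compLex F (U.unit D))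

/-- The extension of `F` restricts to `F` along the universal arrows. -/
noncomputable def extIso (F : LexFun C.toBased D.toBased) : (U.restrict C (U.obj D)).obj (U.ext F) ≅
    compLex F (U.unit D) :=
  (U.restrict C (U.obj D)).objObjPreimageIso _

/-- The components of `extIso`. -/
noncomputable def cmp (F : LexFun C.toBased D.toBased) (c : C.toBased.obj) :
    (U.ext F).obj.obj ((U.unit C).obj.obj c) ≅ (U.unit D).obj.obj (F.obj.obj c) where
  hom := (U.extIso F).hom.hom.toNatTrans.app c
  inv := (U.extIso F).inv.hom.toNatTrans.app c
  hom_inv_id := congrArg (fun γ : (U.restrict C (U.obj D)).obj (U.ext F) ⟶ _ =>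
    γ.hom.toNatTrans.app c) (U.extIso F).hom_inv_id
  inv_hom_id := congrArg (fun γ : (compLex F (U.unit D)) ⟶ _ => γ.hom.toNatTrans.app c)
    (U.extIso F).inv_hom_id

lemma cmp_naturality (F : LexFun C.toBased D.toBased) {c c' : C.toBased.obj} (u : c ⟶ c') :
    (U.ext F).obj.map ((U.unit C).obj.map u) ≫ (U.cmp F c').hom =
      (U.cmp F c).hom ≫ (U.unit D).obj.map (F.obj.map u) :=
  (U.extIso F).hom.hom.toNatTrans.naturality u

/-- The action of the left biadjoint on 2-cells. -/
noncomputable def map₂ {F F' : LexFun C.toBased D.toBased} (α : F ⟶ F') : U.ext F ⟶ U.ext F' :=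
  (U.restrict C (U.obj D)).preimage ((U.extIso F).hom ≫
    ObjectProperty.homMk (BasedCategory.whiskerRight α.hom (U.unit D).obj) ≫ (U.extIso F').inv)

lemma map₂_app {F F' : LexFun C.toBased D.toBased} (α : F ⟶ F') (c : C.toBased.obj) :
    (U.map₂ α).hom.toNatTrans.app ((U.unit C).obj.obj c) =
      (U.cmp F c).hom ≫ (U.unit D).obj.map (α.hom.toNatTrans.app c) ≫ (U.cmp F' c).inv :=
  U.preimage_app _ c

/-- The unit constraint of the left biadjoint. -/
noncomputable def mapId (C : Lex.{w} R) : U.ext ⟨BasedFunctor.id C.toBased, IsLexFunctor.id _⟩ ≅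
    ⟨BasedFunctor.id (U.obj C).toBased, IsPositiveFunctor.id _⟩ :=
  (U.restrict C (U.obj C)).preimageIso (U.extIso ⟨BasedFunctor.id C.toBased, IsLexFunctor.id _⟩)

lemma mapId_hom_app (c : C.toBased.obj) :
    (U.mapId C).hom.hom.toNatTrans.app ((U.unit C).obj.obj c) =
      (U.cmp ⟨BasedFunctor.id C.toBased, IsLexFunctor.id _⟩ c).hom :=
  U.preimage_app _ c

end

section

variable {C D E : Lex.{w} R} (F : LexFun C.toBased D.toBased) (G : LexFun D.toBased E.toBased)

/-- The composite of the extensions of `F` and `G` restricts to the composite of `F` and `G`. -/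
noncomputable def extCompIso : (U.restrict C (U.obj E)).obj
    ⟨(U.ext F).obj.comp (U.ext G).obj, (U.ext F).property.comp (U.ext G).property⟩ ≅
      compLex (compLex F G) (U.unit E) where
  hom := ObjectProperty.homMk (BasedCategory.whiskerRight (U.extIso F).hom.hom (U.ext G).obj ≫
    BasedCategory.whiskerLeft F.obj (U.extIso G).hom.hom)
  inv := ObjectProperty.homMk (BasedCategory.whiskerLeft F.obj (U.extIso G).inv.hom ≫
    BasedCategory.whiskerRight (U.extIso F).inv.hom (U.ext G).obj)
  hom_inv_id := fun_hom_ext fun c => by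
    change ((U.ext G).obj.map (U.cmp F c).hom ≫ (U.cmp G _).hom) ≫
      (U.cmp G _).inv ≫ (U.ext G).obj.map (U.cmp F c).inv = 𝟙 _
    rw [Category.assoc, Iso.hom_inv_id_assoc, ← Functor.map_comp, Iso.hom_inv_id]
    exact (U.ext G).obj.map_id _
  inv_hom_id := fun_hom_ext fun c => by
    change ((U.cmp G _).inv ≫ (U.ext G).obj.map (U.cmp F c).inv) ≫
      (U.ext G).obj.map (U.cmp F c).hom ≫ (U.cmp G _).hom = 𝟙 _
    rw [Category.assoc, ← Functor.map_comp_assoc, Iso.inv_hom_id]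
    exact (congrArg (_ ≫ · ≫ _) ((U.ext G).obj.map_id _)).trans (by simp)

/-- The composition constraint of the left biadjoint. -/
noncomputable def mapComp : U.ext (compLex F G) ≅
    ⟨(U.ext F).obj.comp (U.ext G).obj, (U.ext F).property.comp (U.ext G).property⟩ :=
  (U.restrict C (U.obj E)).preimageIso (U.extIso (compLex F G) ≪≫ (U.extCompIso F G).symm)

lemma mapComp_hom_app (c : C.toBased.obj) :
    (U.mapComp F G).hom.hom.toNatTrans.app ((U.unit C).obj.obj c) =
      (U.cmp (compLex F G) c).hom ≫ (U.cmp G (F.obj.obj c)).inv ≫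
        (U.ext G).obj.map (U.cmp F c).inv :=
  U.preimage_app _ c

lemma mapComp_inv_app (c : C.toBased.obj) :
    (U.mapComp F G).inv.hom.toNatTrans.app ((U.unit C).obj.obj c) =
      (U.ext G).obj.map (U.cmp F c).hom ≫ (U.cmp G (F.obj.obj c)).hom ≫
        (U.cmp (compLex F G) c).inv :=
  (U.preimage_app _ c).trans (Category.assoc _ _ _)

end

end UniversalArrows

end Biadjoint

/-! ### Coherence of the left biadjoint

The axioms of a pseudofunctor, on components and with all the data made abstract. -/

section Coherence

variable {C : Type u₁} [Category.{v₁} C] {D : Type u₂} [Category.{v₂} D] {E : Type u₃}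
  [Category.{v₃} E]

lemma map_id_comp (K : D ⥤ E) {P : D} {Q : E} (f : K.obj P ⟶ Q) : K.map (𝟙 P) ≫ f = f := by simp

lemma coherence_whiskerLeft {K K' : D ⥤ E} (t : K ⟶ K') {P Q : D} (i : P ≅ Q) {S S' W W' : E}
    {j : K.obj Q ≅ S} {j' : K'.obj Q ≅ S'} {m : S ⟶ S'} (ht : t.app Q = j.hom ≫ m ≫ j'.inv)
    (x : W ⟶ S) (x' : S' ⟶ W') :
    (x ≫ j.inv ≫ K.map i.inv) ≫ t.app P ≫ K'.map i.hom ≫ j'.hom ≫ x' = x ≫ m ≫ x' := by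
  have h : t.app P ≫ K'.map i.hom = K.map i.hom ≫ j.hom ≫ m ≫ j'.inv := by rw [← ht, t.naturality]
  rw [reassoc_of% h]
  simp

lemma coherence_whiskerRight {K : D ⥤ E} {P P' Q Q' : D} (i : P ≅ Q) (i' : P' ≅ Q') {m : Q ⟶ Q'}
    {S S' W W' : E} {j : K.obj Q ≅ S} {j' : K.obj Q' ≅ S'} {n : S ⟶ S'}
    (hn : K.map m ≫ j'.hom = j.hom ≫ n) (x : W ⟶ S) (x' : S' ⟶ W') :
    (x ≫ j.inv ≫ K.map i.inv) ≫ K.map (i.hom ≫ m ≫ i'.inv) ≫ K.map i'.hom ≫ j'.hom ≫ x' =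
      x ≫ n ≫ x' := by
  have h : K.map m ≫ j'.hom ≫ x' = j.hom ≫ n ≫ x' := by
    rw [← Category.assoc, hn, Category.assoc]
  rw [K.map_comp, K.map_comp]
  rw [Category.assoc, Category.assoc, Category.assoc, Category.assoc, Iso.map_inv_hom_id_assoc,
    Iso.map_inv_hom_id_assoc, h, Iso.inv_hom_id_assoc]

lemma coherence_associator {L : C ⥤ D} {K : D ⥤ E} {M : C ⥤ E} (t : L ⋙ K ⟶ M) {P Q : C}
    (f : P ≅ Q) {Y Z : D} (y : Y ≅ Z) (g : L.obj Q ≅ Z) {S W W' : E} (h : K.obj Z ≅ S)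
    (z : M.obj Q ≅ S) (ht : t.app Q = K.map g.hom ≫ h.hom ≫ z.inv) (x : W ⟶ S) (x' : S ⟶ W') :
    (x ≫ h.inv ≫ K.map y.inv) ≫ K.map (y.hom ≫ g.inv ≫ L.map f.inv) ≫ 𝟙 _ ≫
      t.app P ≫ M.map f.hom ≫ z.hom ≫ x' = x ≫ x' := by
  have h₁ : t.app P ≫ M.map f.hom = K.map (L.map f.hom) ≫ K.map g.hom ≫ h.hom ≫ z.inv := by
    rw [← ht]
    exact (t.naturality f.hom).symm
  rw [reassoc_of% h₁]
  have h₂ (k : K.obj (L.obj Q) ⟶ W') :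
      K.map (L.map f.inv) ≫ K.map (L.map f.hom) ≫ k = k := by
    rw [← K.map_comp_assoc, ← L.map_comp, f.inv_hom_id, L.map_id, K.map_id, Category.id_comp]
  rw [K.map_comp, K.map_comp]
  simp only [Category.assoc, Category.id_comp, Iso.map_inv_hom_id_assoc, Iso.inv_hom_id_assoc, h₂]

lemma coherence_rightUnitor {K : D ⥤ D} (t : K ⟶ 𝟭 D) {P Q W : D} (f : P ≅ Q) (j : K.obj Q ≅ Q)
    (ht : t.app Q = j.hom) (x : W ⟶ Q) :
    (x ≫ j.inv ≫ K.map f.inv) ≫ t.app P ≫ 𝟙 _ = x ≫ f.inv := by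
  have := t.naturality f.inv
  simp_all

end Coherence

/-! ### The pseudofunctor and its unit -/

section Biadjoint

open BasedFunctor BasedNatTrans Bicategory

variable {R : Type u₁} [Category.{v₁} R]

namespace UniversalArrows

variable (U : UniversalArrows.{w} R)

/-- The left biadjoint defined by universal arrows. -/
noncomputable def leftBiadjoint : Pseudofunctor (Lex.{w} R) (Pretop.{w} R) where
  obj := U.obj
  map F := U.ext F
  map₂ α := U.map₂ α
  map₂_id F := U.hom_ext fun c => by
    refine (U.map₂_app _ c).trans ?_
    refine (congrArg (fun k => _ ≫ k ≫ _) ((U.unit _).obj.map_id _)).trans ?_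
    exact (congrArg (_ ≫ ·) (Category.id_comp _)).trans (Iso.hom_inv_id _)
  map₂_comp {C D F G H} α β := U.hom_ext fun c => by
    refine (U.map₂_app _ c).trans (Eq.trans ?_
      (congrArg₂ (· ≫ ·) (U.map₂_app α c) (U.map₂_app β c)).symm)
    refine (congrArg (fun k => _ ≫ k ≫ _) ((U.unit _).obj.map_comp _ _)).trans ?_
    simp only [Category.assoc, Iso.inv_hom_id_assoc]
  mapId C := U.mapId C
  mapComp F G := U.mapComp F G
  map₂_whisker_left {C D E} F {G H} α := U.hom_ext fun c => by
    refine (U.map₂_app _ c).trans (Eq.symm ?_)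
    change (U.mapComp F G).hom.hom.toNatTrans.app _ ≫ (U.map₂ α).hom.toNatTrans.app _ ≫
      (U.mapComp F H).inv.hom.toNatTrans.app _ = _
    rw [mapComp_hom_app, mapComp_inv_app]
    exact coherence_whiskerLeft (U.map₂ α).hom.toNatTrans (U.cmp F c) (U.map₂_app α _) _ _
  map₂_whisker_right {C D E F G} α H := U.hom_ext fun c => by
    refine (U.map₂_app _ c).trans (Eq.symm ?_)
    change (U.mapComp F H).hom.hom.toNatTrans.app _ ≫
      (U.ext H).obj.map ((U.map₂ α).hom.toNatTrans.app _) ≫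
      (U.mapComp G H).inv.hom.toNatTrans.app _ = _
    rw [mapComp_hom_app, mapComp_inv_app, map₂_app]
    exact coherence_whiskerRight (K := (U.ext H).obj.toFunctor) (U.cmp F c) (U.cmp G c)
      (U.cmp_naturality H (α.hom.toNatTrans.app c)) _ _
  map₂_associator {A B C D} F G H := U.hom_ext fun c => by
    refine (U.map₂_app _ c).trans (Eq.symm ?_)
    change (U.mapComp (compLex F G) H).hom.hom.toNatTrans.app _ ≫
      (U.ext H).obj.map ((U.mapComp F G).hom.hom.toNatTrans.app _) ≫ 𝟙 _ ≫
      (U.mapComp G H).inv.hom.toNatTrans.app _ ≫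
      (U.mapComp F (compLex G H)).inv.hom.toNatTrans.app _ = _ ≫ (U.unit D).obj.map (𝟙 _) ≫ _
    rw [mapComp_hom_app, mapComp_inv_app, mapComp_hom_app]
    refine Eq.trans ?_ (congrArg (_ ≫ ·) (map_id_comp (U.unit D).obj.toFunctor _)).symm
    exact coherence_associator (U.mapComp G H).inv.hom.toNatTrans (U.cmp F c)
      (U.cmp (compLex F G) c) (U.cmp G _) (U.cmp H _) (U.cmp (compLex G H) _)
      (U.mapComp_inv_app G H _) _ _
  map₂_left_unitor {C D} F := U.hom_ext fun c => by
    refine (U.map₂_app _ c).trans (Eq.symm ?_)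
    change (U.mapComp ⟨BasedFunctor.id C.toBased, IsLexFunctor.id _⟩ F).hom.hom.toNatTrans.app _ ≫
      (U.ext F).obj.map ((U.mapId C).hom.hom.toNatTrans.app _) ≫ 𝟙 _ =
        _ ≫ (U.unit D).obj.map (𝟙 _) ≫ _
    rw [mapComp_hom_app, mapId_hom_app]
    refine Eq.trans ?_ (congrArg (_ ≫ ·) (map_id_comp (U.unit D).obj.toFunctor _)).symm
    refine (congrArg (_ ≫ ·) (Category.comp_id _)).trans ((Category.assoc _ _ _).trans
      (congrArg (_ ≫ ·) ((Category.assoc _ _ _).trans (Eq.trans (congrArg (_ ≫ ·) ?_)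
        (Category.comp_id _)))))
    exact ((U.ext F).obj.mapIso (U.cmp _ c)).inv_hom_id
  map₂_right_unitor {C D} F := U.hom_ext fun c => by
    refine (U.map₂_app _ c).trans (Eq.symm ?_)
    change (U.mapComp F ⟨BasedFunctor.id D.toBased, IsLexFunctor.id _⟩).hom.hom.toNatTrans.app _ ≫
      (U.mapId D).hom.hom.toNatTrans.app _ ≫ 𝟙 _ =
        _ ≫ (U.unit D).obj.map (𝟙 _) ≫ _
    rw [mapComp_hom_app]
    refine Eq.trans ?_ (congrArg (_ ≫ ·) (map_id_comp (U.unit D).obj.toFunctor _)).symm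
    exact coherence_rightUnitor (U.mapId D).hom.hom.toNatTrans (U.cmp F c) (U.cmp _ _)
      (U.mapId_hom_app _) _

/-- The universal arrows are the components of a pseudonatural transformation. -/
noncomputable def unitTrans :
    Pseudofunctor.StrongTrans (Pseudofunctor.id (Lex.{w} R)) (U.leftBiadjoint.comp (forget R)) where
  app C := U.unit C
  naturality F := (U.extIso F).symm
  naturality_naturality {C D F G} α := fun_hom_ext fun (c : C.toBased.obj) => by
    change (U.unit D).obj.map (α.hom.toNatTrans.app c) ≫ (U.cmp G c).inv =
      (U.cmp F c).inv ≫ (U.map₂ α).hom.toNatTrans.app _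
    rw [map₂_app, Iso.inv_hom_id_assoc]
  naturality_id C := fun_hom_ext fun (c : C.toBased.obj) => by
    change (U.cmp ⟨BasedFunctor.id C.toBased, IsLexFunctor.id _⟩ c).inv ≫
      (U.mapId C).hom.hom.toNatTrans.app ((U.unit C).obj.obj c) ≫ 𝟙 ((U.unit C).obj.obj c) =
        (U.unit C).obj.map (𝟙 c) ≫ 𝟙 ((U.unit C).obj.obj c) ≫ 𝟙 ((U.unit C).obj.obj c)
    rw [mapId_hom_app]
    refine Eq.trans ?_ ((map_id_comp (U.unit C).obj.toFunctor _).trans (Category.id_comp _)).symm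
    exact (congrArg (_ ≫ ·) (Category.comp_id _)).trans (Iso.inv_hom_id _)
  naturality_comp {C D E} F G := fun_hom_ext fun (c : C.toBased.obj) => by
    change (U.cmp (compLex F G) c).inv ≫ (U.mapComp F G).hom.hom.toNatTrans.app _ ≫ 𝟙 _ =
      (U.unit E).obj.map (𝟙 _) ≫ 𝟙 _ ≫ (U.cmp G _).inv ≫ 𝟙 _ ≫
        (U.ext G).obj.map (U.cmp F c).inv ≫ 𝟙 _
    rw [mapComp_hom_app]
    refine Eq.trans ?_ ((map_id_comp (U.unit E).obj.toFunctor _).trans (Category.id_comp _)).symm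
    refine (congrArg (_ ≫ ·) (Category.comp_id _)).trans (Eq.trans (Iso.inv_hom_id_assoc _ _)
      (congrArg (_ ≫ ·) ?_))
    exact (Category.comp_id _).symm.trans (Category.id_comp _).symm

/-- The hom-functors in question are given by precomposition with the universal arrows. -/
theorem isLeftBiadjoint_leftBiadjoint :
    IsLeftBiadjoint U.leftBiadjoint (forget R) U.unitTrans :=
  fun C X => U.isEquivalence C X

end UniversalArrows

end Biadjoint

end FibPsh

theorem lemma3p1p14 {R : Type u₁} [Category.{v₁} R] [Regular R] :
    -- the fibered Yoneda embedding is full and faithful and has the universal property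
    (∀ C : BasedCategory.{v₂, u₂} R, ∀ [FibPsh.IsLexPreStack C.p],
      (FibPsh.yoneda C.p).toFunctor.Full ∧ (FibPsh.yoneda C.p).toFunctor.Faithful ∧
      FibPsh.IsFiberedPretopos (FibPsh.presheaves C.p).p ∧
      ∃ hY : FibPsh.IsLexFunctor (FibPsh.yoneda C.p),
        ∀ X : BasedCategory.{v₃, u₃} R, FibPsh.IsFiberedPretopos X.p →
          (FibPsh.precomp (FibPsh.yoneda C.p) hY X).IsEquivalence) ∧
    -- the presheaf construction is left biadjoint to the forgetful functor, with unit Yoneda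
    (∃ (hP : ∀ C : FibPsh.Lex.{max w u₁ v₁} R,
          FibPsh.IsFiberedPretopos (FibPsh.presheaves C.toBased.p).p)
        (hY : ∀ C : FibPsh.Lex.{max w u₁ v₁} R, FibPsh.IsLexFunctor (FibPsh.yoneda C.toBased.p))
        (L : Pseudofunctor (FibPsh.Lex.{max w u₁ v₁} R) (FibPsh.Pretop.{max w u₁ v₁} R))
        (η : Pseudofunctor.StrongTrans (Pseudofunctor.id (FibPsh.Lex.{max w u₁ v₁} R))
          (L.comp (FibPsh.forget R))),
      (∀ C, L.obj C = C.presheaves (hP C)) ∧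
      (∀ C, η.app C ≍ C.yoneda (hP C) (hY C)) ∧
      FibPsh.IsLeftBiadjoint L (FibPsh.forget R) η) := by
  refine ⟨fun C _ => ?_, ?_⟩
  · have hP := FibPsh.isFiberedPretopos_presheaves C.p
    have hY := FibPsh.isDense_yoneda C.p
    have : FibPsh.IsLexPreStack (BasedCategory.ofFunctor C.p).p :=
      inferInstanceAs (FibPsh.IsLexPreStack C.p)
    exact ⟨hY.full, hY.faithful, hP, hY.isLexFunctor, fun X _ => hY.precomp_isEquivalence X⟩
  · let hP (C : FibPsh.Lex.{max w u₁ v₁} R) := FibPsh.isFiberedPretopos_presheaves C.toBased.p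
    let hY (C : FibPsh.Lex.{max w u₁ v₁} R) := FibPsh.isLexFunctor_yoneda C.toBased.p
    let U : FibPsh.UniversalArrows.{max w u₁ v₁} R :=
      { obj C := C.presheaves (hP C)
        unit C := C.yoneda (hP C) (hY C)
        isEquivalence C X :=
          have := hP C
          have : FibPsh.IsLexPreStack (BasedCategory.ofFunctor C.toBased.p).p := C.isLexPreStack
          (FibPsh.isDense_yoneda C.toBased.p).precomp_isEquivalence X.toBased }
    exact ⟨hP, hY, U.leftBiadjoint, U.unitTrans, fun C => rfl, fun C => HEq.rfl,
      U.isLeftBiadjoint_leftBiadjoint⟩
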